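/- **Setting.** Let $\mathrm{Sp}_2(\mathbb R)$ be the group of real $4\times4$ matrices $g$ with $g'Jg=J$, where $J=\begin{pmatrix}0&-1\\1&0\end{pmatrix}$ in $2\times 2$ blocks and $'$ denotes transpose. For a positive integer $N$ let $K(N)$ be the paramodular group, i.e. the group of rational symplectic $4\times 4$ matrices that stabilize the column lattice $\mathbb Z\oplus\mathbb Z\oplus\mathbb Z\oplus N\mathbb Z$. Let $\mathcal H_2$ be the Siegel upper half space of degree $2$. For a real matrix $g=\begin{pmatrix}a&b\\c&d\end{pmatrix}$ with $g'Jg=m(g)J$, $m(g)>0$, and $f:\mathcal H_2\to\mathbb C$ put $$(f|_kg)(\Omega)=m(g)^{2k-3}\det(c\Omega+d)^{-k}f\big((a\Omega+b)(c\Omega+d)^{-1}\big).$$ $S_k(K(N))$ is the space of holomorphic $f:\mathcal H_2\to\mathbb C$ with $f|_k\gamma=f$ for all $\gamma\in K(N)$ and $\lim_{y\to+\infty}(f|_kg)\begin{pmatrix}\tau&0\\0&iy\end{pmatrix}=0$ for all $g\in\mathrm{Sp}_2(\mathbb Q)$ and all $\tau$ in the upper half plane. Such $f$ has a Fourier expansion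 $f(\Omega)=\sum_t a(t;f)\,e^{2\pi i\,\mathrm{tr}(t\Omega)}$ over the matrices $t=\begin{pmatrix}n&r/2\\r/2&mN\end{pmatrix}$ with $n,m\in\mathbb Z_{\ge0}$, $r\in\mathbb Z$, $4nmN-r^2\ge0$; let $\mathcal X_2(N)$ be the set of those $t$ with $4nmN-r^2>0$. For a positive divisor $c$ of $N$ with $\gcd(c,N/c)=1$, the Atkin–Lehner involution at $c$ is $f\mapsto f|_k\begin{pmatrix}(\alpha_c^{-1})'&0\\0&\alpha_c\end{pmatrix}$, where $\alpha_c=\frac1{\sqrt c}\begin{pmatrix}\alpha c&\beta\\\gamma N&\delta c\end{pmatrix}$ for any integers $\alpha,\beta,\gamma,\delta$ with $\alpha\delta c-\beta\gamma N/c=1$; for $c=N$ it is the Fricke involution, and one may take $\alpha_N=\frac1{\sqrt N}\begin{pmatrix}0&-1\\N&0\end{pmatrix}$. The double coset $K(N)\,\mathrm{diag}(d_1,d_2,d_3,d_4)\,K(N)=\bigsqcup_jK(N)t_j$ defines the Hecke operator $f\mapsto\sum_jf|_kt_j$. Let $T(p)$, $T_1(p^2)$, $T_{0,1}(p^2)$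 be the Hecke operators of $\mathrm{diag}(1,1,p,p)$, $\mathrm{diag}(1,p,p^2,p)$, $\mathrm{diag}(p,p^2,p,1)$ respectively. An eigenform is by definition nonzero, and $\lambda_f(T)$ denotes the eigenvalue of an eigenform $f$ of $T$. **Lemma.** Let $k\ge3$ and $N\ge1$ be integers and let $p$ be a prime with $p\nmid N$ or $p\,\|\,N$. Let $K$ be a number field with a fixed embedding into $\mathbb C$, with ring of integers $\mathcal O_K$. Let $f,g\in S_k(K(N))$ be such that all Fourier coefficients of $f$ lie in $\mathbb Z$ and generate the unit ideal of $\mathbb Z$, and all Fourier coefficients of $g$ lie in $\mathcal O_K$. Suppose that $f$ and $g$ are eigenfunctions of the Fricke involution with the same sign $\pm1$ and, if $p\,\|\,N$, also of the Atkin–Lehner involution at $p$ with the same sign $\epsilon_p=\pm1$. Let $\mathfrak a\subseteq\mathcal O_K$ be an ideal with $$a(t;f)\equiv a(t;g)\bmod\mathfrak a\quad\text{for all }t\in\mathcal X_2(N).$$ 1. Let $T$ be $T(p)$ or $T_1(p^2)$ if $p\nmid N$, and $T(p)$ or $T_{0,1}(p^2)$ if $p\,\|\,N$. If $f$ and $g$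 are eigenforms of $T$, then $\lambda_f(T)\in\mathbb Z$, $\lambda_g(T)\in\mathcal O_K$ and $\lambda_f(T)\equiv\lambda_g(T)\bmod\mathfrak a$. 2. If $f$ and $g$ are eigenforms of both of these operators, then their $p$-Euler polynomials have coefficients in $\mathbb Z$ and $\mathcal O_K$ respectively and are congruent modulo $\mathfrak a$, coefficient by coefficient. Here the $p$-Euler polynomial of $h\in\{f,g\}$ is $$Q_p(h,x)=1-\lambda_h(T(p))x+\big(p\lambda_h(T_1(p^2))+p^{2k-5}(1+p^2)\big)x^2-p^{2k-3}\lambda_h(T(p))x^3+p^{4k-6}x^4$$ if $p\nmid N$, and $$Q_p(h,x)=1-\big(\lambda_h(T(p))+p^{k-3}\epsilon_p\big)x+\big(p\lambda_h(T_{0,1}(p^2))+p^{2k-3}\big)x^2+p^{3k-5}\epsilon_px^3$$ if $p\,\|\,N$. -/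

import Mathlib

open scoped Polynomial

noncomputable section

namespace Paramodular

open Matrix Filter Topology

/-- The index set of `4 × 4` matrices in `2 × 2` blocks; the four coordinates are, in this order,
`inl 0`, `inl 1`, `inr 0`, `inr 1`. -/
abbrev Ix : Type := Fin 2 ⊕ Fin 2

/-- The column lattice `ℤ ⊕ ℤ ⊕ ℤ ⊕ N ℤ`, inside `ℝ⁴`. -/
def lattice (N : ℕ) : Set (Ix → ℝ) :=
  {v | (∃ n : ℤ, v (Sum.inl 0) = n) ∧ (∃ n : ℤ, v (Sum.inl 1) = n) ∧
    (∃ n : ℤ, v (Sum.inr 0) = n) ∧ (∃ n : ℤ, v (Sum.inr 1) = N * n)}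

/-- The paramodular group `K(N)` of degree two and level `N`: the symplectic matrices `g` with
`g L = L` for the lattice `L = ℤ ⊕ ℤ ⊕ ℤ ⊕ N ℤ` (for `N ≥ 1` such matrices are automatically
rational, because `L` spans `ℚ⁴`). The symplectic form is Mathlib's `Matrix.J`, with blocks
`0, -1, 1, 0`. -/
def paramodularGroup (N : ℕ) : Subgroup (GL Ix ℝ) where
  carrier := {g | (g : Matrix Ix Ix ℝ) ∈ symplecticGroup (Fin 2) ℝ ∧
    ∀ v : Ix → ℝ, (g : Matrix Ix Ix ℝ) *ᵥ v ∈ lattice N ↔ v ∈ lattice N}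
  one_mem' := by
    refine ⟨?_, fun v => ?_⟩
    · simp
    · simp
  mul_mem' := by
    rintro a b ⟨ha, ha'⟩ ⟨hb, hb'⟩
    refine ⟨?_, fun v => ?_⟩
    · simpa using (symplecticGroup (Fin 2) ℝ).mul_mem ha hb
    · rw [Units.val_mul, ← mulVec_mulVec, ha', hb']
  inv_mem' := by
    rintro a ⟨ha, ha'⟩
    refine ⟨?_, fun v => ?_⟩
    · have h := ((⟨_, ha⟩ : symplecticGroup (Fin 2) ℝ)⁻¹).2
      rw [SymplecticGroup.coe_inv'] at h
      simpa [coe_units_inv] using h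
    · rw [← ha' ((a⁻¹ : GL Ix ℝ) *ᵥ v), mulVec_mulVec, ← Units.val_mul]
      simp

/-- The Siegel upper half space of degree two: symmetric complex `2 × 2` matrices with positive
definite imaginary part. -/
def siegelUpperHalfSpace : Set (Matrix (Fin 2) (Fin 2) ℂ) :=
  {Ω | Ω.IsSymm ∧ (Ω.map Complex.im).PosDef}

/-- The symmetric matrix with entries `τ, z, z, ω`. -/
def point (τ z ω : ℂ) : Matrix (Fin 2) (Fin 2) ℂ := !![τ, z; z, ω]

/-- `c Ω + d`, for a matrix `g` with lower blocks `c, d`. -/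
def denom (g : Matrix Ix Ix ℝ) (Ω : Matrix (Fin 2) (Fin 2) ℂ) : Matrix (Fin 2) (Fin 2) ℂ :=
  g.toBlocks₂₁.map Complex.ofReal * Ω + g.toBlocks₂₂.map Complex.ofReal

/-- The fractional linear transformation `(a Ω + b) (c Ω + d)⁻¹`. -/
def moebius (g : Matrix Ix Ix ℝ) (Ω : Matrix (Fin 2) (Fin 2) ℂ) : Matrix (Fin 2) (Fin 2) ℂ :=
  (g.toBlocks₁₁.map Complex.ofReal * Ω + g.toBlocks₁₂.map Complex.ofReal) * (denom g Ω)⁻¹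

/-- The multiplier of a symplectic similitude: if `gᵀ J g = m J`, this is `m`, since the entry of
`J` at this place is `1`. -/
def multiplier (g : Matrix Ix Ix ℝ) : ℝ :=
  (gᵀ * J (Fin 2) ℝ * g) (Sum.inr 0) (Sum.inl 0)

/-- The weight `k` slash operator in the arithmetic normalization,
`(f | g)(Ω) = m(g)^(2k-3) det(c Ω + d)^(-k) f(g Ω)`; it is only used for symplectic similitudes `g`
of positive multiplier and at points `Ω` of the Siegel upper half space. -/
def slash (k : ℕ) (f : Matrix (Fin 2) (Fin 2) ℂ → ℂ) (g : Matrix Ix Ix ℝ)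
    (Ω : Matrix (Fin 2) (Fin 2) ℂ) : ℂ :=
  (multiplier g : ℂ) ^ (2 * (k : ℤ) - 3) * (denom g Ω).det ^ (-(k : ℤ)) * f (moebius g Ω)

/-- `f` (of which only the values on the Siegel upper half space matter) is a paramodular form of
weight `k` and level `N`: it is holomorphic in the coordinates `τ, z, ω` and invariant under
`K(N)`. -/
structure IsParamodularForm (k N : ℕ) (f : Matrix (Fin 2) (Fin 2) ℂ → ℂ) : Prop where
  holomorphic : DifferentiableOn ℂ (fun x : ℂ × ℂ × ℂ => f (point x.1 x.2.1 x.2.2))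
    {x | point x.1 x.2.1 x.2.2 ∈ siegelUpperHalfSpace}
  invariant : ∀ γ ∈ paramodularGroup N, ∀ Ω ∈ siegelUpperHalfSpace,
    slash k f (γ : Matrix Ix Ix ℝ) Ω = f Ω

/-- `f` is a paramodular cusp form: the Siegel operator
`(Φ h)(τ) = lim_{y → +∞} h(diag(τ, i y))` kills `f | g` for all rational symplectic `g`. -/
structure IsCuspForm (k N : ℕ) (f : Matrix (Fin 2) (Fin 2) ℂ → ℂ) : Prop
    extends IsParamodularForm k N f where
  cuspidal : ∀ g ∈ symplecticGroup (Fin 2) ℚ, ∀ τ : ℂ, 0 < τ.im →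
    Tendsto (fun y : ℝ => slash k f (g.map (fun x : ℚ => (x : ℝ)))
      (point τ 0 (Complex.I * y))) atTop (𝓝 0)

/-- The index set of Fourier expansions in level `N`: the triple `(n, r, m)` stands for the
positive semidefinite matrix with entries `n, r/2, r/2, m N`. -/
def indexSemi (N : ℕ) : Set (ℤ × ℤ × ℤ) :=
  {t | 0 ≤ t.1 ∧ 0 ≤ t.2.2 ∧ 0 ≤ 4 * t.1 * t.2.2 * N - t.2.1 ^ 2}

/-- The triples whose matrix is positive definite. -/
def indexDef (N : ℕ) : Set (ℤ × ℤ × ℤ) :=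
  {t | 0 ≤ t.1 ∧ 0 ≤ t.2.2 ∧ 0 < 4 * t.1 * t.2.2 * N - t.2.1 ^ 2}

/-- The matrix with entries `n, r/2, r/2, m N` of a triple `(n, r, m)`. -/
def indexMatrix (N : ℕ) (t : ℤ × ℤ × ℤ) : Matrix (Fin 2) (Fin 2) ℂ :=
  !![(t.1 : ℂ), (t.2.1 : ℂ) / 2; (t.2.1 : ℂ) / 2, (t.2.2 : ℂ) * N]

/-- The Fourier expansion of `f` has the coefficients `a`:
`f(Ω) = ∑ₜ a(t) exp(2 π i tr(t Ω))` on the Siegel upper half space. -/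
def HasFourierCoeffs (N : ℕ) (f : Matrix (Fin 2) (Fin 2) ℂ → ℂ) (a : indexSemi N → ℂ) : Prop :=
  ∀ Ω ∈ siegelUpperHalfSpace,
    HasSum (fun t : indexSemi N =>
      a t * Complex.exp (2 * Real.pi * Complex.I * (indexMatrix N t * Ω).trace)) (f Ω)

/-- The elliptic Atkin--Lehner matrix with rows `(α c, β)`, `(γ N, δ c)`, divided by `√c`. -/
def ellipticAL (N c : ℕ) (α β γ δ : ℤ) : Matrix (Fin 2) (Fin 2) ℝ :=
  (Real.sqrt c)⁻¹ • !![(α : ℝ) * c, (β : ℝ); (γ : ℝ) * N, (δ : ℝ) * c]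

/-- The paramodular Atkin--Lehner matrix with diagonal blocks `(α_c⁻¹)ᵀ` and `α_c`. -/
def paramodularAL (N c : ℕ) (α β γ δ : ℤ) : Matrix Ix Ix ℝ :=
  fromBlocks ((ellipticAL N c α β γ δ)⁻¹)ᵀ 0 0 (ellipticAL N c α β γ δ)

/-- `f` is an eigenfunction of the Fricke involution with sign `ε`. The elliptic Fricke matrix has
rows `(0, -1)`, `(N, 0)`, divided by `√N`. -/
def HasFrickeSign (k N : ℕ) (f : Matrix (Fin 2) (Fin 2) ℂ → ℂ) (ε : ℤ) : Prop :=
  ∀ Ω ∈ siegelUpperHalfSpace, slash k f (paramodularAL N N 0 (-1) 1 0) Ω = ε * f Ω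

/-- `f` is an eigenfunction of the Atkin--Lehner involution at the divisor `c` of `N` (with `c` and
`N / c` coprime) with sign `ε`. On forms of level `N` all matrices `α_c` with
`α δ c - β γ N / c = 1` give the same action. -/
def HasAtkinLehnerSign (k N c : ℕ) (f : Matrix (Fin 2) (Fin 2) ℂ → ℂ) (ε : ℤ) : Prop :=
  ∃ α β γ δ : ℤ, α * δ * (c : ℤ) - β * γ * ((N / c : ℕ) : ℤ) = 1 ∧
    ∀ Ω ∈ siegelUpperHalfSpace, slash k f (paramodularAL N c α β γ δ) Ω = ε * f Ω

/-- The double coset `K(N) diag(d) K(N)`. -/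
def doubleCoset (N : ℕ) (d : Ix → ℝ) : Set (GL Ix ℝ) :=
  {g | ∃ γ ∈ paramodularGroup N, ∃ γ' ∈ paramodularGroup N,
    (g : Matrix Ix Ix ℝ) = (γ : Matrix Ix Ix ℝ) * diagonal d * (γ' : Matrix Ix Ix ℝ)}

/-- The Hecke operator of a double coset `⊔ⱼ K(N) tⱼ`, that is `f ↦ ∑ⱼ f | tⱼ`. The sum runs over
the elements `K(N) t` of `K(N) \ GL₄(ℝ)` that lie in the double coset, with a chosen
representative of each; there are finitely many for the rational diagonals used below. -/
def hecke (k N : ℕ) (d : Ix → ℝ) (f : Matrix (Fin 2) (Fin 2) ℂ → ℂ)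
    (Ω : Matrix (Fin 2) (Fin 2) ℂ) : ℂ :=
  ∑ᶠ (c : Quotient (QuotientGroup.rightRel (paramodularGroup N)))
    (_ : c.out ∈ doubleCoset N d), slash k f (c.out : Matrix Ix Ix ℝ) Ω

/-- The diagonal `(1, 1, p, p)`, of the operator `T(p)`. -/
def diagT (p : ℕ) : Ix → ℝ := Sum.elim ![1, 1] ![(p : ℝ), (p : ℝ)]

/-- The diagonal `(1, p, p², p)`, of the operator `T₁(p²)`. -/
def diagT1 (p : ℕ) : Ix → ℝ := Sum.elim ![1, (p : ℝ)] ![(p : ℝ) ^ 2, (p : ℝ)]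

/-- The diagonal `(p, p², p, 1)`, of the operator `T₀₁(p²)`. -/
def diagT01 (p : ℕ) : Ix → ℝ := Sum.elim ![(p : ℝ), (p : ℝ) ^ 2] ![(p : ℝ), 1]

/-- The second operator at the prime `p`: `T₁(p²)` if `p ∤ N`, and `T₀₁(p²)` if `p ∣ N`. -/
def diagSecond (N p : ℕ) : Ix → ℝ := open Classical in if p ∣ N then diagT01 p else diagT1 p

/-- `f` is a (nonzero) eigenform with eigenvalue `lam` of the Hecke operator of
`K(N) diag(d) K(N)`. -/
def IsEigenform (k N : ℕ) (d : Ix → ℝ) (f : Matrix (Fin 2) (Fin 2) ℂ → ℂ) (lam : ℂ) : Prop :=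
  (∃ Ω ∈ siegelUpperHalfSpace, f Ω ≠ 0) ∧
    ∀ Ω ∈ siegelUpperHalfSpace, hecke k N d f Ω = lam * f Ω

/-- The `p`-Euler polynomial of an eigenform, for `p ∤ N`: here `l` and `l'` are the eigenvalues of
`T(p)` and `T₁(p²)`. -/
def eulerPolyGood (k p : ℕ) (l l' : ℂ) : ℂ[X] :=
  1 - Polynomial.C l * Polynomial.X
    + Polynomial.C (p * l' + p ^ (2 * k - 5) * (1 + p ^ 2)) * Polynomial.X ^ 2
    - Polynomial.C (p ^ (2 * k - 3) * l) * Polynomial.X ^ 3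
    + Polynomial.C ((p : ℂ) ^ (4 * k - 6)) * Polynomial.X ^ 4

/-- The `p`-Euler polynomial of an eigenform, for `p` exactly dividing `N`: here `l` and `l'` are
the eigenvalues of `T(p)` and `T₀₁(p²)`, and `ε` is the Atkin--Lehner sign at `p`. -/
def eulerPolyBad (k p : ℕ) (ε : ℤ) (l l' : ℂ) : ℂ[X] :=
  1 - Polynomial.C (l + p ^ (k - 3) * ε) * Polynomial.X
    + Polynomial.C (p * l' + p ^ (2 * k - 3)) * Polynomial.X ^ 2
    + Polynomial.C ((p : ℂ) ^ (3 * k - 5) * ε) * Polynomial.X ^ 3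

open NumberField

/-- The complex numbers `x` and `y` lie in `ℤ` and in `𝓞 K` (embedded by `σ`), respectively, and
are congruent modulo the ideal `𝔞` of `𝓞 K`. -/
def CongruentMod {K : Type*} [Field K] [NumberField K] (σ : K →+* ℂ) (𝔞 : Ideal (𝓞 K))
    (x y : ℂ) : Prop :=
  ∃ (u : ℤ) (v : 𝓞 K), (u : ℂ) = x ∧ σ (v : K) = y ∧ (u : 𝓞 K) - v ∈ 𝔞

/-- The polynomials `P` and `Q` have coefficients in `ℤ` and in `𝓞 K` (embedded by `σ`),
respectively, and are congruent coefficient by coefficient modulo the ideal `𝔞`. -/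
def PolyCongruentMod {K : Type*} [Field K] [NumberField K] (σ : K →+* ℂ) (𝔞 : Ideal (𝓞 K))
    (P Q : ℂ[X]) : Prop :=
  ∀ i : ℕ, CongruentMod σ 𝔞 (P.coeff i) (Q.coeff i)

end Paramodular

end

/-!
The Fourier coefficients of `T f`, for each of the Hecke operators `T` in question, are integral
linear combinations of the Fourier coefficients of `f`, with coefficients that do not depend on `f`
(`exists_integral_hecke_formula`). Given this, the congruence is pure algebra
(`congruentMod_eigenvalue`): the coefficients of `f` generate the unit ideal, so `1 = ∑ cₜ a(t)` and
`λ_f = ∑ cₜ a(t; T f)` is an integer. The eigenvalue `λ_g` maps the finitely generated `ℤ`-module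
spanned by the coefficients of `g` to itself and is therefore an algebraic integer, and
`λ_g ≡ λ_g ∑ cₜ b(t) = ∑ cₜ b(t; T g) ≡ λ_f` modulo `𝔞`. Here the congruence between `a(t)` and
`b(t)` is needed for all `t`; at the singular `t` both coefficients vanish because `f` and `g` are
cusp forms (`IsCuspForm.coeff_eq_zero`): the limit in the definition of the Siegel operator is a
Fourier series, whose coefficients are Fourier coefficients at singular indices.

The integral formula is obtained without explicit representatives of the cosets. Let `m = p ^ μ` be
the multiplier of the double coset. An Iwasawa decomposition for `K(N)`, which holds since
`p² ∤ N` (`exists_mul_eq_patMat_upper`), gives each coset a representative `triMat N m α x`, acting by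
`Ω ↦ m⁻¹ (A Ω Aᵀ + S)`, where `A` has integral coordinates `α` and the symmetric matrix `S` has
integral coordinates `x`. It contributes `m⁻³ det(A)ᵏ a(s) exp(2 π i tr(s S) / m)` to the coefficient
of `T f` at `t`, where `Aᵀ s A = m t` (`eigenvalue_mul_coeff`). For a fixed `A` the vectors `x` that
occur form a set of vectors modulo `m`, and it remains to see that the sum over this set of
`m⁻³ det(A)ᵏ exp(2 π i tr(s S) / m)` is an integer (`exists_int_weighted_sum`). This rests on two
symmetries of the set.

* It is stable under translation by the image of `S ↦ A S Aᵀ`, since the double coset is stable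
  under right multiplication by upper unipotent matrices. The exponential is invariant under these
  translations, so its sum is an algebraic integer times the order of the image modulo `m`; this
  order times `det(A)³`, the determinant of `S ↦ A S Aᵀ`, is divisible by `m³`. Hence the expression
  is an algebraic integer, as `k ≥ 3`.
* It is stable under multiplication by integers `u` prime to `p` (`InCoset.smul_upper`). Averaging
  over `u` turns the exponentials into Ramanujan sums, so the expression is rational. The stability
  holds because conjugation by `diag(u, u, 1, 1)` preserves `K(N)` up to congruence modulo `m`: up to
  quarter turns, an element of `K(N)` is a product of unipotent elements and an element that is block
  diagonal modulo `m`, so the conjugate, with `u⁻¹` replaced by an inverse of `u` modulo `m²`, is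
  congruent to an element of `K(N)` (`isTwistable_of_mem`). Finally, similitudes of multiplier `m`
  that are congruent modulo `m` lie in the same coset (`exists_mem_mul_eq_of_isCong`).
-/

noncomputable section

namespace Paramodular

open Matrix Filter Topology

/-! ### Fourier coefficients as limits of finite means -/

/-- The normalized exponential `exp(2 π i z)`. -/
def ec (z : ℂ) : ℂ := Complex.exp (2 * Real.pi * Complex.I * z)

theorem ec_add (z w : ℂ) : ec (z + w) = ec z * ec w := by
  simp only [ec, mul_add, Complex.exp_add]

theorem ec_zero : ec 0 = 1 := by simp [ec]

theorem ec_ne_zero (z : ℂ) : ec z ≠ 0 := Complex.exp_ne_zero _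

theorem ec_sum {ι : Type*} (s : Finset ι) (f : ι → ℂ) : ec (∑ i ∈ s, f i) = ∏ i ∈ s, ec (f i) := by
  simp only [ec, Finset.mul_sum, Complex.exp_sum]

theorem ec_nat_mul (n : ℕ) (z : ℂ) : ec (n * z) = ec z ^ n := by
  rw [ec, ec, ← Complex.exp_nat_mul]; ring_nf

theorem ec_eq_one_iff (z : ℂ) : ec z = 1 ↔ ∃ n : ℤ, z = n := by
  rw [ec, Complex.exp_eq_one_iff]
  have h : (2 * Real.pi * Complex.I : ℂ) ≠ 0 := Complex.two_pi_I_ne_zero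
  constructor
  · rintro ⟨n, hn⟩
    exact ⟨n, mul_left_cancel₀ h (by rw [hn]; ring)⟩
  · rintro ⟨n, rfl⟩
    exact ⟨n, by ring⟩

theorem ec_int (n : ℤ) : ec n = 1 := (ec_eq_one_iff _).2 ⟨n, rfl⟩

theorem norm_ec (z : ℂ) : ‖ec z‖ = Real.exp (-(2 * Real.pi * z.im)) := by
  rw [ec, Complex.norm_exp]
  congr 1
  simp

theorem ec_int_div_eq_one_iff {L : ℕ} (hL : L ≠ 0) (n : ℤ) :
    ec ((n : ℂ) / L) = 1 ↔ (L : ℤ) ∣ n := by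
  have hL' : (L : ℂ) ≠ 0 := by exact_mod_cast hL
  rw [ec_eq_one_iff]
  constructor
  · rintro ⟨m, hm⟩
    refine ⟨m, ?_⟩
    rw [div_eq_iff hL'] at hm
    have : (n : ℂ) = ((m * L : ℤ) : ℂ) := by push_cast; exact hm
    rw [Int.cast_injective this]; ring
  · rintro ⟨m, rfl⟩
    exact ⟨m, by push_cast; field_simp⟩

theorem sum_ec_int_mul_div {L : ℕ} (hL : L ≠ 0) (n : ℤ) :
    ∑ j ∈ Finset.range L, ec ((n : ℂ) * j / L) = if (L : ℤ) ∣ n then (L : ℂ) else 0 := by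
  have h : ∀ j : ℕ, ec ((n : ℂ) * j / L) = ec ((n : ℂ) / L) ^ j := fun j => by
    rw [← ec_nat_mul]; congr 1; ring
  simp only [h]
  split_ifs with hd
  · rw [(ec_int_div_eq_one_iff hL n).2 hd]; simp
  · have hne : ec ((n : ℂ) / L) ≠ 1 := fun h => hd ((ec_int_div_eq_one_iff hL n).1 h)
    have hL' : (L : ℂ) ≠ 0 := by exact_mod_cast hL
    rw [geom_sum_eq hne, ← ec_nat_mul, mul_div_cancel₀ _ hL', ec_int, sub_self, zero_div]

/-- The mean of `F(x) exp(-2 π i k·x)` over the points of `[0, 1)³` with coordinates in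
`(1/L) ℤ`: a finite substitute for the `k`-th Fourier coefficient of `F`. -/
def gridMean (k : Fin 3 → ℤ) (F : (Fin 3 → ℝ) → ℂ) (L : ℕ) : ℂ :=
  ((L : ℂ) ^ 3)⁻¹ * ∑ j : Fin 3 → Fin L,
    F (fun i => (j i : ℝ) / L) * ec (-∑ i, (k i : ℂ) * ((j i : ℕ) : ℂ) / L)

theorem gridMean_character (k ν : Fin 3 → ℤ) {L : ℕ} (hL : L ≠ 0) :
    gridMean k (fun x => ec (∑ i, (ν i : ℂ) * (x i : ℂ))) L
      = if ∀ i, (L : ℤ) ∣ ν i - k i then 1 else 0 := by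
  have hL' : (L : ℂ) ≠ 0 := by exact_mod_cast hL
  have h : ∀ j : Fin 3 → Fin L,
      ec (∑ i, (ν i : ℂ) * ((((j i : ℕ) : ℝ) / L : ℝ) : ℂ)) *
        ec (-∑ i, (k i : ℂ) * ((j i : ℕ) : ℂ) / L)
      = ∏ i, ec (((ν i - k i : ℤ) : ℂ) * ((j i : ℕ) : ℂ) / L) := fun j => by
    rw [← ec_add, ← ec_sum, ← Finset.sum_neg_distrib, ← Finset.sum_add_distrib]
    congr 1
    refine Finset.sum_congr rfl fun i _ => ?_
    push_cast; ring
  unfold gridMean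
  simp only [h]
  rw [← Fintype.piFinset_univ, ← Finset.prod_univ_sum (fun _ => Finset.univ)
    (fun (i : Fin 3) (j : Fin L) => ec (((ν i - k i : ℤ) : ℂ) * ((j : ℕ) : ℂ) / L))]
  have h1 : ∀ i : Fin 3, ∑ j : Fin L, ec (((ν i - k i : ℤ) : ℂ) * ((j : ℕ) : ℂ) / L)
      = if (L : ℤ) ∣ ν i - k i then (L : ℂ) else 0 := fun i => by
    rw [Fin.sum_univ_eq_sum_range (fun j => ec (((ν i - k i : ℤ) : ℂ) * (j : ℂ) / L)) L,
      sum_ec_int_mul_div hL]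
  simp only [h1]
  split_ifs with hd
  · simp [hd, hL']
  · obtain ⟨i, hi⟩ := not_forall.1 hd
    rw [Finset.prod_eq_zero (Finset.mem_univ i) (by simp [hi]), mul_zero]

theorem norm_gridMean_character_le (k ν : Fin 3 → ℤ) {L : ℕ} (hL : L ≠ 0) :
    ‖gridMean k (fun x => ec (∑ i, (ν i : ℂ) * (x i : ℂ))) L‖ ≤ 1 := by
  rw [gridMean_character k ν hL]; split_ifs <;> simp

/-- The `k`-th coefficient of an absolutely convergent Fourier series is recovered as a limit of
finite means. Being a limit of finite sums of values, it is visibly linear and determined by the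
values of the series. -/
theorem tendsto_gridMean {ι : Type*} (c : ι → ℂ) (ν : ι → Fin 3 → ℤ) (F : (Fin 3 → ℝ) → ℂ)
    (hF : ∀ x : Fin 3 → ℝ, HasSum (fun i => c i * ec (∑ a, (ν i a : ℂ) * (x a : ℂ))) (F x))
    (k : Fin 3 → ℤ) :
    Tendsto (gridMean k F) atTop (𝓝 (∑' i, if ν i = k then c i else 0)) := by
  have hs : Summable fun i => ‖c i‖ := by simpa [ec_zero] using (hF 0).summable.norm
  have key : ∀ L : ℕ, L ≠ 0 → gridMean k F L
      = ∑' i, c i * gridMean k (fun x => ec (∑ a, (ν i a : ℂ) * (x a : ℂ))) L := by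
    intro L hL
    refine (HasSum.tsum_eq ?_).symm
    unfold gridMean
    have h2 := (hasSum_sum (s := (Finset.univ : Finset (Fin 3 → Fin L))) fun j _ =>
      (hF (fun i => (j i : ℝ) / L)).mul_right
        (ec (-∑ i, (k i : ℂ) * ((j i : ℕ) : ℂ) / L))).mul_left ((L : ℂ) ^ 3)⁻¹
    refine Eq.subst (motive := fun g => HasSum g _) (funext fun i => ?_) h2
    simp only [Finset.mul_sum]
    exact Finset.sum_congr rfl fun j _ => by ring
  have h3 : Tendsto (fun L => ∑' i, c i *
      gridMean k (fun x => ec (∑ a, (ν i a : ℂ) * (x a : ℂ))) L) atTop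
      (𝓝 (∑' i, if ν i = k then c i else 0)) := by
    refine tendsto_tsum_of_dominated_convergence hs (fun i => ?_) ?_
    · -- for large `L`, divisibility of `ν i - k` by `L` means equality
      refine tendsto_const_nhds.congr' ?_
      filter_upwards [eventually_gt_atTop (∑ a, (ν i a - k a).natAbs)] with L hL
      rw [gridMean_character k (ν i) (by omega)]
      by_cases h : ν i = k
      · simp [h]
      · rw [if_neg h, if_neg, mul_zero]
        intro hd
        refine h (funext fun a => ?_)
        have hle : (ν i a - k a).natAbs ≤ ∑ a, (ν i a - k a).natAbs :=
          Finset.single_le_sum (f := fun a => (ν i a - k a).natAbs) (fun _ _ => Nat.zero_le _)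
            (Finset.mem_univ a)
        have hlt : |ν i a - k a| < (L : ℤ) := by
          rw [Int.abs_eq_natAbs]; exact_mod_cast hle.trans_lt hL
        have h0 := Int.eq_zero_of_abs_lt_dvd (hd a) hlt
        omega
    · filter_upwards [eventually_ne_atTop 0] with L hL i
      rw [norm_mul]
      exact mul_le_of_le_one_right (norm_nonneg _) (norm_gridMean_character_le k (ν i) hL)
  refine h3.congr' ?_
  filter_upwards [eventually_ne_atTop 0] with L hL
  exact (key L hL).symm

theorem gridMean_const_mul (k : Fin 3 → ℤ) (a : ℂ) (F : (Fin 3 → ℝ) → ℂ) (L : ℕ) :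
    gridMean k (fun x => a * F x) L = a * gridMean k F L := by
  unfold gridMean
  rw [mul_left_comm a, Finset.mul_sum _ _ a]
  simp only [mul_assoc]

theorem gridMean_sum {ι : Type*} (s : Finset ι) (k : Fin 3 → ℤ) (F : ι → (Fin 3 → ℝ) → ℂ)
    (L : ℕ) : gridMean k (fun x => ∑ i ∈ s, F i x) L = ∑ i ∈ s, gridMean k (F i) L := by
  unfold gridMean
  rw [← Finset.mul_sum, Finset.sum_comm]
  simp only [Finset.sum_mul]

/-! ### Exponential sums modulo prime powers -/

/-- The reduction modulo `m` of integral vectors. -/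
def red (m : ℕ) : (Fin 3 → ℤ) →+ (Fin 3 → ZMod m) where
  toFun x i := (x i : ZMod m)
  map_zero' := by ext; simp
  map_add' x y := by ext; simp

theorem red_surjective (m : ℕ) : Function.Surjective (red m) := fun y =>
  ⟨fun i => (ZMod.intCast_surjective (y i)).choose,
    funext fun i => (ZMod.intCast_surjective (y i)).choose_spec⟩

/-- The image in `(ℤ/m)³` of an integral `3 × 3` matrix. -/
def redRange (m : ℕ) (Φ : Matrix (Fin 3) (Fin 3) ℤ) : AddSubgroup (Fin 3 → ZMod m) :=
  (LinearMap.range Φ.mulVecLin).toAddSubgroup.map (red m)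

/-- The index of the image of `Φ` in `(ℤ/m)³` divides `det Φ`, the index of its image in `ℤ³`. -/
theorem index_redRange_dvd (m : ℕ) (Φ : Matrix (Fin 3) (Fin 3) ℤ) (hΦ : Φ.det ≠ 0) :
    (redRange m Φ).index ∣ Φ.det.natAbs := by
  have hinj : Function.Injective Φ.mulVecLin := by
    intro x y hxy
    exact Matrix.mulVec_injective_of_det_ne_zero hΦ hxy
  have h1 := Submodule.natAbs_det_equiv (LinearMap.range Φ.mulVecLin)
    (LinearEquiv.ofInjective Φ.mulVecLin hinj)
  have h2 : ((LinearMap.range Φ.mulVecLin).subtype ∘ₗ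
      ((LinearEquiv.ofInjective Φ.mulVecLin hinj : (Fin 3 → ℤ) →+
        LinearMap.range Φ.mulVecLin)).toIntLinearMap) = Φ.mulVecLin := by
    ext; rfl
  rw [h2, ← Matrix.toLin'_apply', LinearMap.det_toLin'] at h1
  rw [h1, ← AddSubgroup.index_comap_of_surjective _ (red_surjective m)]
  exact AddSubgroup.index_dvd_of_le (AddSubgroup.le_comap_map (red m) _)

theorem pow_three_dvd_det_mul_card (m : ℕ) [NeZero m] (Φ : Matrix (Fin 3) (Fin 3) ℤ)
    (hΦ : Φ.det ≠ 0) : (m : ℤ) ^ 3 ∣ Φ.det * Nat.card (redRange m Φ) := by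
  have h := index_redRange_dvd m Φ hΦ
  have h2 := (redRange m Φ).card_mul_index
  have h3 : Nat.card (Fin 3 → ZMod m) = m ^ 3 := by simp
  rw [h3] at h2
  rw [← Int.natCast_pow, ← h2, mul_comm, Int.natCast_mul]
  exact mul_dvd_mul (Int.natCast_dvd.2 h) dvd_rfl

/-- The additive character `x ↦ exp(2 π i (s · x) / m)` of `(ℤ/m)³`. -/
def vecChar (m : ℕ) [NeZero m] (s : Fin 3 → ℤ) (x : Fin 3 → ZMod m) : ℂ :=
  ZMod.stdAddChar (∑ i, (s i : ZMod m) * x i)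

theorem vecChar_add (m : ℕ) [NeZero m] (s : Fin 3 → ℤ) (x y : Fin 3 → ZMod m) :
    vecChar m s (x + y) = vecChar m s x * vecChar m s y := by
  simp [vecChar, mul_add, Finset.sum_add_distrib, AddChar.map_add_eq_mul]

theorem vecChar_red (m : ℕ) [NeZero m] (s x : Fin 3 → ℤ) :
    vecChar m s (red m x) = ec ((∑ i, (s i : ℂ) * x i) / m) := by
  have h : (∑ i, (s i : ZMod m) * red m x i) = ((∑ i, s i * x i : ℤ) : ZMod m) := by
    simp [red]
  rw [vecChar, h, ZMod.stdAddChar_coe, ec]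
  congr 1
  push_cast
  ring

theorem vecChar_pow (m : ℕ) [NeZero m] (s : Fin 3 → ℤ) (x : Fin 3 → ZMod m) :
    vecChar m s x ^ m = 1 := by
  rw [vecChar, ← AddChar.map_nsmul_eq_pow]
  simp

theorem isIntegral_vecChar (m : ℕ) [NeZero m] (s : Fin 3 → ℤ) (x : Fin 3 → ZMod m) :
    IsIntegral ℤ (vecChar m s x) :=
  IsIntegral.of_pow (NeZero.pos m) (by rw [vecChar_pow]; exact isIntegral_one)

/-- `Φᵀ s ∈ m ℤ³` says exactly that the character of `s` is trivial on the image of `Φ`. -/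
theorem vecChar_eq_one_of_mem_redRange (m : ℕ) [NeZero m] (Φ : Matrix (Fin 3) (Fin 3) ℤ)
    (s T : Fin 3 → ℤ) (hs : Φᵀ *ᵥ s = (m : ℤ) • T) {h : Fin 3 → ZMod m}
    (hh : h ∈ redRange m Φ) : vecChar m s h = 1 := by
  obtain ⟨_, ⟨y, rfl⟩, rfl⟩ := hh
  rw [vecChar_red]
  have h1 : ∑ i, s i * (Φ *ᵥ y) i = m * ∑ i, T i * y i := by
    have h2 : s ⬝ᵥ (Φ *ᵥ y) = (m : ℤ) • (T ⬝ᵥ y) := by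
      rw [← smul_dotProduct, ← hs, mulVec_transpose, dotProduct_mulVec]
    simpa [dotProduct] using h2
  rw [show (∑ i, (s i : ℂ) * ((Φ.mulVecLin y i : ℤ) : ℂ)) = (m : ℂ) * ((∑ i, T i * y i : ℤ) : ℂ) by
    have := congrArg (fun z : ℤ => (z : ℂ)) h1
    push_cast at this ⊢
    exact this]
  rw [mul_div_cancel_left₀ _ (by exact_mod_cast NeZero.ne m), ec_int]

/-- The Ramanujan sum modulo a prime power is an integer. -/
theorem exists_int_sum_coprime (p μ : ℕ) (hp : p.Prime) (hμ : 0 < μ) (n : ℤ) :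
    ∃ z : ℤ, ∑ j ∈ (Finset.range (p ^ μ)).filter (fun j => ¬ p ∣ j),
      ec ((n : ℂ) * j / (p ^ μ : ℕ)) = z := by
  obtain ⟨ν, rfl⟩ : ∃ ν, μ = ν + 1 := ⟨μ - 1, by omega⟩
  have hp0 : p ≠ 0 := hp.ne_zero
  have h1 := Finset.sum_filter_add_sum_filter_not (Finset.range (p ^ (ν + 1))) (fun j => p ∣ j)
    (fun j => ec ((n : ℂ) * j / (p ^ (ν + 1) : ℕ)))
  rw [sum_ec_int_mul_div (pow_ne_zero _ hp0)] at h1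
  have h2 : ∑ j ∈ (Finset.range (p ^ (ν + 1))).filter (fun j => p ∣ j),
      ec ((n : ℂ) * j / (p ^ (ν + 1) : ℕ))
      = ∑ i ∈ Finset.range (p ^ ν), ec ((n : ℂ) * i / (p ^ ν : ℕ)) := by
    symm
    refine Finset.sum_bij (fun i _ => p * i) ?_ ?_ ?_ ?_
    · intro i hi
      simp only [Finset.mem_filter, Finset.mem_range] at hi ⊢
      refine ⟨?_, dvd_mul_right _ _⟩
      rw [pow_succ, mul_comm]
      exact Nat.mul_lt_mul_of_pos_right hi hp.pos
    · intro i _ j _ h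
      exact Nat.eq_of_mul_eq_mul_left hp.pos h
    · intro j hj
      simp only [Finset.mem_filter, Finset.mem_range] at hj
      obtain ⟨hj, i, rfl⟩ := hj
      refine ⟨i, ?_, rfl⟩
      rw [pow_succ, mul_comm] at hj
      simpa using lt_of_mul_lt_mul_right hj (Nat.zero_le p)
    · intro i _
      congr 1
      have : (p : ℂ) ≠ 0 := by exact_mod_cast hp0
      push_cast
      field_simp
      ring
  rw [h2, sum_ec_int_mul_div (pow_ne_zero _ hp0)] at h1
  refine ⟨(if ((p ^ (ν + 1) : ℕ) : ℤ) ∣ n then ((p ^ (ν + 1) : ℕ) : ℤ) else 0)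
    - (if ((p ^ ν : ℕ) : ℤ) ∣ n then ((p ^ ν : ℕ) : ℤ) else 0), ?_⟩
  rw [← eq_sub_iff_add_eq'] at h1
  rw [h1]
  push_cast
  rfl

/-- A character sum over a set stable under multiplication by the units modulo `p ^ μ` is
rational. -/
theorem exists_rat_sum_vecChar (p μ : ℕ) (hp : p.Prime) (hμ : 0 < μ) [NeZero (p ^ μ)]
    (X : Finset (Fin 3 → ZMod (p ^ μ))) (s : Fin 3 → ℤ)
    (hunit : ∀ u : ℕ, ¬ p ∣ u → ∀ x ∈ X, (fun i => (u : ZMod (p ^ μ)) * x i) ∈ X) :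
    ∃ r : ℚ, ∑ x ∈ X, vecChar (p ^ μ) s x = r := by
  have hinv : ∀ u : ℕ, ¬ p ∣ u →
      ∑ x ∈ X, vecChar (p ^ μ) s (fun i => (u : ZMod (p ^ μ)) * x i)
        = ∑ x ∈ X, vecChar (p ^ μ) s x := by
    intro u hu
    have hcop : u.Coprime (p ^ μ) :=
      (Nat.Coprime.pow_left μ ((Nat.Prime.coprime_iff_not_dvd hp).2 hu)).symm
    have hinj : Set.InjOn (fun x : Fin 3 → ZMod (p ^ μ) => fun i => (u : ZMod (p ^ μ)) * x i) X := by
      intro x _ y _ hxy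
      funext i
      have h := congrFun hxy i
      exact ((ZMod.isUnit_iff_coprime u (p ^ μ)).2 hcop).mul_left_cancel h
    have himg : X.image (fun x => fun i => (u : ZMod (p ^ μ)) * x i) = X := by
      refine Finset.eq_of_subset_of_card_le ?_ ?_
      · intro y hy
        obtain ⟨x, hx, rfl⟩ := Finset.mem_image.1 hy
        exact hunit u hu x hx
      · rw [Finset.card_image_of_injOn hinj]
    conv_rhs => rw [← himg]
    rw [Finset.sum_image hinj]
  set U := (Finset.range (p ^ μ)).filter (fun j => ¬ p ∣ j) with hU
  have hUcard : (U.card : ℚ) ≠ 0 := by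
    have : 1 ∈ U := by
      simp only [hU, Finset.mem_filter, Finset.mem_range]
      exact ⟨Nat.one_lt_pow hμ.ne' hp.one_lt, fun h => hp.one_lt.ne' (Nat.dvd_one.1 h)⟩
    exact_mod_cast (Finset.card_pos.2 ⟨1, this⟩).ne'
  have hsum : ∀ x : Fin 3 → ZMod (p ^ μ), ∃ z : ℤ,
      ∑ u ∈ U, vecChar (p ^ μ) s (fun i => (u : ZMod (p ^ μ)) * x i) = z := by
    intro x
    obtain ⟨y, rfl⟩ := red_surjective (p ^ μ) x
    obtain ⟨z, hz⟩ := exists_int_sum_coprime p μ hp hμ (∑ i, s i * y i)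
    refine ⟨z, ?_⟩
    rw [← hz]
    refine Finset.sum_congr rfl fun u _ => ?_
    have : (fun i => (u : ZMod (p ^ μ)) * red (p ^ μ) y i) = red (p ^ μ) (fun i => u * y i) := by
      ext i; simp [red]
    rw [this, vecChar_red]
    congr 2
    push_cast
    rw [Finset.sum_mul]
    exact Finset.sum_congr rfl fun i _ => by ring
  choose z hz using hsum
  refine ⟨(∑ x ∈ X, (z x : ℚ)) / U.card, ?_⟩
  have h3 : (U.card : ℂ) * ∑ x ∈ X, vecChar (p ^ μ) s x = ∑ x ∈ X, (z x : ℂ) := by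
    rw [← nsmul_eq_mul, ← Finset.sum_const,
      ← Finset.sum_congr rfl fun u hu => hinv u (Finset.mem_filter.1 hu).2, Finset.sum_comm]
    exact Finset.sum_congr rfl fun x _ => hz x
  have hUc : (U.card : ℂ) ≠ 0 := by exact_mod_cast hUcard
  push_cast
  rw [eq_div_iff hUc, mul_comm, h3]

/-- A character sum over a set stable under translation by a subgroup on which the character is
trivial is divisible by the order of the subgroup, in the ring of algebraic integers. -/
theorem exists_isIntegral_sum_vecChar (m : ℕ) [NeZero m] (X : Finset (Fin 3 → ZMod m))
    (s : Fin 3 → ℤ) (H : AddSubgroup (Fin 3 → ZMod m)) (hH : ∀ h ∈ H, vecChar m s h = 1)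
    (hX : ∀ h ∈ H, ∀ x ∈ X, h + x ∈ X) :
    ∃ w : ℂ, IsIntegral ℤ w ∧ ∑ x ∈ X, vecChar m s x = Nat.card H * w := by
  classical
  let π : (Fin 3 → ZMod m) → (Fin 3 → ZMod m) ⧸ H := QuotientAddGroup.mk
  refine ⟨∑ q ∈ X.image π, vecChar m s q.out, IsIntegral.sum _ fun q _ =>
    isIntegral_vecChar m s _, ?_⟩
  rw [Finset.mul_sum, ← Finset.sum_fiberwise_of_maps_to (g := π) (t := X.image π)
    (fun x hx => Finset.mem_image_of_mem π hx)]
  refine Finset.sum_congr rfl fun q hq => ?_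
  obtain ⟨x0, hx0, rfl⟩ := Finset.mem_image.1 hq
  have hout : -((π x0).out) + x0 ∈ H := QuotientAddGroup.eq.1 (QuotientAddGroup.out_eq' (π x0))
  have hfib : ∀ x ∈ X.filter (fun x => π x = π x0), vecChar m s x = vecChar m s (π x0).out := by
    intro x hx
    have h1 : -((π x0).out) + x ∈ H := by
      refine QuotientAddGroup.eq.1 ?_
      rw [QuotientAddGroup.out_eq']
      exact (Finset.mem_filter.1 hx).2.symm
    have h2 : x = (π x0).out + (-((π x0).out) + x) := by abel
    rw [h2, vecChar_add, hH _ h1, mul_one]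
  rw [Finset.sum_congr rfl hfib, Finset.sum_const, nsmul_eq_mul]
  congr 2
  rw [Nat.card_eq_fintype_card, ← Finset.card_univ]
  symm
  refine Finset.card_bij (fun (h : H) _ => (h : Fin 3 → ZMod m) + x0) ?_ ?_ ?_
  · intro h _
    refine Finset.mem_filter.2 ⟨hX _ h.2 _ hx0, ?_⟩
    refine (QuotientAddGroup.eq.2 ?_).symm
    rw [add_comm (h : Fin 3 → ZMod m), neg_add_cancel_left]
    exact h.2
  · intro a _ b _ hab
    exact Subtype.ext (add_right_cancel hab)
  · intro x hx
    have h1 : -x0 + x ∈ H := QuotientAddGroup.eq.1 (Finset.mem_filter.1 hx).2.symm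
    exact ⟨⟨-x0 + x, h1⟩, Finset.mem_univ _, by simp⟩

/-- The integrality statement behind the Hecke action on Fourier coefficients: in weight `k ≥ 3`
the factor `det(Φ)`, with the order of the group of translations, makes up for the
denominator `m³`. -/
theorem exists_int_weighted_sum (p μ k : ℕ) (hp : p.Prime) (hμ : 0 < μ) (hk : 3 ≤ k)
    [NeZero (p ^ μ)] (Φ : Matrix (Fin 3) (Fin 3) ℤ) (δ : ℤ) (hδ : δ ≠ 0) (hΦ : Φ.det = δ ^ 3)
    (X : Finset (Fin 3 → ZMod (p ^ μ))) (s T : Fin 3 → ℤ)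
    (hs : Φᵀ *ᵥ s = ((p ^ μ : ℕ) : ℤ) • T)
    (hunit : ∀ u : ℕ, ¬ p ∣ u → ∀ x ∈ X, (fun i => (u : ZMod (p ^ μ)) * x i) ∈ X)
    (htrans : ∀ h ∈ redRange (p ^ μ) Φ, ∀ x ∈ X, h + x ∈ X) :
    ∃ z : ℤ, (((p ^ μ : ℕ) : ℂ) ^ 3)⁻¹ * (δ : ℂ) ^ k * ∑ x ∈ X, vecChar (p ^ μ) s x = z := by
  obtain ⟨r, hr⟩ := exists_rat_sum_vecChar p μ hp hμ X s hunit
  obtain ⟨w, hw, hw'⟩ := exists_isIntegral_sum_vecChar (p ^ μ) X s (redRange (p ^ μ) Φ)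
    (fun h hh => vecChar_eq_one_of_mem_redRange (p ^ μ) Φ s T hs hh) htrans
  obtain ⟨y, hy⟩ := pow_three_dvd_det_mul_card (p ^ μ) Φ (by rw [hΦ]; exact pow_ne_zero _ hδ)
  have hm : ((p ^ μ : ℕ) : ℂ) ≠ 0 := by exact_mod_cast NeZero.ne (p ^ μ)
  have hint : IsIntegral ℤ
      ((((p ^ μ : ℕ) : ℂ) ^ 3)⁻¹ * (δ : ℂ) ^ k * ∑ x ∈ X, vecChar (p ^ μ) s x) := by
    have h1 : (((p ^ μ : ℕ) : ℂ) ^ 3)⁻¹ * (δ : ℂ) ^ k * ∑ x ∈ X, vecChar (p ^ μ) s x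
        = ((δ ^ (k - 3) * y : ℤ) : ℂ) * w := by
      rw [hw']
      have h2 : (δ : ℂ) ^ 3 * (Nat.card (redRange (p ^ μ) Φ) : ℂ) = ((p ^ μ : ℕ) : ℂ) ^ 3 * y := by
        rw [hΦ] at hy
        exact_mod_cast hy
      have h3 : (δ : ℂ) ^ k = δ ^ (k - 3) * δ ^ 3 := by rw [← pow_add]; congr 1; omega
      rw [h3]
      push_cast at h2 hm ⊢
      field_simp
      linear_combination w * h2
    rw [h1]
    exact (isIntegral_algebraMap (R := ℤ) (A := ℂ) (x := δ ^ (k - 3) * y)).mul hw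
  rw [hr] at hint ⊢
  have h4 : ((((p ^ μ : ℕ) : ℂ) ^ 3)⁻¹ * (δ : ℂ) ^ k * r)
      = algebraMap ℚ ℂ ((((p ^ μ : ℕ) : ℚ) ^ 3)⁻¹ * (δ : ℚ) ^ k * r) := by simp
  rw [h4] at hint ⊢
  rw [isIntegral_algebraMap_iff (algebraMap ℚ ℂ).injective] at hint
  obtain ⟨z, hz⟩ := IsIntegrallyClosed.isIntegral_iff.1 hint
  exact ⟨z, by rw [← hz]; simp⟩

/-! ### The paramodular order and its similitudes -/

/-- `g` is a symplectic similitude with multiplier `m`. -/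
def IsSim (m : ℝ) (g : Matrix Ix Ix ℝ) : Prop := gᵀ * J (Fin 2) ℝ * g = m • J (Fin 2) ℝ

theorem IsSim.mul {m n : ℝ} {g h : Matrix Ix Ix ℝ} (hg : IsSim m g) (hh : IsSim n h) :
    IsSim (m * n) (g * h) := by
  unfold IsSim at *
  calc (g * h)ᵀ * J (Fin 2) ℝ * (g * h) = hᵀ * (gᵀ * J (Fin 2) ℝ * g) * h := by
        rw [transpose_mul]; simp only [Matrix.mul_assoc]
    _ = (m * n) • J (Fin 2) ℝ := by
        rw [hg, Matrix.mul_smul, Matrix.smul_mul, hh, smul_smul]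

theorem isSim_one_iff (g : Matrix Ix Ix ℝ) : IsSim 1 g ↔ g ∈ symplecticGroup (Fin 2) ℝ := by
  rw [SymplecticGroup.mem_iff', IsSim, one_smul]

/-- The symplectic adjugate: `adj g * g = m` for a similitude `g` with multiplier `m`. -/
def adj (g : Matrix Ix Ix ℝ) : Matrix Ix Ix ℝ := -(J (Fin 2) ℝ * gᵀ * J (Fin 2) ℝ)

theorem adj_fromBlocks (a b c d : Matrix (Fin 2) (Fin 2) ℝ) :
    adj (fromBlocks a b c d) = fromBlocks dᵀ (-bᵀ) (-cᵀ) aᵀ := by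
  simp [adj, J, fromBlocks_transpose, fromBlocks_multiply, fromBlocks_neg]

theorem adj_mul_self {m : ℝ} {g : Matrix Ix Ix ℝ} (hg : IsSim m g) : adj g * g = m • 1 := by
  rw [adj, Matrix.neg_mul, Matrix.mul_assoc, Matrix.mul_assoc, ← Matrix.mul_assoc gᵀ, hg,
    Matrix.mul_smul, J_squared, smul_neg, neg_neg]

theorem mul_adj_self {m : ℝ} (hm : m ≠ 0) {g : Matrix Ix Ix ℝ} (hg : IsSim m g) :
    g * adj g = m • 1 := by
  have h : (m⁻¹ • adj g) * g = 1 := by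
    rw [Matrix.smul_mul, adj_mul_self hg, smul_smul, inv_mul_cancel₀ hm, one_smul]
  have h2 := mul_eq_one_comm.1 h
  rw [Matrix.mul_smul] at h2
  rw [← h2, smul_smul, mul_inv_cancel₀ hm, one_smul]

theorem isSim_adj {m : ℝ} (hm : m ≠ 0) {g : Matrix Ix Ix ℝ} (hg : IsSim m g) :
    IsSim m (adj g) := by
  have h := mul_adj_self hm hg
  have hJ : (J (Fin 2) ℝ) * J (Fin 2) ℝ = -1 := J_squared _ _
  have h1 : (adj g)ᵀ = -(J (Fin 2) ℝ * g * J (Fin 2) ℝ) := by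
    simp [adj, transpose_mul, J_transpose, Matrix.mul_assoc]
  unfold IsSim
  rw [h1, Matrix.neg_mul, Matrix.neg_mul, Matrix.mul_assoc (J (Fin 2) ℝ * g), hJ,
    Matrix.mul_neg, Matrix.mul_one, Matrix.neg_mul, neg_neg, Matrix.mul_assoc, h,
    Matrix.mul_smul, Matrix.mul_one]

/-- The weights of the entries of the paramodular order: the matrices whose `(i, j)` entry is an
integral multiple of `scale N i j` form the ring of endomorphisms of both the lattice
`ℤ ⊕ ℤ ⊕ ℤ ⊕ N ℤ` and its dual. -/
def scale (N : ℕ) : Matrix Ix Ix ℝ :=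
  fromBlocks !![1, (N : ℝ); 1, 1] !![1, 1; 1, (N : ℝ)⁻¹] !![1, (N : ℝ); (N : ℝ), (N : ℝ)]
    !![1, 1; (N : ℝ), 1]

/-- Membership in the paramodular order. Its similitudes with multiplier one are the elements of
`K(N)` (`isPat_of_mem`, `exists_mem_paramodularGroup`). -/
def IsPat (N : ℕ) (g : Matrix Ix Ix ℝ) : Prop := ∀ i j, ∃ z : ℤ, g i j = z * scale N i j

theorem exists_int_scale_mul {N : ℕ} (hN : 0 < N) (i j k : Ix) :
    ∃ z : ℤ, scale N i j * scale N j k = z * scale N i k := by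
  have h : (N : ℝ) ≠ 0 := by exact_mod_cast hN.ne'
  have key : ∃ z : ℕ, z ∈ [1, N, N * N] ∧ scale N i j * scale N j k = z * scale N i k := by
    rcases i with i | i <;> rcases j with j | j <;> rcases k with k | k <;>
    fin_cases i <;> fin_cases j <;> fin_cases k <;> simp [scale, h]
  obtain ⟨z, -, hz⟩ := key
  exact ⟨z, by exact_mod_cast hz⟩

theorem IsPat.mul {N : ℕ} (hN : 0 < N) {g h : Matrix Ix Ix ℝ} (hg : IsPat N g) (hh : IsPat N h) :
    IsPat N (g * h) := by
  intro i k
  choose x hx using hg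
  choose y hy using hh
  choose e he using exists_int_scale_mul hN
  refine ⟨∑ j, x i j * y j k * e i j k, ?_⟩
  rw [Matrix.mul_apply]
  push_cast
  rw [Finset.sum_mul]
  refine Finset.sum_congr rfl fun j _ => ?_
  rw [hx, hy]
  linear_combination (x i j : ℝ) * y j k * he i j k

theorem IsPat.add {N : ℕ} {g h : Matrix Ix Ix ℝ} (hg : IsPat N g) (hh : IsPat N h) :
    IsPat N (g + h) := fun i j => by
  obtain ⟨x, hx⟩ := hg i j
  obtain ⟨y, hy⟩ := hh i j
  exact ⟨x + y, by rw [Matrix.add_apply, hx, hy]; push_cast; ring⟩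

theorem IsPat.smul {N : ℕ} {g : Matrix Ix Ix ℝ} (hg : IsPat N g) (n : ℤ) :
    IsPat N ((n : ℝ) • g) := fun i j => by
  obtain ⟨x, hx⟩ := hg i j
  exact ⟨n * x, by rw [Matrix.smul_apply, hx]; push_cast; simp [mul_assoc]⟩

theorem isPat_one (N : ℕ) : IsPat N 1 := by
  intro i j
  by_cases h : i = j
  · subst h
    refine ⟨1, ?_⟩
    rcases i with i | i <;> fin_cases i <;> simp [scale]
  · exact ⟨0, by simp [h]⟩

theorem IsPat.adj {N : ℕ} {g : Matrix Ix Ix ℝ} (hg : IsPat N g) : IsPat N (adj g) := by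
  rw [← fromBlocks_toBlocks g, adj_fromBlocks]
  have hs : ∀ i j : Fin 2, scale N (Sum.inl i) (Sum.inl j) = scale N (Sum.inr j) (Sum.inr i) ∧
      scale N (Sum.inl i) (Sum.inr j) = scale N (Sum.inl j) (Sum.inr i) ∧
      scale N (Sum.inr i) (Sum.inl j) = scale N (Sum.inr j) (Sum.inl i) := by
    intro i j
    fin_cases i <;> fin_cases j <;> simp [scale]
  rintro (i | i) (j | j)
  · obtain ⟨z, hz⟩ := hg (Sum.inr j) (Sum.inr i)
    exact ⟨z, by rw [(hs i j).1, ← hz]; rfl⟩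
  · obtain ⟨z, hz⟩ := hg (Sum.inl j) (Sum.inr i)
    exact ⟨-z, by rw [(hs i j).2.1, Int.cast_neg, neg_mul, ← hz]; rfl⟩
  · obtain ⟨z, hz⟩ := hg (Sum.inr j) (Sum.inl i)
    exact ⟨-z, by rw [(hs i j).2.2, Int.cast_neg, neg_mul, ← hz]; rfl⟩
  · obtain ⟨z, hz⟩ := hg (Sum.inl j) (Sum.inl i)
    exact ⟨z, by rw [← (hs j i).1, ← hz]; rfl⟩

/-- The element of the paramodular order with integral coordinates `a, b, c, d`. -/
def patMat (N : ℕ) (a b c d : Matrix (Fin 2) (Fin 2) ℤ) : Matrix Ix Ix ℝ :=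
  fromBlocks !![(a 0 0 : ℝ), N * (a 0 1 : ℝ); (a 1 0 : ℝ), (a 1 1 : ℝ)]
    !![(b 0 0 : ℝ), (b 0 1 : ℝ); (b 1 0 : ℝ), (b 1 1 : ℝ) / N]
    !![(c 0 0 : ℝ), N * (c 0 1 : ℝ); N * (c 1 0 : ℝ), N * (c 1 1 : ℝ)]
    !![(d 0 0 : ℝ), (d 0 1 : ℝ); N * (d 1 0 : ℝ), (d 1 1 : ℝ)]

theorem isPat_patMat (N : ℕ) (a b c d : Matrix (Fin 2) (Fin 2) ℤ) : IsPat N (patMat N a b c d) := by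
  rintro (i | i) (j | j)
  · exact ⟨a i j, by fin_cases i <;> fin_cases j <;> simp [patMat, scale, mul_comm]⟩
  · exact ⟨b i j, by fin_cases i <;> fin_cases j <;> simp [patMat, scale, div_eq_mul_inv]⟩
  · exact ⟨c i j, by fin_cases i <;> fin_cases j <;> simp [patMat, scale, mul_comm]⟩
  · exact ⟨d i j, by fin_cases i <;> fin_cases j <;> simp [patMat, scale, mul_comm]⟩

theorem IsPat.exists_patMat {N : ℕ} {g : Matrix Ix Ix ℝ} (hg : IsPat N g) :
    ∃ a b c d, g = patMat N a b c d := by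
  choose z hz using hg
  refine ⟨fun i j => z (Sum.inl i) (Sum.inl j), fun i j => z (Sum.inl i) (Sum.inr j),
    fun i j => z (Sum.inr i) (Sum.inl j), fun i j => z (Sum.inr i) (Sum.inr j), ?_⟩
  ext i j
  rw [hz]
  rcases i with i | i <;> rcases j with j | j <;> fin_cases i <;> fin_cases j <;>
    simp [patMat, scale, mul_comm, div_eq_mul_inv]

/-- The similitude equations in integral coordinates. -/
theorem isSim_patMat_iff {N : ℕ} (hN : 0 < N) (m : ℤ) (a b c d : Matrix (Fin 2) (Fin 2) ℤ) :
    IsSim m (patMat N a b c d) ↔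
      c 0 0 * a 0 1 + c 1 0 * a 1 1 = a 0 0 * c 0 1 + a 1 0 * c 1 1 ∧
      d 0 0 * b 0 1 + d 1 0 * b 1 1 = b 0 0 * d 0 1 + b 1 0 * d 1 1 ∧
      d 0 0 * a 0 0 + N * (d 1 0 * a 1 0) - b 0 0 * c 0 0 - N * (b 1 0 * c 1 0) = m ∧
      d 0 0 * a 0 1 + d 1 0 * a 1 1 - b 0 0 * c 0 1 - b 1 0 * c 1 1 = 0 ∧
      d 0 1 * a 0 0 + d 1 1 * a 1 0 - b 0 1 * c 0 0 - b 1 1 * c 1 0 = 0 ∧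
      N * (d 0 1 * a 0 1) + d 1 1 * a 1 1 - N * (b 0 1 * c 0 1) - b 1 1 * c 1 1 = m := by
  have h : (N : ℝ) ≠ 0 := by exact_mod_cast hN.ne'
  constructor
  · intro H
    have e : ∀ i j, _ := fun i j => congrFun (congrFun H i) j
    have e1 := e (Sum.inl 0) (Sum.inl 1)
    have e2 := e (Sum.inr 0) (Sum.inr 1)
    have e3 := e (Sum.inr 0) (Sum.inl 0)
    have e4 := e (Sum.inr 0) (Sum.inl 1)
    have e5 := e (Sum.inr 1) (Sum.inl 0)
    have e6 := e (Sum.inr 1) (Sum.inl 1)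
    simp [patMat, J, fromBlocks_transpose, fromBlocks_multiply, Matrix.mul_apply,
      Fin.sum_univ_two] at e1 e2 e3 e4 e5 e6
    field_simp at e1 e2 e3 e4 e5 e6
    refine ⟨?_, ?_, ?_, ?_, ?_, ?_⟩ <;> rify
    · have : (N : ℝ) * ((c 0 0 * a 0 1 + c 1 0 * a 1 1 : ℝ) - (a 0 0 * c 0 1 + a 1 0 * c 1 1)) = 0 := by
        linear_combination e1
      rcases mul_eq_zero.1 this with h' | h'
      · exact absurd h' h
      · linarith
    · linear_combination e2
    · linear_combination e3
    · have : (N : ℝ) * (d 0 0 * a 0 1 + d 1 0 * a 1 1 - b 0 0 * c 0 1 - b 1 0 * c 1 1 : ℝ) = 0 := by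
        linear_combination e4
      exact (mul_eq_zero.1 this).resolve_left h
    · linear_combination e5
    · linear_combination e6
  · rintro ⟨e1, e2, e3, e4, e5, e6⟩
    rify at e1 e2 e3 e4 e5 e6
    unfold IsSim
    ext i j
    rcases i with i | i <;> rcases j with j | j <;> fin_cases i <;> fin_cases j <;>
    simp [patMat, J, fromBlocks_transpose, fromBlocks_multiply, Matrix.mul_apply,
      Fin.sum_univ_two] <;> field_simp
    exacts [by ring, by linear_combination N * e1, by linear_combination -N * e1, by ring,
      by linear_combination -e3, by linear_combination -e5, by linear_combination -N * e4,
      by linear_combination -e6, by linear_combination e3, by linear_combination N * e4,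
      by linear_combination e5, by linear_combination e6, by ring, by linear_combination e2,
      by linear_combination -e2, by ring]

theorem IsPat.mulVec_mem_lattice {N : ℕ} (hN : 0 < N) {g : Matrix Ix Ix ℝ} (hg : IsPat N g)
    {v : Ix → ℝ} (hv : v ∈ lattice N) : g *ᵥ v ∈ lattice N := by
  obtain ⟨a, b, c, d, rfl⟩ := hg.exists_patMat
  obtain ⟨⟨v0, h0⟩, ⟨v1, h1⟩, ⟨v2, h2⟩, v3, h3⟩ := hv
  have h : (N : ℝ) ≠ 0 := by exact_mod_cast hN.ne'
  refine ⟨⟨a 0 0 * v0 + N * a 0 1 * v1 + b 0 0 * v2 + b 0 1 * (N * v3), ?_⟩,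
    ⟨a 1 0 * v0 + a 1 1 * v1 + b 1 0 * v2 + b 1 1 * v3, ?_⟩,
    ⟨c 0 0 * v0 + N * c 0 1 * v1 + d 0 0 * v2 + d 0 1 * (N * v3), ?_⟩,
    ⟨c 1 0 * v0 + c 1 1 * v1 + d 1 0 * v2 + d 1 1 * v3, ?_⟩⟩ <;>
  · simp [Matrix.mulVec, dotProduct, patMat, Fin.sum_univ_two, h0, h1, h2, h3]
    field_simp
    ring

/-- An integral symplectic matrix of the paramodular order belongs to `K(N)`. -/
theorem exists_mem_paramodularGroup {N : ℕ} (hN : 0 < N) {g : Matrix Ix Ix ℝ} (hg : IsPat N g)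
    (hs : IsSim 1 g) : ∃ γ ∈ paramodularGroup N, (γ : Matrix Ix Ix ℝ) = g := by
  have h1 : adj g * g = 1 := by rw [adj_mul_self hs, one_smul]
  have h2 : g * adj g = 1 := by rw [mul_adj_self one_ne_zero hs, one_smul]
  refine ⟨⟨g, adj g, h2, h1⟩, ⟨(isSim_one_iff g).1 hs, fun v => ⟨fun hv => ?_, fun hv => ?_⟩⟩, rfl⟩
  · have h3 := hg.adj.mulVec_mem_lattice hN hv
    simpa [mulVec_mulVec, h1] using h3
  · exact hg.mulVec_mem_lattice hN hv

theorem isSim_of_mem {N : ℕ} {γ : GL Ix ℝ} (hγ : γ ∈ paramodularGroup N) :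
    IsSim 1 (γ : Matrix Ix Ix ℝ) := (isSim_one_iff _).2 hγ.1

theorem exists_entry_of_mulVec_mem {N : ℕ} {g : Matrix Ix Ix ℝ}
    (hg : ∀ v ∈ lattice N, g *ᵥ v ∈ lattice N) (i j : Ix) :
    ∃ z : ℤ, g i j * (Sum.elim ![1, 1] ![1, (N : ℝ)] : Ix → ℝ) j
      = z * (Sum.elim ![1, 1] ![1, (N : ℝ)] : Ix → ℝ) i := by
  set w : Ix → ℝ := Sum.elim ![1, 1] ![1, (N : ℝ)] with hw
  have h1 : (Pi.single j (w j) : Ix → ℝ) ∈ lattice N := by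
    rcases j with j | j <;> fin_cases j
    · exact ⟨⟨1, by simp [hw]⟩, ⟨0, by simp⟩, ⟨0, by simp⟩, ⟨0, by simp⟩⟩
    · exact ⟨⟨0, by simp⟩, ⟨1, by simp [hw]⟩, ⟨0, by simp⟩, ⟨0, by simp⟩⟩
    · exact ⟨⟨0, by simp⟩, ⟨0, by simp⟩, ⟨1, by simp [hw]⟩, ⟨0, by simp⟩⟩
    · exact ⟨⟨0, by simp⟩, ⟨0, by simp⟩, ⟨0, by simp⟩, ⟨1, by simp [hw]⟩⟩
  have h2 := hg _ h1
  have h3 : ∀ i, (g *ᵥ (Pi.single j (w j) : Ix → ℝ)) i = g i j * w j := fun i => by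
    rw [Matrix.mulVec_single]; simp [Matrix.col]
  obtain ⟨⟨a, ha⟩, ⟨b, hb⟩, ⟨c, hc⟩, d, hd⟩ := h2
  rw [h3] at ha hb hc hd
  rcases i with i | i <;> fin_cases i
  · exact ⟨a, ha.trans (by simp [hw])⟩
  · exact ⟨b, hb.trans (by simp [hw])⟩
  · exact ⟨c, hc.trans (by simp [hw])⟩
  · exact ⟨d, hd.trans (by simp [hw, mul_comm])⟩

theorem isPat_of_mem {N : ℕ} (hN : 0 < N) {γ : GL Ix ℝ} (hγ : γ ∈ paramodularGroup N) :
    IsPat N (γ : Matrix Ix Ix ℝ) := by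
  have h : (N : ℝ) ≠ 0 := by exact_mod_cast hN.ne'
  set g := (γ : Matrix Ix Ix ℝ) with hg
  have hs : IsSim 1 g := isSim_of_mem hγ
  have h2 : g * adj g = 1 := by rw [mul_adj_self one_ne_zero hs, one_smul]
  have e1 := exists_entry_of_mulVec_mem fun v hv => (hγ.2 v).2 hv
  -- the entries of the inverse give the integrality conditions dual to those for `g`
  have e2 := exists_entry_of_mulVec_mem (g := adj g) fun v hv => by
    rw [← hγ.2, mulVec_mulVec, ← hg, h2, one_mulVec]; exact hv
  rw [← fromBlocks_toBlocks g, adj_fromBlocks] at e2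
  have hmul : ∀ {x : ℝ} {z : ℤ}, x * N = z → x = z * (N : ℝ)⁻¹ := fun hx => by
    rw [← hx]; field_simp
  rintro (i | i) (j | j) <;> fin_cases i <;> fin_cases j
  · obtain ⟨z, hz⟩ := e1 (Sum.inl 0) (Sum.inl 0)
    exact ⟨z, by simpa [scale] using hz⟩
  · obtain ⟨z, hz⟩ := e2 (Sum.inr 1) (Sum.inr 0)
    exact ⟨z, by simpa [scale, toBlocks₁₁] using hz⟩
  · obtain ⟨z, hz⟩ := e1 (Sum.inl 1) (Sum.inl 0)
    exact ⟨z, by simpa [scale] using hz⟩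
  · obtain ⟨z, hz⟩ := e1 (Sum.inl 1) (Sum.inl 1)
    exact ⟨z, by simpa [scale] using hz⟩
  · obtain ⟨z, hz⟩ := e1 (Sum.inl 0) (Sum.inr 0)
    exact ⟨z, by simpa [scale] using hz⟩
  · obtain ⟨z, hz⟩ := e2 (Sum.inl 1) (Sum.inr 0)
    exact ⟨-z, by
      simp [toBlocks₁₂] at hz
      simp [scale, ← hz]⟩
  · obtain ⟨z, hz⟩ := e1 (Sum.inl 1) (Sum.inr 0)
    exact ⟨z, by simpa [scale] using hz⟩
  · obtain ⟨z, hz⟩ := e1 (Sum.inl 1) (Sum.inr 1)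
    exact ⟨z, by
      simp at hz
      simpa [scale] using hmul hz⟩
  · obtain ⟨z, hz⟩ := e1 (Sum.inr 0) (Sum.inl 0)
    exact ⟨z, by simpa [scale] using hz⟩
  · obtain ⟨z, hz⟩ := e2 (Sum.inr 1) (Sum.inl 0)
    exact ⟨-z, by
      simp [toBlocks₂₁] at hz
      simp [scale, ← hz]⟩
  · obtain ⟨z, hz⟩ := e1 (Sum.inr 1) (Sum.inl 0)
    exact ⟨z, by simpa [scale] using hz⟩
  · obtain ⟨z, hz⟩ := e1 (Sum.inr 1) (Sum.inl 1)
    exact ⟨z, by simpa [scale] using hz⟩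
  · obtain ⟨z, hz⟩ := e1 (Sum.inr 0) (Sum.inr 0)
    exact ⟨z, by simpa [scale] using hz⟩
  · obtain ⟨z, hz⟩ := e2 (Sum.inl 1) (Sum.inl 0)
    exact ⟨z, by simpa [scale, toBlocks₂₂] using hz⟩
  · obtain ⟨z, hz⟩ := e1 (Sum.inr 1) (Sum.inr 0)
    exact ⟨z, by simpa [scale] using hz⟩
  · obtain ⟨z, hz⟩ := e1 (Sum.inr 1) (Sum.inr 1)
    exact ⟨z, by
      simp [hN.ne'] at hz
      simpa [scale] using hz⟩

/-! ### Elements of the paramodular group -/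

/-- The embedding of pairs of `2 × 2` matrices: `x` acts on the coordinates `1, 3` and `y`, with
its off-diagonal entries rescaled, on the coordinates `2, 4`. -/
def pairMat (N : ℕ) (x y : Matrix (Fin 2) (Fin 2) ℤ) : Matrix Ix Ix ℝ :=
  patMat N !![x 0 0, 0; 0, y 0 0] !![x 0 1, 0; 0, y 0 1] !![x 1 0, 0; 0, y 1 0]
    !![x 1 1, 0; 0, y 1 1]

theorem isSim_pairMat {N : ℕ} (hN : 0 < N) {x y : Matrix (Fin 2) (Fin 2) ℤ}
    (hx : x 0 0 * x 1 1 - x 0 1 * x 1 0 = 1) (hy : y 0 0 * y 1 1 - y 0 1 * y 1 0 = 1) :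
    IsSim 1 (pairMat N x y) := by
  have h := (isSim_patMat_iff hN 1 !![x 0 0, 0; 0, y 0 0] !![x 0 1, 0; 0, y 0 1]
    !![x 1 0, 0; 0, y 1 0] !![x 1 1, 0; 0, y 1 1]).2
    ⟨by simp, by simp, by simp; linarith, by simp, by simp, by simp; linarith⟩
  simpa [pairMat] using h

theorem exists_mem_eq_pairMat {N : ℕ} (hN : 0 < N) {x y : Matrix (Fin 2) (Fin 2) ℤ}
    (hx : x 0 0 * x 1 1 - x 0 1 * x 1 0 = 1) (hy : y 0 0 * y 1 1 - y 0 1 * y 1 0 = 1) :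
    ∃ γ ∈ paramodularGroup N, (γ : Matrix Ix Ix ℝ) = pairMat N x y :=
  exists_mem_paramodularGroup hN (isPat_patMat _ _ _ _ _) (isSim_pairMat hN hx hy)

/-- The block diagonal element of `K(N)` with upper left block `(a₀₀, N a₀₁; a₁₀, a₁₁)`. -/
def leviMat (N : ℕ) (a : Matrix (Fin 2) (Fin 2) ℤ) : Matrix Ix Ix ℝ :=
  patMat N a 0 0 !![a 1 1, -a 1 0; -a 0 1, a 0 0]

theorem exists_mem_eq_leviMat {N : ℕ} (hN : 0 < N) {a : Matrix (Fin 2) (Fin 2) ℤ}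
    (ha : a 0 0 * a 1 1 - N * (a 0 1 * a 1 0) = 1) :
    ∃ γ ∈ paramodularGroup N, (γ : Matrix Ix Ix ℝ) = leviMat N a := by
  have h := (isSim_patMat_iff hN 1 a 0 0 !![a 1 1, -a 1 0; -a 0 1, a 0 0]).2
    ⟨by simp, by simp, by simp; linarith, by simp; ring, by simp; ring, by simp; linarith⟩
  exact exists_mem_paramodularGroup hN (isPat_patMat _ _ _ _ _) (by simpa [leviMat] using h)

/-- The symmetric integral coordinate matrix `(s₀, s₁; s₁, s₂)`. -/
def symInt (s : Fin 3 → ℤ) : Matrix (Fin 2) (Fin 2) ℤ := !![s 0, s 1; s 1, s 2]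

theorem exists_mem_eq_upper {N : ℕ} (hN : 0 < N) (s : Fin 3 → ℤ) :
    ∃ γ ∈ paramodularGroup N, (γ : Matrix Ix Ix ℝ) = patMat N 1 (symInt s) 0 1 := by
  have h := (isSim_patMat_iff hN 1 1 (symInt s) 0 1).2 (by simp [symInt])
  exact exists_mem_paramodularGroup hN (isPat_patMat _ _ _ _ _) (by simpa using h)

theorem exists_mem_eq_lower {N : ℕ} (hN : 0 < N) (s : Fin 3 → ℤ) :
    ∃ γ ∈ paramodularGroup N, (γ : Matrix Ix Ix ℝ) = patMat N 1 0 (symInt s) 1 := by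
  have h := (isSim_patMat_iff hN 1 1 0 (symInt s) 1).2 (by simp [symInt])
  exact exists_mem_paramodularGroup hN (isPat_patMat _ _ _ _ _) (by simpa using h)

theorem exists_sl_two_reduce (a b : ℤ) : ∃ x : Matrix (Fin 2) (Fin 2) ℤ,
    x 0 0 * x 1 1 - x 0 1 * x 1 0 = 1 ∧ x 0 0 * a + x 0 1 * b = Int.gcd a b ∧
      x 1 0 * a + x 1 1 * b = 0 := by
  by_cases h : (Int.gcd a b : ℤ) = 0
  · have h0 : Int.gcd a b = 0 := by exact_mod_cast h
    obtain ⟨rfl, rfl⟩ := Int.gcd_eq_zero_iff.1 h0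
    exact ⟨1, by simp⟩
  · obtain ⟨a', ha'⟩ := Int.gcd_dvd_left a b
    obtain ⟨b', hb'⟩ := Int.gcd_dvd_right a b
    have hb := Int.gcd_eq_gcd_ab a b
    set g : ℤ := ((Int.gcd a b : ℕ) : ℤ)
    refine ⟨!![Int.gcdA a b, Int.gcdB a b; -b', a'], ?_, ?_, ?_⟩
    · refine mul_left_cancel₀ h ?_
      simp
      linear_combination -Int.gcdA a b * ha' - Int.gcdB a b * hb' - hb
    · simp; linarith
    · simp
      linear_combination -b' * ha' + a' * hb'

/-- The real vector with coordinates `v` with respect to the lattice `ℤ ⊕ ℤ ⊕ ℤ ⊕ N ℤ`. -/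
def latVec (N : ℕ) (v : Fin 4 → ℤ) : Ix → ℝ :=
  Sum.elim ![(v 0 : ℝ), (v 1 : ℝ)] ![(v 2 : ℝ), N * (v 3 : ℝ)]

theorem patMat_mulVec_latVec {N : ℕ} (hN : 0 < N) (a b c d : Matrix (Fin 2) (Fin 2) ℤ)
    (v : Fin 4 → ℤ) : patMat N a b c d *ᵥ latVec N v = latVec N
      ![a 0 0 * v 0 + N * a 0 1 * v 1 + b 0 0 * v 2 + N * b 0 1 * v 3,
        a 1 0 * v 0 + a 1 1 * v 1 + b 1 0 * v 2 + b 1 1 * v 3,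
        c 0 0 * v 0 + N * c 0 1 * v 1 + d 0 0 * v 2 + N * d 0 1 * v 3,
        c 1 0 * v 0 + c 1 1 * v 1 + d 1 0 * v 2 + d 1 1 * v 3] := by
  have h : (N : ℝ) ≠ 0 := by exact_mod_cast hN.ne'
  ext i
  rcases i with i | i <;> fin_cases i <;>
  · simp [Matrix.mulVec, dotProduct, patMat, latVec, Fin.sum_univ_two]
    field_simp
    ring

/-- If the coordinates `v` of a lattice vector are such that `v₀, v₂, N v₁, N v₃` have no common prime
factor, then `K(N)` moves it to the first basis vector. -/
theorem exists_mem_mulVec_latVec_eq {N : ℕ} (hN : 0 < N) (v : Fin 4 → ℤ)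
    (hv : ∀ q : ℕ, q.Prime → ¬ ((q : ℤ) ∣ v 0 ∧ (q : ℤ) ∣ v 2 ∧ (q : ℤ) ∣ N * v 1 ∧
      (q : ℤ) ∣ N * v 3)) :
    ∃ γ ∈ paramodularGroup N, (γ : Matrix Ix Ix ℝ) *ᵥ latVec N v = latVec N ![1, 0, 0, 0] := by
  obtain ⟨x, hx, hx1, hx2⟩ := exists_sl_two_reduce (v 0) (v 2)
  obtain ⟨y, hy, hy1, hy2⟩ := exists_sl_two_reduce (v 1) (v 3)
  set g₁ : ℤ := ((Int.gcd (v 0) (v 2) : ℕ) : ℤ)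
  set g₂ : ℤ := ((Int.gcd (v 1) (v 3) : ℕ) : ℤ)
  have hcop : IsCoprime g₁ (N * g₂) := by
    rw [Int.isCoprime_iff_gcd_eq_one]
    by_contra hne
    obtain ⟨q, hq, hqd⟩ := Nat.exists_prime_and_dvd hne
    have h1 : (q : ℤ) ∣ g₁ := (Int.natCast_dvd_natCast.2 hqd).trans (Int.gcd_dvd_left _ _)
    have h2 : (q : ℤ) ∣ N * g₂ := (Int.natCast_dvd_natCast.2 hqd).trans (Int.gcd_dvd_right _ _)
    exact hv q hq ⟨h1.trans (Int.gcd_dvd_left _ _), h1.trans (Int.gcd_dvd_right _ _),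
      h2.trans (mul_dvd_mul_left _ (Int.gcd_dvd_left _ _)),
      h2.trans (mul_dvd_mul_left _ (Int.gcd_dvd_right _ _))⟩
  obtain ⟨α, β, hαβ⟩ := hcop
  obtain ⟨γ₁, hγ₁, e₁⟩ := exists_mem_eq_pairMat hN hx hy
  obtain ⟨γ₂, hγ₂, e₂⟩ := exists_mem_eq_leviMat hN (a := !![α, β; -g₂, g₁])
    (by simp; linarith)
  refine ⟨γ₂ * γ₁, mul_mem hγ₂ hγ₁, ?_⟩
  rw [Units.val_mul, ← mulVec_mulVec, e₁, e₂, pairMat, patMat_mulVec_latVec hN, leviMat,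
    patMat_mulVec_latVec hN]
  congr 1
  ext i
  fin_cases i
  · simp
    linear_combination hαβ + α * hx1 + N * β * hy1
  · simp
    linear_combination g₁ * hy1 - g₂ * hx1
  · simp
    linear_combination g₂ * hy2 * N + g₁ * hx2
  · simp
    linear_combination α * hy2 - β * hx2

/-- Elements of the rational plane spanned by the integral vectors `x` and `y`. -/
def InSpan (x y v : Fin 4 → ℤ) : Prop :=
  ∃ α β : ℚ, ∀ i, (v i : ℚ) = α * x i + β * y i

/-- In a plane isotropic for `v₀ w₂ - v₂ w₀ + N (v₁ w₃ - v₃ w₁)`, with `p` exactly dividing `N`,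
some integral vector has its outer coordinates `v₀, v₂` not both divisible by `p`: a vector `y`
without this property is congruent to a multiple of `x` modulo `p`, so `y` can be replaced by
`(y - λ x) / p`, which makes the minors of `x` and `y` smaller. -/
theorem exists_inSpan_not_dvd {N p : ℕ} (hp : p.Prime) (hpN : p ∣ N) (hpN2 : ¬ p ^ 2 ∣ N)
    (x : Fin 4 → ℤ) (hx0 : (p : ℤ) ∣ x 0) (hx2 : (p : ℤ) ∣ x 2)
    (hx13 : ¬ ((p : ℤ) ∣ x 1 ∧ (p : ℤ) ∣ x 3)) (i j : Fin 4) (n : ℕ) :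
    ∀ y : Fin 4 → ℤ, x 0 * y 2 - x 2 * y 0 + N * (x 1 * y 3 - x 3 * y 1) = 0 →
      x i * y j - x j * y i ≠ 0 → (x i * y j - x j * y i).natAbs = n →
      ∃ v, InSpan x y v ∧ ¬ ((p : ℤ) ∣ v 0 ∧ (p : ℤ) ∣ v 2) := by
  induction n using Nat.strong_induction_on with
  | _ n ih =>
  intro y hω hne hn
  by_cases hy : (p : ℤ) ∣ y 0 ∧ (p : ℤ) ∣ y 2
  swap
  · exact ⟨y, ⟨0, 1, fun i => by simp⟩, hy⟩
  have hpZ : Prime (p : ℤ) := Nat.prime_iff_prime_int.1 hp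
  have hp0 : (p : ℤ) ≠ 0 := hpZ.ne_zero
  obtain ⟨N', rfl⟩ := hpN
  have hN' : ¬ (p : ℤ) ∣ N' := fun h => hpN2 (by
    rw [pow_two]; exact mul_dvd_mul_left p (Int.natCast_dvd_natCast.1 h))
  have hminor : (p : ℤ) ∣ x 1 * y 3 - x 3 * y 1 := by
    obtain ⟨a, ha⟩ := hx0
    obtain ⟨b, hb⟩ := hx2
    obtain ⟨c, hc⟩ := hy.1
    obtain ⟨d, hd⟩ := hy.2
    have h : (p : ℤ) * (p * (a * d - b * c) + N' * (x 1 * y 3 - x 3 * y 1)) = 0 := by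
      rw [ha, hb, hc, hd] at hω
      push_cast at hω
      linear_combination hω
    have h' := (mul_eq_zero.1 h).resolve_left hp0
    refine (hpZ.dvd_or_dvd (a := (N' : ℤ)) ?_).resolve_left hN'
    exact ⟨-(a * d - b * c), by linear_combination h'⟩
  have hinv : ∀ t : ℤ, ¬ (p : ℤ) ∣ t → ∃ s r : ℤ, s * t = 1 + p * r := by
    intro t ht
    obtain ⟨u, v, huv⟩ := ((Prime.coprime_iff_not_dvd hpZ).2 ht)
    exact ⟨v, -u, by linear_combination huv⟩
  obtain ⟨l, h1, h3⟩ : ∃ l : ℤ, (p : ℤ) ∣ y 1 - l * x 1 ∧ (p : ℤ) ∣ y 3 - l * x 3 := by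
    obtain ⟨e, he⟩ := hminor
    by_cases h1 : (p : ℤ) ∣ x 1
    · have h3 : ¬ (p : ℤ) ∣ x 3 := fun h3 => hx13 ⟨h1, h3⟩
      obtain ⟨s, r, hs⟩ := hinv _ h3
      exact ⟨s * y 3, ⟨-(s * e) - r * y 1, by linear_combination -s * he - y 1 * hs⟩,
        ⟨-r * y 3, by linear_combination -y 3 * hs⟩⟩
    · obtain ⟨s, r, hs⟩ := hinv _ h1
      exact ⟨s * y 1, ⟨-r * y 1, by linear_combination -y 1 * hs⟩,
        ⟨s * e - r * y 3, by linear_combination s * he - y 3 * hs⟩⟩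
  have hall : ∀ i, (p : ℤ) ∣ y i - l * x i := by
    intro i
    fin_cases i
    · exact dvd_sub hy.1 (hx0.mul_left l)
    · exact h1
    · exact dvd_sub hy.2 (hx2.mul_left l)
    · exact h3
  choose z hz using hall
  have hmz : (p : ℤ) * (x i * z j - x j * z i) = x i * y j - x j * y i := by
    linear_combination -x i * hz j + x j * hz i
  have hz0 : x i * z j - x j * z i ≠ 0 := fun h => hne (by rw [← hmz, h, mul_zero])
  obtain ⟨v, ⟨α, β, hv⟩, hv'⟩ := ih (x i * z j - x j * z i).natAbs (by
      rw [← hn, ← hmz, Int.natAbs_mul, Int.natAbs_natCast]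
      have := Int.natAbs_pos.2 hz0
      nlinarith [hp.two_le]) z (by
      refine mul_left_cancel₀ hp0 ?_
      linear_combination hω - x 0 * hz 2 + x 2 * hz 0 - ((p * N' : ℕ) : ℤ) * (x 1 * hz 3 - x 3 * hz 1))
    hz0 rfl
  refine ⟨v, ⟨α - β * l / p, β / p, fun i => ?_⟩, hv'⟩
  have hpQ : (p : ℚ) ≠ 0 := by exact_mod_cast hp.ne_zero
  have hzi : (y i : ℚ) - l * x i = p * z i := by exact_mod_cast hz i
  rw [hv i]
  field_simp
  linear_combination -β * hzi

/-! ### The Iwasawa decomposition -/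

theorem exists_eq_mul_primitive (v : Fin 4 → ℤ) (hv : v ≠ 0) :
    ∃ (g : ℤ) (w : Fin 4 → ℤ), g ≠ 0 ∧ (∀ i, v i = g * w i) ∧
      ∀ q : ℕ, q.Prime → ¬ ∀ i, (q : ℤ) ∣ w i := by
  obtain ⟨w, hw, hw1⟩ := Finset.extract_gcd v (Finset.univ_nonempty (α := Fin 4))
  refine ⟨Finset.univ.gcd v, w, ?_, fun i => hw i (Finset.mem_univ i), fun q hq h => ?_⟩
  · intro h0
    exact hv (funext fun i => Finset.gcd_eq_zero_iff.1 h0 i (Finset.mem_univ i))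
  · have h1 : (q : ℤ) ∣ 1 := hw1 ▸ Finset.dvd_gcd fun i _ => h i
    exact (Nat.prime_iff_prime_int.1 hq).not_isUnit (isUnit_of_dvd_one h1)

/-- The plane spanned by the first two columns of a similitude in the paramodular order whose
multiplier is a power of `p`, with `p²` not dividing `N`, contains an integral vector that `K(N)`
moves to the first basis vector. -/
theorem exists_inSpan_unimodular {N p μ : ℕ} (hN : 0 < N) (hp : p.Prime) (hpN : ¬ p ^ 2 ∣ N)
    {a b c d : Matrix (Fin 2) (Fin 2) ℤ}
    (hs : IsSim (((p ^ μ : ℕ) : ℤ) : ℝ) (patMat N a b c d)) :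
    ∃ v, InSpan ![a 0 0, a 1 0, c 0 0, c 1 0] ![N * a 0 1, a 1 1, N * c 0 1, c 1 1] v ∧
      ∀ q : ℕ, q.Prime → ¬ ((q : ℤ) ∣ v 0 ∧ (q : ℤ) ∣ v 2 ∧ (q : ℤ) ∣ N * v 1 ∧
        (q : ℤ) ∣ N * v 3) := by
  obtain ⟨e1, -, e3, e4, e5, e6⟩ := (isSim_patMat_iff hN _ a b c d).1 hs
  set m : ℤ := ((p ^ μ : ℕ) : ℤ) with hm
  have hm0 : m ≠ 0 := by
    rw [hm]; exact_mod_cast pow_ne_zero _ hp.ne_zero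
  have hN0 : (N : ℤ) ≠ 0 := by exact_mod_cast hN.ne'
  have hqp : ∀ q : ℕ, q.Prime → (q : ℤ) ∣ m → q = p := fun q hq h =>
    (Nat.prime_dvd_prime_iff_eq hq hp).1 (hq.dvd_of_dvd_pow (Int.natCast_dvd_natCast.1 h))
  set X : Fin 4 → ℤ := ![a 0 0, a 1 0, c 0 0, c 1 0] with hX
  set Y : Fin 4 → ℤ := ![N * a 0 1, a 1 1, N * c 0 1, c 1 1] with hY
  have hX0 : X ≠ 0 := by
    intro h
    have h0 : a 0 0 = 0 := congrFun h 0
    have h1 : a 1 0 = 0 := congrFun h 1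
    have h2 : c 0 0 = 0 := congrFun h 2
    have h3 : c 1 0 = 0 := congrFun h 3
    rw [h0, h1, h2, h3] at e3
    exact hm0 (by linarith)
  obtain ⟨g, x, hg, hgx, hx⟩ := exists_eq_mul_primitive X hX0
  have hgx0 : a 0 0 = g * x 0 := hgx 0
  have hgx1 : a 1 0 = g * x 1 := hgx 1
  have hgx2 : c 0 0 = g * x 2 := hgx 2
  have hgx3 : c 1 0 = g * x 3 := hgx 3
  -- it suffices to find a vector whose outer coordinates have no common prime factor with `N`
  suffices H : ∃ v, InSpan X Y v ∧ ∀ q : ℕ, q.Prime → q ∣ N → ¬ ((q : ℤ) ∣ v 0 ∧ (q : ℤ) ∣ v 2) by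
    obtain ⟨v, ⟨α, β, hαβ⟩, hv⟩ := H
    by_cases hv0 : v = 0
    · refine ⟨x, ⟨(g : ℚ)⁻¹, 0, fun i => ?_⟩, fun q hq hd => ?_⟩
      · have : (g : ℚ) ≠ 0 := by exact_mod_cast hg
        rw [hgx i]; push_cast; field_simp; ring
      · by_cases hqN : q ∣ N
        · exact hv q hq hqN (by simp [hv0])
        · have hqN' : ¬ (q : ℤ) ∣ N := fun h => hqN (Int.natCast_dvd_natCast.1 h)
          have hqZ := Nat.prime_iff_prime_int.1 hq
          refine hx q hq fun i => ?_
          fin_cases i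
          · exact hd.1
          · exact (hqZ.dvd_or_dvd hd.2.2.1).resolve_left hqN'
          · exact hd.2.1
          · exact (hqZ.dvd_or_dvd hd.2.2.2).resolve_left hqN'
    · obtain ⟨h, w, hh, hw, hw'⟩ := exists_eq_mul_primitive v hv0
      refine ⟨w, ⟨α / h, β / h, fun i => ?_⟩, fun q hq hd => ?_⟩
      · have h1 : (h : ℚ) ≠ 0 := by exact_mod_cast hh
        have h2 := hαβ i
        rw [hw i] at h2
        push_cast at h2
        field_simp
        linear_combination h2
      · by_cases hqN : q ∣ N
        · refine hv q hq hqN ⟨?_, ?_⟩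
          · rw [hw 0]; exact hd.1.mul_left h
          · rw [hw 2]; exact hd.2.1.mul_left h
        · have hqN' : ¬ (q : ℤ) ∣ N := fun h => hqN (Int.natCast_dvd_natCast.1 h)
          have hqZ := Nat.prime_iff_prime_int.1 hq
          refine hw' q hq fun i => ?_
          fin_cases i
          · exact hd.1
          · exact (hqZ.dvd_or_dvd hd.2.2.1).resolve_left hqN'
          · exact hd.2.1
          · exact (hqZ.dvd_or_dvd hd.2.2.2).resolve_left hqN'
  have hxspan : ∀ i, (x i : ℚ) = (g : ℚ)⁻¹ * X i := fun i => by
    have : (g : ℚ) ≠ 0 := by exact_mod_cast hg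
    rw [hgx i]; push_cast; field_simp
  -- away from `p` the first column has the required property
  have hxq : ∀ q : ℕ, q.Prime → q ∣ N → q ≠ p → ¬ ((q : ℤ) ∣ x 0 ∧ (q : ℤ) ∣ x 2) := by
    rintro q hq ⟨N', hN'⟩ hne ⟨⟨s, hs'⟩, ⟨t, ht⟩⟩
    refine hne (hqp q hq ⟨d 0 0 * g * s + N' * (d 1 0 * a 1 0) - b 0 0 * g * t
      - N' * (b 1 0 * c 1 0), ?_⟩)
    rw [← e3, hgx0, hgx2, hs', ht, hN']
    push_cast
    ring
  by_cases hgood : p ∣ N ∧ (p : ℤ) ∣ x 0 ∧ (p : ℤ) ∣ x 2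
  swap
  · refine ⟨x, ⟨(g : ℚ)⁻¹, 0, fun i => by rw [hxspan]; ring⟩, fun q hq hqN hd => ?_⟩
    by_cases hqp' : q = p
    · subst hqp'; exact hgood ⟨hqN, hd⟩
    · exact hxq q hq hqN hqp' hd
  obtain ⟨hpN', hx0, hx2⟩ := hgood
  have hx13 : ¬ ((p : ℤ) ∣ x 1 ∧ (p : ℤ) ∣ x 3) := by
    rintro ⟨h1, h3⟩
    refine hx p hp fun i => ?_
    fin_cases i
    exacts [hx0, h1, hx2, h3]
  have hω : x 0 * Y 2 - x 2 * Y 0 + N * (x 1 * Y 3 - x 3 * Y 1) = 0 := by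
    refine mul_left_cancel₀ hg ?_
    simp only [hY, Matrix.cons_val]
    rw [hgx0, hgx1, hgx2, hgx3] at e1
    linear_combination -N * e1
  -- the first two columns are independent: two linear forms separate them
  obtain ⟨i, j, hij⟩ : ∃ i j, x i * Y j - x j * Y i ≠ 0 := by
    by_contra! hall
    have hYz : ∀ j, Y j = 0 := by
      intro j
      have h0 := hall 0 j
      have h1 := hall 1 j
      have h2 := hall 2 j
      have h3 := hall 3 j
      simp only [hY, Matrix.cons_val] at h0 h1 h2 h3
      refine mul_left_cancel₀ hm0 ?_
      rw [mul_zero, ← e3, hgx0, hgx1, hgx2, hgx3]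
      simp only [hY]
      linear_combination g * d 0 0 * h0 + g * N * d 1 0 * h1 - g * b 0 0 * h2 - g * N * b 1 0 * h3
        + g * x j * N * e4
    have h0 : N * a 0 1 = 0 := hYz 0
    have h1 : a 1 1 = 0 := hYz 1
    have h2 : N * c 0 1 = 0 := hYz 2
    have h3 : c 1 1 = 0 := hYz 3
    refine hm0 ?_
    rw [← e6]
    linear_combination d 0 1 * h0 + d 1 1 * h1 - b 0 1 * h2 - b 1 1 * h3
  obtain ⟨y, ⟨α, β, hy⟩, hyp⟩ := exists_inSpan_not_dvd hp hpN' hpN x hx0 hx2 hx13 i j _ Y hω hij rfl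
  obtain ⟨N', hN'⟩ := hpN'
  refine ⟨fun i => x i + N' * y i, ⟨(1 + N' * α) * (g : ℚ)⁻¹, N' * β, fun i => ?_⟩,
    fun q hq hqN hd => ?_⟩
  · push_cast
    rw [hy i, hxspan i]
    ring
  have hqZ := Nat.prime_iff_prime_int.1 hq
  by_cases hqp' : q = p
  · subst hqp'
    have hN'' : ¬ (q : ℤ) ∣ N' := fun h => hpN (by
      rw [pow_two, hN']; exact mul_dvd_mul_left q (Int.natCast_dvd_natCast.1 h))
    exact hyp ⟨(hqZ.dvd_or_dvd ((dvd_add_right hx0).1 hd.1)).resolve_left hN'',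
      (hqZ.dvd_or_dvd ((dvd_add_right hx2).1 hd.2)).resolve_left hN''⟩
  · have h1 : (q : ℤ) ∣ N' := by
      rw [hN'] at hqN
      rcases hq.dvd_mul.1 hqN with h | h
      · exact absurd ((Nat.prime_dvd_prime_iff_eq hq hp).1 h) hqp'
      · exact Int.natCast_dvd_natCast.2 h
    exact hxq q hq hqN hqp' ⟨(dvd_add_left (h1.mul_right _)).1 hd.1,
      (dvd_add_left (h1.mul_right _)).1 hd.2⟩

/-- The Iwasawa decomposition relative to the Siegel parabolic subgroup. An integral vector of the
isotropic plane spanned by the first two columns is moved to the first basis vector; by isotropy the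
image of the plane is then spanned by this vector and one in the coordinates `2, 4`, on which a copy
of `SL₂(ℤ)` acts. -/
theorem exists_mul_eq_patMat_upper {N p μ : ℕ} (hN : 0 < N) (hp : p.Prime) (hpN : ¬ p ^ 2 ∣ N)
    {t : Matrix Ix Ix ℝ} (ht : IsPat N t) (hs : IsSim (((p ^ μ : ℕ) : ℤ) : ℝ) t) :
    ∃ κ ∈ paramodularGroup N, ∃ a b d, (κ : Matrix Ix Ix ℝ) * t = patMat N a b 0 d := by
  have hNR : (N : ℝ) ≠ 0 := by exact_mod_cast hN.ne'
  obtain ⟨a, b, c, d, rfl⟩ := ht.exists_patMat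
  obtain ⟨v, ⟨α, β, hv⟩, hv'⟩ := exists_inSpan_unimodular hN hp hpN hs
  obtain ⟨κ, hκ, hκv⟩ := exists_mem_mulVec_latVec_eq hN v hv'
  have hpat2 : IsPat N ((κ : Matrix Ix Ix ℝ) * patMat N a b c d) :=
    (isPat_of_mem hN hκ).mul hN (isPat_patMat _ _ _ _ _)
  have hs2 := (isSim_of_mem hκ).mul hs
  obtain ⟨a', b', c', d', ht2⟩ := hpat2.exists_patMat
  rw [ht2, one_mul] at hs2
  obtain ⟨e1, -⟩ := (isSim_patMat_iff hN _ _ _ _ _).1 hs2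
  rify at e1
  -- the vector `v` is the image of `(α, β, 0, 0)` under the original matrix
  have hlv : latVec N v = patMat N a b c d *ᵥ Sum.elim ![(α : ℝ), (β : ℝ)] ![0, 0] := by
    have hvR : ∀ i, (v i : ℝ) = α * (![a 0 0, a 1 0, c 0 0, c 1 0] : Fin 4 → ℤ) i
        + β * (![N * a 0 1, a 1 1, N * c 0 1, c 1 1] : Fin 4 → ℤ) i := fun i => by
      exact_mod_cast hv i
    have h0 := hvR 0
    have h1 := hvR 1
    have h2 := hvR 2
    have h3 := hvR 3
    simp at h0 h1 h2 h3
    ext i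
    rcases i with i | i <;> fin_cases i <;>
    · simp [Matrix.mulVec, dotProduct, patMat, latVec, Fin.sum_univ_two, h0, h1, h2, h3]
      ring
  rw [hlv, mulVec_mulVec, ht2] at hκv
  have f0 := congrFun hκv (Sum.inl 0)
  have f1 := congrFun hκv (Sum.inl 1)
  have f2 := congrFun hκv (Sum.inr 0)
  have f3 := congrFun hκv (Sum.inr 1)
  simp [Matrix.mulVec, dotProduct, patMat, latVec, Fin.sum_univ_two] at f0 f1 f2 f3
  have f3' : (c' 1 0 : ℝ) * α + c' 1 1 * β = 0 := by
    refine mul_left_cancel₀ hNR ?_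
    linear_combination f3
  -- by isotropy the third row vanishes in the first two columns
  have hc00 : c' 0 0 = 0 := by
    have h : (c' 0 0 : ℝ) = 0 := by
      linear_combination (-(c' 0 0 : ℝ)) * f0 + (a' 0 0 : ℝ) * f2 + N * β * e1
        + N * (a' 1 0 : ℝ) * f3' - N * (c' 1 0 : ℝ) * f1
    exact_mod_cast h
  have hc01 : c' 0 1 = 0 := by
    have h : (c' 0 1 : ℝ) = 0 := by
      linear_combination (-(c' 0 1 : ℝ)) * f0 + (a' 0 1 : ℝ) * f2 - α * e1
        + (a' 1 1 : ℝ) * f3' - (c' 1 1 : ℝ) * f1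
    exact_mod_cast h
  rw [hc00, hc01] at e1
  have e1' : c' 1 0 * a' 1 1 = a' 1 0 * c' 1 1 := by
    have : (c' 1 0 : ℝ) * a' 1 1 = a' 1 0 * c' 1 1 := by
      simpa using e1
    exact_mod_cast this
  -- the second and fourth entries of the two columns are proportional
  obtain ⟨y, hy, h1, h2⟩ : ∃ y : Matrix (Fin 2) (Fin 2) ℤ,
      y 0 0 * y 1 1 - y 0 1 * y 1 0 = 1 ∧ y 1 0 * a' 1 0 + y 1 1 * c' 1 0 = 0 ∧
        y 1 0 * a' 1 1 + y 1 1 * c' 1 1 = 0 := by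
    by_cases h0 : Int.gcd (a' 1 0) (c' 1 0) = 0
    · obtain ⟨ha, hc⟩ := Int.gcd_eq_zero_iff.1 h0
      obtain ⟨y, hy, -, hy2⟩ := exists_sl_two_reduce (a' 1 1) (c' 1 1)
      exact ⟨y, hy, by rw [ha, hc]; ring, hy2⟩
    · obtain ⟨y, hy, hy1, hy2⟩ := exists_sl_two_reduce (a' 1 0) (c' 1 0)
      refine ⟨y, hy, hy2, ?_⟩
      have hg : ((Int.gcd (a' 1 0) (c' 1 0) : ℕ) : ℤ) ≠ 0 := by exact_mod_cast h0
      refine mul_left_cancel₀ hg ?_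
      rw [← hy1]
      linear_combination (y 0 0 * a' 1 1 + y 0 1 * c' 1 1) * hy2
        + (y 0 0 * y 1 1 - y 0 1 * y 1 0) * (-e1')
  obtain ⟨κ', hκ', e'⟩ := exists_mem_eq_pairMat hN (x := 1) (y := y) (by simp) hy
  have hpat3 : IsPat N ((κ' * κ : GL Ix ℝ) * patMat N a b c d : Matrix Ix Ix ℝ) :=
    (isPat_of_mem hN (mul_mem hκ' hκ)).mul hN (isPat_patMat _ _ _ _ _)
  obtain ⟨a3, b3, c3, d3, ht3⟩ := hpat3.exists_patMat
  refine ⟨κ' * κ, mul_mem hκ' hκ, a3, b3, d3, ?_⟩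
  rw [ht3]
  have hmul : patMat N a3 b3 c3 d3 = pairMat N 1 y * patMat N a' b' c' d' := by
    rw [← ht3, ← ht2, ← e', Units.val_mul, Matrix.mul_assoc]
  have g00 := congrFun (congrFun hmul (Sum.inr 0)) (Sum.inl 0)
  have g01 := congrFun (congrFun hmul (Sum.inr 0)) (Sum.inl 1)
  have g10 := congrFun (congrFun hmul (Sum.inr 1)) (Sum.inl 0)
  have g11 := congrFun (congrFun hmul (Sum.inr 1)) (Sum.inl 1)
  simp [pairMat, patMat, Matrix.mul_apply, Fin.sum_univ_two, hc00, hc01]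
    at g00 g01 g10 g11
  have h1R : (y 1 0 : ℝ) * a' 1 0 + y 1 1 * c' 1 0 = 0 := by exact_mod_cast h1
  have h2R : (y 1 0 : ℝ) * a' 1 1 + y 1 1 * c' 1 1 = 0 := by exact_mod_cast h2
  have hc3 : c3 = 0 := by
    ext i j
    fin_cases i <;> fin_cases j
    · exact_mod_cast g00
    · simpa [hN.ne'] using g01
    · have : (N : ℝ) * c3 1 0 = N * 0 := by rw [g10]; linear_combination N * h1R
      exact_mod_cast mul_left_cancel₀ hNR this
    · have : (N : ℝ) * c3 1 1 = N * 0 := by rw [g11]; linear_combination N * h2R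
      exact_mod_cast mul_left_cancel₀ hNR this
  rw [hc3]

/-! ### Twisting by `diag(u, u, 1, 1)` -/

/-- Congruence modulo `m` in the paramodular order. -/
def IsCong (N : ℕ) (m : ℤ) (g h : Matrix Ix Ix ℝ) : Prop :=
  ∃ r, IsPat N r ∧ g = h + (m : ℝ) • r

theorem IsCong.refl (N : ℕ) (m : ℤ) (g : Matrix Ix Ix ℝ) : IsCong N m g g :=
  ⟨0, fun _ _ => ⟨0, by simp⟩, by simp⟩

theorem IsPat.neg {N : ℕ} {g : Matrix Ix Ix ℝ} (hg : IsPat N g) : IsPat N (-g) := by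
  simpa using hg.smul (-1)

theorem IsCong.symm {N : ℕ} {m : ℤ} {g h : Matrix Ix Ix ℝ} (H : IsCong N m g h) :
    IsCong N m h g := by
  obtain ⟨r, hr, rfl⟩ := H
  exact ⟨-r, hr.neg, by simp⟩

theorem IsCong.trans {N : ℕ} {m : ℤ} {g h k : Matrix Ix Ix ℝ} (H : IsCong N m g h)
    (H' : IsCong N m h k) : IsCong N m g k := by
  obtain ⟨r, hr, rfl⟩ := H
  obtain ⟨s, hs, rfl⟩ := H'
  exact ⟨s + r, hs.add hr, by rw [smul_add, add_assoc]⟩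

theorem IsCong.mul {N : ℕ} (hN : 0 < N) {m : ℤ} {g h g' h' : Matrix Ix Ix ℝ} (H : IsCong N m g h)
    (H' : IsCong N m g' h') (hg : IsPat N g) (hh' : IsPat N h') :
    IsCong N m (g * g') (h * h') := by
  obtain ⟨r, hr, e⟩ := H
  obtain ⟨s, hs, rfl⟩ := H'
  refine ⟨r * h' + g * s, (hr.mul hN hh').add (hg.mul hN hs), ?_⟩
  rw [Matrix.mul_add, smul_add, ← add_assoc, Matrix.mul_smul]
  congr 1
  rw [e, Matrix.add_mul, Matrix.smul_mul]

theorem adj_add (g h : Matrix Ix Ix ℝ) : adj (g + h) = adj g + adj h := by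
  simp only [adj, transpose_add, Matrix.mul_add, Matrix.add_mul, neg_add]

theorem adj_smul (x : ℝ) (g : Matrix Ix Ix ℝ) : adj (x • g) = x • adj g := by
  simp only [adj, transpose_smul, Matrix.mul_smul, Matrix.smul_mul, smul_neg]

theorem IsCong.adj {N : ℕ} {m : ℤ} {g h : Matrix Ix Ix ℝ} (H : IsCong N m g h) :
    IsCong N m (adj g) (adj h) := by
  obtain ⟨r, hr, rfl⟩ := H
  exact ⟨Paramodular.adj r, hr.adj, by rw [adj_add, adj_smul]⟩

/-- Multiplication of the upper right block by `u` and of the lower left block by `v`. For `u v = 1`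
it is conjugation by the similitude `diag(u, u, 1, 1)`. -/
def twist (u v : ℤ) (g : Matrix Ix Ix ℝ) : Matrix Ix Ix ℝ :=
  fromBlocks g.toBlocks₁₁ ((u : ℝ) • g.toBlocks₁₂) ((v : ℝ) • g.toBlocks₂₁) g.toBlocks₂₂

theorem IsPat.twist {N : ℕ} {g : Matrix Ix Ix ℝ} (hg : IsPat N g) (u v : ℤ) :
    IsPat N (twist u v g) := by
  rintro (i | i) (j | j)
  · exact hg _ _
  · obtain ⟨z, hz⟩ := hg (Sum.inl i) (Sum.inr j)
    exact ⟨u * z, by push_cast; rw [mul_assoc, ← hz]; rfl⟩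
  · obtain ⟨z, hz⟩ := hg (Sum.inr i) (Sum.inl j)
    exact ⟨v * z, by push_cast; rw [mul_assoc, ← hz]; rfl⟩
  · exact hg _ _

theorem isPat_offDiagonal {N : ℕ} {a b c d : Matrix (Fin 2) (Fin 2) ℝ}
    (hg : IsPat N (fromBlocks a b c d)) (x y : ℤ) :
    IsPat N (fromBlocks 0 ((x : ℝ) • b) ((y : ℝ) • c) 0) := by
  rintro (i | i) (j | j)
  · exact ⟨0, by simp⟩
  · obtain ⟨z, hz⟩ := hg (Sum.inl i) (Sum.inr j)
    exact ⟨x * z, by push_cast; rw [mul_assoc, ← hz]; rfl⟩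
  · obtain ⟨z, hz⟩ := hg (Sum.inr i) (Sum.inl j)
    exact ⟨y * z, by push_cast; rw [mul_assoc, ← hz]; rfl⟩
  · exact ⟨0, by simp⟩

/-- Twisting is multiplicative modulo `m` if `u v ≡ 1` modulo `m`. -/
theorem isCong_twist_mul {N : ℕ} (hN : 0 < N) {m u v q : ℤ} (huv : u * v = 1 + m * q)
    {g h : Matrix Ix Ix ℝ} (hg : IsPat N g) (hh : IsPat N h) :
    IsCong N m (twist u v g * twist u v h) (twist u v (g * h)) := by
  rw [← fromBlocks_toBlocks g] at hg ⊢
  rw [← fromBlocks_toBlocks h] at hh ⊢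
  set a := g.toBlocks₁₁
  set b := g.toBlocks₁₂
  set c := g.toBlocks₂₁
  set d := g.toBlocks₂₂
  set a' := h.toBlocks₁₁
  set b' := h.toBlocks₁₂
  set c' := h.toBlocks₂₁
  set d' := h.toBlocks₂₂
  refine ⟨_, ((isPat_offDiagonal hg 1 1).mul hN (isPat_offDiagonal hh 1 1)).smul q, ?_⟩
  have huv' : (u : ℝ) * v = 1 + m * q := by exact_mod_cast huv
  have hvu' : (v : ℝ) * u = 1 + m * q := by rw [mul_comm]; exact huv'
  simp only [twist, fromBlocks_multiply, toBlocks_fromBlocks₁₁, toBlocks_fromBlocks₁₂,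
    toBlocks_fromBlocks₂₁, toBlocks_fromBlocks₂₂, fromBlocks_smul, fromBlocks_add]
  congr 1
  · simp only [Matrix.smul_mul, Matrix.mul_smul, smul_smul, hvu', add_smul, one_smul, Int.cast_one,
      Matrix.zero_mul, zero_add, add_assoc]
  · simp
  · simp
  · simp only [Matrix.smul_mul, Matrix.mul_smul, smul_smul, huv', add_smul, one_smul, Int.cast_one,
      Matrix.zero_mul, add_zero]
    abel

theorem twist_adj (u v : ℤ) (g : Matrix Ix Ix ℝ) : adj (twist u v g) = twist u v (adj g) := by
  conv_rhs => rw [← fromBlocks_toBlocks g]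
  rw [twist, adj_fromBlocks, adj_fromBlocks, twist]
  simp

/-- The elements of `K(N)` whose twist is congruent modulo `m` to an element of `K(N)`. -/
def IsTwistable (N : ℕ) (m u v : ℤ) (γ : GL Ix ℝ) : Prop :=
  ∃ γ' ∈ paramodularGroup N, IsCong N m (γ' : Matrix Ix Ix ℝ) (twist u v (γ : Matrix Ix Ix ℝ))

theorem coe_inv_eq_adj {N : ℕ} {γ : GL Ix ℝ} (hγ : γ ∈ paramodularGroup N) :
    ((γ⁻¹ : GL Ix ℝ) : Matrix Ix Ix ℝ) = adj (γ : Matrix Ix Ix ℝ) := by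
  have h : adj (γ : Matrix Ix Ix ℝ) * γ = 1 := by
    rw [adj_mul_self (isSim_of_mem hγ), one_smul]
  calc ((γ⁻¹ : GL Ix ℝ) : Matrix Ix Ix ℝ) = (adj (γ : Matrix Ix Ix ℝ) * γ) * (γ⁻¹ : GL Ix ℝ) := by
        rw [h, one_mul]
    _ = _ := by rw [Matrix.mul_assoc, Units.mul_inv, mul_one]

theorem IsTwistable.mul {N : ℕ} (hN : 0 < N) {m u v q : ℤ} (huv : u * v = 1 + m * q)
    {γ δ : GL Ix ℝ} (hγ : γ ∈ paramodularGroup N) (hδ : δ ∈ paramodularGroup N)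
    (h : IsTwistable N m u v γ) (h' : IsTwistable N m u v δ) : IsTwistable N m u v (γ * δ) := by
  obtain ⟨γ', hγ', hc⟩ := h
  obtain ⟨δ', hδ', hc'⟩ := h'
  refine ⟨γ' * δ', mul_mem hγ' hδ', ?_⟩
  rw [Units.val_mul, Units.val_mul]
  exact (hc.mul hN hc' (isPat_of_mem hN hγ') ((isPat_of_mem hN hδ).twist u v)).trans
    (isCong_twist_mul hN huv (isPat_of_mem hN hγ) (isPat_of_mem hN hδ))

theorem IsTwistable.inv {N : ℕ} {m u v : ℤ} {γ : GL Ix ℝ} (hγ : γ ∈ paramodularGroup N)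
    (h : IsTwistable N m u v γ) : IsTwistable N m u v γ⁻¹ := by
  obtain ⟨γ', hγ', hc⟩ := h
  refine ⟨γ'⁻¹, inv_mem hγ', ?_⟩
  rw [coe_inv_eq_adj hγ', coe_inv_eq_adj hγ, ← twist_adj]
  exact hc.adj

theorem isTwistable_upper {N : ℕ} (hN : 0 < N) (m u v : ℤ) {γ : GL Ix ℝ} (s : Fin 3 → ℤ)
    (e : (γ : Matrix Ix Ix ℝ) = patMat N 1 (symInt s) 0 1) : IsTwistable N m u v γ := by
  obtain ⟨γ', hγ', e'⟩ := exists_mem_eq_upper hN (u • s)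
  refine ⟨γ', hγ', ?_⟩
  convert IsCong.refl N m _
  rw [e, e', twist, patMat, patMat]
  simp only [toBlocks_fromBlocks₁₁, toBlocks_fromBlocks₁₂, toBlocks_fromBlocks₂₁,
    toBlocks_fromBlocks₂₂]
  congr 1 <;> ext i j <;> fin_cases i <;> fin_cases j <;> simp [symInt, mul_div_assoc]

theorem isTwistable_lower {N : ℕ} (hN : 0 < N) (m u v : ℤ) {γ : GL Ix ℝ} (s : Fin 3 → ℤ)
    (e : (γ : Matrix Ix Ix ℝ) = patMat N 1 0 (symInt s) 1) : IsTwistable N m u v γ := by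
  obtain ⟨γ', hγ', e'⟩ := exists_mem_eq_lower hN (v • s)
  refine ⟨γ', hγ', ?_⟩
  convert IsCong.refl N m _
  rw [e, e', twist, patMat, patMat]
  simp only [toBlocks_fromBlocks₁₁, toBlocks_fromBlocks₁₂, toBlocks_fromBlocks₂₁,
    toBlocks_fromBlocks₂₂]
  congr 1 <;> ext i j <;> fin_cases i <;> fin_cases j <;> simp [symInt, mul_left_comm]

theorem isCong_patMat (N : ℕ) (m : ℤ) (a b c d a' b' c' d' : Matrix (Fin 2) (Fin 2) ℤ) :
    IsCong N m (patMat N (a + m • a') (b + m • b') (c + m • c') (d + m • d'))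
      (patMat N a b c d) := by
  refine ⟨_, isPat_patMat N a' b' c' d', ?_⟩
  simp only [patMat, fromBlocks_smul, fromBlocks_add]
  congr 1 <;> ext i j <;> fin_cases i <;> fin_cases j <;>
    simp [-zsmul_eq_mul] <;> ring

/-- The quarter turn of `SL₂(ℤ)`, or the identity. -/
def turn (b : Bool) : Matrix (Fin 2) (Fin 2) ℤ := if b then !![0, 1; -1, 0] else 1

theorem turn_det (b : Bool) : turn b 0 0 * turn b 1 1 - turn b 0 1 * turn b 1 0 = 1 := by
  cases b <;> simp [turn]

theorem isTwistable_pairMat_turn {N : ℕ} (hN : 0 < N) {m u v q : ℤ} (huv : u * v = 1 + m * (m * q))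
    {γ : GL Ix ℝ} (b b' : Bool) (e : (γ : Matrix Ix Ix ℝ) = pairMat N (turn b) (turn b')) :
    IsTwistable N m u v γ := by
  have key : ∀ b : Bool, ∃ x x' : Matrix (Fin 2) (Fin 2) ℤ,
      x 0 0 * x 1 1 - x 0 1 * x 1 0 = 1 ∧
        x = !![turn b 0 0, u * turn b 0 1; v * turn b 1 0, turn b 1 1] + m • x' := by
    intro b
    cases b
    · exact ⟨1, 0, by simp, by ext i j; fin_cases i <;> fin_cases j <;> simp [turn]⟩
    -- the matrix with rows `(0, u)`, `(-v, 0)` has determinant `u v ≡ 1` modulo `m²`, and is corrected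
    -- by multiples of `m` on the diagonal
    · refine ⟨!![m, u; -v, -(m * q)], !![1, 0; 0, -q], ?_, ?_⟩
      · simp; linear_combination huv
      · ext i j; fin_cases i <;> fin_cases j <;> simp [turn]
  obtain ⟨x, x', hx, ex⟩ := key b
  obtain ⟨y, y', hy, ey⟩ := key b'
  obtain ⟨γ', hγ', e'⟩ := exists_mem_eq_pairMat hN hx hy
  refine ⟨γ', hγ', ?_⟩
  rw [e', e]
  convert isCong_patMat N m
    !![turn b 0 0, 0; 0, turn b' 0 0] !![u * turn b 0 1, 0; 0, u * turn b' 0 1]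
    !![v * turn b 1 0, 0; 0, v * turn b' 1 0] !![turn b 1 1, 0; 0, turn b' 1 1]
    !![x' 0 0, 0; 0, y' 0 0] !![x' 0 1, 0; 0, y' 0 1]
    !![x' 1 0, 0; 0, y' 1 0] !![x' 1 1, 0; 0, y' 1 1] using 1
  · rw [pairMat]
    congr 1 <;> ext i j <;> fin_cases i <;> fin_cases j <;> simp [ex, ey, -zsmul_eq_mul]
  · rw [pairMat, twist, patMat, patMat]
    simp only [toBlocks_fromBlocks₁₁, toBlocks_fromBlocks₁₂, toBlocks_fromBlocks₂₁,
      toBlocks_fromBlocks₂₂]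
    congr 1 <;> ext i j <;> fin_cases i <;> fin_cases j <;> simp [mul_div_assoc, mul_left_comm]

/-- For a prime `p`, one of the four coordinate choices makes the upper left block of an element
of `K(N)` invertible modulo `p`. The other two minors of the first two columns are controlled by
isotropy and the Plücker relation. -/
theorem exists_minor_not_dvd {N p : ℕ} (hN : 0 < N) (hp : p.Prime)
    {a b c d : Matrix (Fin 2) (Fin 2) ℤ} (hs : IsSim 1 (patMat N a b c d)) :
    ¬ ((p : ℤ) ∣ a 0 0 * a 1 1 - N * (a 0 1 * a 1 0) ∧
      (p : ℤ) ∣ c 0 0 * a 1 1 - N * (c 0 1 * a 1 0) ∧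
      (p : ℤ) ∣ a 0 0 * c 1 1 - N * (a 0 1 * c 1 0) ∧
      (p : ℤ) ∣ c 0 0 * c 1 1 - N * (c 0 1 * c 1 0)) := by
  rintro ⟨⟨k1, h1⟩, ⟨k2, h2⟩, ⟨k3, h3⟩, ⟨k4, h4⟩⟩
  obtain ⟨e1, -, e3, e4, e5, e6⟩ := (isSim_patMat_iff hN 1 a b c d).1 (by simpa using hs)
  have hpZ := Nat.prime_iff_prime_int.1 hp
  set δ := a 0 0 * c 0 1 - c 0 0 * a 0 1 with hδ
  have hδ' : c 1 0 * a 1 1 - a 1 0 * c 1 1 = δ := by rw [hδ]; linear_combination e1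
  have hpl : (p : ℤ) ∣ N * δ * δ :=
    ⟨(c 0 0 * a 1 1 - N * (c 0 1 * a 1 0)) * k3 - k1 * (c 0 0 * c 1 1 - N * (c 0 1 * c 1 0)), by
      linear_combination (c 0 0 * a 1 1 - N * (c 0 1 * a 1 0)) * h3
        - (c 0 0 * c 1 1 - N * (c 0 1 * c 1 0)) * h1 - N * δ * hδ'
        + N * (c 1 0 * a 1 1 - a 1 0 * c 1 1) * hδ⟩
  have hNδ : (p : ℤ) ∣ N * δ := by
    rcases hpZ.dvd_or_dvd hpl with h | h
    · exact h
    · exact h.mul_left _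
  obtain ⟨k, hk⟩ := hNδ
  refine hpZ.not_isUnit (isUnit_of_dvd_one
    ⟨(d 0 0 * d 1 1 - N * (d 1 0 * d 0 1)) * k1 + (b 0 0 * d 0 1 - d 0 0 * b 0 1) * k
      + (N * (b 1 0 * d 0 1) - d 0 0 * b 1 1) * k3 - (b 0 0 * d 1 1 - N * (d 1 0 * b 0 1)) * k2
      - (b 1 0 * d 1 1 - d 1 0 * b 1 1) * k + (b 0 0 * b 1 1 - N * (b 1 0 * b 0 1)) * k4, ?_⟩)
  linear_combination (d 0 0 * d 1 1 - N * (d 1 0 * d 0 1)) * h1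
    + (b 0 0 * d 0 1 - d 0 0 * b 0 1) * hk
    + (N * (b 1 0 * d 0 1) - d 0 0 * b 1 1) * h3 - (b 0 0 * d 1 1 - N * (d 1 0 * b 0 1)) * h2
    - (b 1 0 * d 1 1 - d 1 0 * b 1 1) * hk + (b 0 0 * b 1 1 - N * (b 1 0 * b 0 1)) * h4
    - N * (b 1 0 * d 1 1 - d 1 0 * b 1 1) * hδ' - e6
    - (N * (d 0 1 * a 0 1) + d 1 1 * a 1 1 - N * (b 0 1 * c 0 1) - b 1 1 * c 1 1) * e3
    + N * (d 0 1 * a 0 0 + d 1 1 * a 1 0 - b 0 1 * c 0 0 - b 1 1 * c 1 0) * e4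

/-! ### Stability of the double coset under twists; finiteness -/

theorem adj_patMat (N : ℕ) (a b c d : Matrix (Fin 2) (Fin 2) ℤ) :
    adj (patMat N a b c d) = patMat N dᵀ (-bᵀ) (-cᵀ) aᵀ := by
  rw [patMat, adj_fromBlocks, patMat]
  congr 1 <;> ext i j <;> fin_cases i <;> fin_cases j <;> simp [neg_div]

/-- The symmetry of `a bᵀ`, in integral coordinates. -/
theorem upper_symm_of_isSim {N : ℕ} (hN : 0 < N) {m : ℤ} (hm : m ≠ 0)
    {a b c d : Matrix (Fin 2) (Fin 2) ℤ} (hs : IsSim m (patMat N a b c d)) :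
    a 0 0 * b 1 0 + a 0 1 * b 1 1 = b 0 0 * a 1 0 + b 0 1 * a 1 1 := by
  have h := isSim_adj (by exact_mod_cast hm) hs
  rw [adj_patMat] at h
  have h2 := ((isSim_patMat_iff hN m _ _ _ _).1 h).2.1
  simp at h2
  linear_combination -h2

theorem smul_fromBlocks_eq_sub (m : ℝ) (a b c d b₁ c₁ b₀ c₀ : Matrix (Fin 2) (Fin 2) ℝ)
    (hb : b₁ = b + m • b₀) (hc : c₁ = c + m • c₀) :
    fromBlocks a b₁ c₁ d = fromBlocks a b c d + m • fromBlocks 0 b₀ c₀ 0 := by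
  rw [fromBlocks_smul, fromBlocks_add, hb, hc]
  simp

/-- An element of `K(N)` whose upper left block is invertible modulo `m` is twistable: it is a
product of a lower unipotent element, an element which is block diagonal modulo `m`, and an upper
unipotent element. -/
theorem isTwistable_of_isCoprime {N : ℕ} (hN : 0 < N) {m u v q : ℤ} (huv : u * v = 1 + m * q)
    {γ : GL Ix ℝ} (hγ : γ ∈ paramodularGroup N) {a b c d : Matrix (Fin 2) (Fin 2) ℤ}
    (e : (γ : Matrix Ix Ix ℝ) = patMat N a b c d)
    (hcop : IsCoprime (a 0 0 * a 1 1 - N * (a 0 1 * a 1 0)) m) : IsTwistable N m u v γ := by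
  have hNR : (N : ℝ) ≠ 0 := by exact_mod_cast hN.ne'
  obtain ⟨x, y, hxy⟩ := hcop
  have hs : IsSim ((1 : ℤ) : ℝ) (patMat N a b c d) := by
    rw [← e]; simpa using isSim_of_mem hγ
  have s1 := ((isSim_patMat_iff hN 1 a b c d).1 hs).1
  have s2 := upper_symm_of_isSim hN one_ne_zero hs
  -- the integral approximations of `a⁻¹ b` and `c a⁻¹`
  set sB : Fin 3 → ℤ := ![x * (a 1 1 * b 0 0 - N * (a 0 1 * b 1 0)),
    x * (a 1 1 * b 0 1 - a 0 1 * b 1 1), x * (a 0 0 * b 1 1 - N * (a 1 0 * b 0 1))] with hsB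
  set sC : Fin 3 → ℤ := ![x * (c 0 0 * a 1 1 - N * (c 0 1 * a 1 0)),
    x * (a 0 0 * c 0 1 - c 0 0 * a 0 1), x * (a 0 0 * c 1 1 - N * (c 1 0 * a 0 1))] with hsC
  obtain ⟨ρ, hρ, eρ⟩ := exists_mem_eq_upper hN (-sB)
  obtain ⟨l, hl, el⟩ := exists_mem_eq_lower hN (-sC)
  have hμ : IsTwistable N m u v (l * γ * ρ) := by
    refine ⟨l * γ * ρ, mul_mem (mul_mem hl hγ) hρ, ?_⟩
    have hpat := isPat_patMat N a b c d
    have hval : ((l * γ * ρ : GL Ix ℝ) : Matrix Ix Ix ℝ)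
        = patMat N 1 0 (symInt (-sC)) 1 * patMat N a b c d * patMat N 1 (symInt (-sB)) 0 1 := by
      rw [Units.val_mul, Units.val_mul, el, e, eρ]
    rw [hval]
    set M := patMat N 1 0 (symInt (-sC)) 1 * patMat N a b c d * patMat N 1 (symInt (-sB)) 0 1 with hM
    rify at hxy s1 s2
    have hM12 : M.toBlocks₁₂ = (m * y : ℝ) • (patMat N a b c d).toBlocks₁₂ := by
      ext i j
      fin_cases i <;> fin_cases j <;>
      simp [hM, patMat, toBlocks₁₂, Matrix.mul_apply, Fin.sum_univ_two, symInt, hsB]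
      · field_simp
        linear_combination -(b 0 0 : ℝ) * hxy + N * x * (a 0 1 : ℝ) * s2
      · field_simp
        linear_combination -(b 0 1 : ℝ) * hxy
      · linear_combination -(b 1 0 : ℝ) * hxy + x * (a 1 1 : ℝ) * s2
      · field_simp
        linear_combination -(b 1 1 : ℝ) * hxy
    have hM21 : M.toBlocks₂₁ = (m * y : ℝ) • (patMat N a b c d).toBlocks₂₁ := by
      ext i j
      fin_cases i <;> fin_cases j <;>
      simp [hM, patMat, toBlocks₂₁, Matrix.mul_apply, Fin.sum_univ_two, symInt, hsC]
      · linear_combination -(c 0 0 : ℝ) * hxy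
      · linear_combination -N * (c 0 1 : ℝ) * hxy
      · linear_combination -N * (c 1 0 : ℝ) * hxy + N * x * (a 0 0 : ℝ) * s1
      · linear_combination -N * (c 1 1 : ℝ) * hxy + N ^ 2 * x * (a 0 1 : ℝ) * s1
    refine ⟨_, isPat_offDiagonal (a := (patMat N a b c d).toBlocks₁₁)
      (d := (patMat N a b c d).toBlocks₂₂) (by rw [fromBlocks_toBlocks]; exact hpat)
      (y * (1 - u)) (y * (1 - v)), ?_⟩
    conv_lhs => rw [← fromBlocks_toBlocks M]
    refine smul_fromBlocks_eq_sub _ _ _ _ _ _ _ _ _ ?_ ?_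
    · rw [hM12, smul_smul, smul_smul, ← add_smul]
      congr 1
      push_cast; ring
    · rw [hM21, smul_smul, smul_smul, ← add_smul]
      congr 1
      push_cast; ring
  have hdec : γ = l⁻¹ * (l * γ * ρ) * ρ⁻¹ := by group
  rw [hdec]
  exact (((isTwistable_lower hN m u v _ el).inv hl).mul hN huv (inv_mem hl)
    (mul_mem (mul_mem hl hγ) hρ) hμ).mul hN huv
    (mul_mem (inv_mem hl) (mul_mem (mul_mem hl hγ) hρ)) (inv_mem hρ)
    ((isTwistable_upper hN m u v _ eρ).inv hρ)

theorem pairMat_mul_patMat {N : ℕ} (hN : 0 < N) (x y a b c d : Matrix (Fin 2) (Fin 2) ℤ) :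
    ∃ b' c' d', pairMat N x y * patMat N a b c d = patMat N
      !![x 0 0 * a 0 0 + x 0 1 * c 0 0, x 0 0 * a 0 1 + x 0 1 * c 0 1;
        y 0 0 * a 1 0 + y 0 1 * c 1 0, y 0 0 * a 1 1 + y 0 1 * c 1 1] b' c' d' := by
  have hNR : (N : ℝ) ≠ 0 := by exact_mod_cast hN.ne'
  have hpat : IsPat N (pairMat N x y * patMat N a b c d) :=
    (isPat_patMat _ _ _ _ _).mul hN (isPat_patMat _ _ _ _ _)
  obtain ⟨a', b', c', d', h⟩ := hpat.exists_patMat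
  refine ⟨b', c', d', ?_⟩
  rw [h]
  congr 1
  have g00 := congrFun (congrFun h (Sum.inl 0)) (Sum.inl 0)
  have g01 := congrFun (congrFun h (Sum.inl 0)) (Sum.inl 1)
  have g10 := congrFun (congrFun h (Sum.inl 1)) (Sum.inl 0)
  have g11 := congrFun (congrFun h (Sum.inl 1)) (Sum.inl 1)
  simp [pairMat, patMat, Matrix.mul_apply, Fin.sum_univ_two] at g00 g01 g10 g11
  ext i j
  fin_cases i <;> fin_cases j
  · have : (a' 0 0 : ℝ) = x 0 0 * a 0 0 + x 0 1 * c 0 0 := by rw [← g00]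
    simpa using (by exact_mod_cast this : a' 0 0 = x 0 0 * a 0 0 + x 0 1 * c 0 0)
  · have : (a' 0 1 : ℝ) = x 0 0 * a 0 1 + x 0 1 * c 0 1 := by
      refine mul_left_cancel₀ hNR ?_
      rw [← g01]; ring
    simpa using (by exact_mod_cast this : a' 0 1 = x 0 0 * a 0 1 + x 0 1 * c 0 1)
  · have : (a' 1 0 : ℝ) = y 0 0 * a 1 0 + y 0 1 * c 1 0 := by
      rw [← g10]; field_simp
    simpa using (by exact_mod_cast this : a' 1 0 = y 0 0 * a 1 0 + y 0 1 * c 1 0)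
  · have : (a' 1 1 : ℝ) = y 0 0 * a 1 1 + y 0 1 * c 1 1 := by
      rw [← g11]; field_simp
    simpa using (by exact_mod_cast this : a' 1 1 = y 0 0 * a 1 1 + y 0 1 * c 1 1)

/-- Every element of `K(N)` is twistable modulo a prime power: multiplication by quarter turns makes
its upper left block invertible modulo `p`. -/
theorem isTwistable_of_mem {N p μ : ℕ} (hN : 0 < N) (hp : p.Prime) {u v q : ℤ}
    (huv : u * v = 1 + ((p ^ μ : ℕ) : ℤ) * (((p ^ μ : ℕ) : ℤ) * q))
    {γ : GL Ix ℝ} (hγ : γ ∈ paramodularGroup N) :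
    IsTwistable N ((p ^ μ : ℕ) : ℤ) u v γ := by
  obtain ⟨a, b, c, d, e⟩ := (isPat_of_mem hN hγ).exists_patMat
  have hs : IsSim 1 (patMat N a b c d) := e ▸ isSim_of_mem hγ
  obtain ⟨s, s', hss⟩ : ∃ s s' : Bool, ¬ (p : ℤ) ∣
      (turn s 0 0 * a 0 0 + turn s 0 1 * c 0 0) * (turn s' 0 0 * a 1 1 + turn s' 0 1 * c 1 1)
      - N * ((turn s 0 0 * a 0 1 + turn s 0 1 * c 0 1) *
        (turn s' 0 0 * a 1 0 + turn s' 0 1 * c 1 0)) := by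
    by_contra! hall
    refine exists_minor_not_dvd hN hp hs ⟨?_, ?_, ?_, ?_⟩
    · simpa [turn] using hall false false
    · simpa [turn] using hall true false
    · simpa [turn] using hall false true
    · simpa [turn] using hall true true
  obtain ⟨w, hw, ew⟩ := exists_mem_eq_pairMat hN (turn_det s) (turn_det s')
  obtain ⟨b', c', d', e'⟩ := pairMat_mul_patMat hN (turn s) (turn s') a b c d
  have hcop : ∀ z : ℤ, ¬ (p : ℤ) ∣ z → IsCoprime z ((p ^ μ : ℕ) : ℤ) := by
    intro z hz
    push_cast
    exact (((Nat.prime_iff_prime_int.1 hp).coprime_iff_not_dvd.2 hz).symm).pow_right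
  have h1 : IsTwistable N ((p ^ μ : ℕ) : ℤ) u v (w * γ) :=
    isTwistable_of_isCoprime hN huv (mul_mem hw hγ) (by rw [Units.val_mul, ew, e, e'])
      (hcop _ (by simpa using hss))
  have h2 : γ = w⁻¹ * (w * γ) := by group
  rw [h2]
  exact ((isTwistable_pairMat_turn hN huv s s' ew).inv hw).mul hN huv (inv_mem hw)
    (mul_mem hw hγ) h1

/-- Membership of a matrix in `K(N) diag(d) K(N)`. -/
def InCoset (N : ℕ) (d : Ix → ℝ) (t : Matrix Ix Ix ℝ) : Prop :=
  ∃ γ ∈ paramodularGroup N, ∃ γ' ∈ paramodularGroup N,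
    t = (γ : Matrix Ix Ix ℝ) * diagonal d * (γ' : Matrix Ix Ix ℝ)

/-- The diagonals of the Hecke operators: integral, and a similitude with multiplier `m`. -/
structure IsHeckeDiag (m : ℤ) (d : Ix → ℝ) : Prop where
  int : ∀ i, ∃ z : ℤ, d i = z
  sim : ∀ i : Fin 2, d (Sum.inl i) * d (Sum.inr i) = m

theorem IsHeckeDiag.isPat {N : ℕ} {m : ℤ} {d : Ix → ℝ} (hd : IsHeckeDiag m d) :
    IsPat N (diagonal d) := by
  intro i j
  by_cases h : i = j
  · subst h
    obtain ⟨z, hz⟩ := hd.int i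
    refine ⟨z, ?_⟩
    rcases i with i | i <;> fin_cases i <;> simpa [scale] using hz
  · exact ⟨0, by simp [h]⟩

theorem IsHeckeDiag.isSim {m : ℤ} {d : Ix → ℝ} (hd : IsHeckeDiag m d) :
    IsSim m (diagonal d) := by
  have h0 := hd.sim 0
  have h1 := hd.sim 1
  unfold IsSim
  ext i j
  rw [diagonal_transpose, mul_diagonal, diagonal_mul]
  rcases i with i | i <;> rcases j with j | j <;> fin_cases i <;> fin_cases j <;>
    simp [J] <;> linarith

theorem InCoset.isPat {N : ℕ} (hN : 0 < N) {m : ℤ} {d : Ix → ℝ} (hd : IsHeckeDiag m d)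
    {t : Matrix Ix Ix ℝ} (ht : InCoset N d t) : IsPat N t := by
  obtain ⟨γ, hγ, γ', hγ', rfl⟩ := ht
  exact ((isPat_of_mem hN hγ).mul hN hd.isPat).mul hN (isPat_of_mem hN hγ')

theorem InCoset.isSim {N : ℕ} {m : ℤ} {d : Ix → ℝ} (hd : IsHeckeDiag m d)
    {t : Matrix Ix Ix ℝ} (ht : InCoset N d t) : IsSim m t := by
  obtain ⟨γ, hγ, γ', hγ', rfl⟩ := ht
  simpa using ((isSim_of_mem hγ).mul hd.isSim).mul (isSim_of_mem hγ')

theorem InCoset.mul_left {N : ℕ} {d : Ix → ℝ} {t : Matrix Ix Ix ℝ} (ht : InCoset N d t)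
    {κ : GL Ix ℝ} (hκ : κ ∈ paramodularGroup N) : InCoset N d ((κ : Matrix Ix Ix ℝ) * t) := by
  obtain ⟨γ, hγ, γ', hγ', rfl⟩ := ht
  exact ⟨κ * γ, mul_mem hκ hγ, γ', hγ', by simp [Matrix.mul_assoc]⟩

theorem InCoset.mul_right {N : ℕ} {d : Ix → ℝ} {t : Matrix Ix Ix ℝ} (ht : InCoset N d t)
    {κ : GL Ix ℝ} (hκ : κ ∈ paramodularGroup N) : InCoset N d (t * (κ : Matrix Ix Ix ℝ)) := by
  obtain ⟨γ, hγ, γ', hγ', rfl⟩ := ht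
  exact ⟨γ, hγ, γ' * κ, mul_mem hγ' hκ, by simp [Matrix.mul_assoc]⟩

/-- Two congruent similitudes modulo their common multiplier `m` lie in the same left coset of
`K(N)`. -/
theorem exists_mem_mul_eq_of_isCong {N : ℕ} (hN : 0 < N) {m : ℤ} (hm : m ≠ 0)
    {t τ : Matrix Ix Ix ℝ} (ht : IsSim m t) (hτ : IsSim m τ) (hτp : IsPat N τ)
    (H : IsCong N m t τ) : ∃ κ ∈ paramodularGroup N, (κ : Matrix Ix Ix ℝ) * τ = t := by
  have hmR : (m : ℝ) ≠ 0 := by exact_mod_cast hm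
  obtain ⟨r, hr, e⟩ := H
  have h1 : (m : ℝ)⁻¹ • (t * adj τ) = 1 + r * adj τ := by
    rw [e, Matrix.add_mul, mul_adj_self hmR hτ, Matrix.smul_mul, ← smul_add, smul_smul,
      inv_mul_cancel₀ hmR, one_smul]
  obtain ⟨κ, hκ, eκ⟩ := exists_mem_paramodularGroup hN (g := (m : ℝ)⁻¹ • (t * adj τ))
    (by rw [h1]; exact (isPat_one N).add (hr.mul hN hτp.adj)) (by
      have h2 := ht.mul (isSim_adj hmR hτ)
      unfold IsSim at h2 ⊢
      rw [transpose_smul, Matrix.smul_mul, Matrix.smul_mul, Matrix.mul_smul, h2, smul_smul,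
        smul_smul]
      congr 1
      field_simp)
  refine ⟨κ, hκ, ?_⟩
  rw [eκ, Matrix.smul_mul, Matrix.mul_assoc, adj_mul_self hτ, Matrix.mul_smul, smul_smul,
    inv_mul_cancel₀ hmR, one_smul, Matrix.mul_one]

/-- The upper triangular elements of the double coset are stable under multiplication of the upper
right block by an integer `u` prime to `p`. -/
theorem InCoset.smul_upper {N p μ : ℕ} (hN : 0 < N) (hp : p.Prime) {d : Ix → ℝ}
    (hd : IsHeckeDiag ((p ^ μ : ℕ) : ℤ) d) {u : ℕ} (hu : ¬ p ∣ u) {A B D : Matrix (Fin 2) (Fin 2) ℤ}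
    (ht : InCoset N d (patMat N A B 0 D)) : InCoset N d (patMat N A ((u : ℤ) • B) 0 D) := by
  set m : ℤ := ((p ^ μ : ℕ) : ℤ) with hm
  have hm0 : m ≠ 0 := by rw [hm]; exact_mod_cast pow_ne_zero _ hp.ne_zero
  obtain ⟨v, q, huv⟩ : ∃ v q : ℤ, (u : ℤ) * v = 1 + m * (m * q) := by
    have h1 : IsCoprime (u : ℤ) (m * m) := by
      have h2 : IsCoprime (u : ℤ) m := by
        rw [hm]; push_cast
        exact (((Nat.prime_iff_prime_int.1 hp).coprime_iff_not_dvd.2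
          (fun h => hu (Int.natCast_dvd_natCast.1 h))).symm).pow_right
      exact h2.mul_right h2
    obtain ⟨x, y, hxy⟩ := h1
    exact ⟨x, -y, by linear_combination hxy⟩
  have hs := ht.isSim hd
  have htw : twist u v (patMat N A B 0 D) = patMat N A ((u : ℤ) • B) 0 D := by
    rw [twist, patMat, patMat]
    simp only [toBlocks_fromBlocks₁₁, toBlocks_fromBlocks₁₂, toBlocks_fromBlocks₂₁,
      toBlocks_fromBlocks₂₂]
    congr 1 <;> ext i j <;> fin_cases i <;> fin_cases j <;> simp [mul_div_assoc]
  have hs' : IsSim m (patMat N A ((u : ℤ) • B) 0 D) := by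
    obtain ⟨-, s2, s3, s4, s5, s6⟩ := (isSim_patMat_iff hN m A B 0 D).1 hs
    refine (isSim_patMat_iff hN m A ((u : ℤ) • B) 0 D).2 ⟨by simp, ?_, ?_, ?_, ?_, ?_⟩
    · simp only [Matrix.smul_apply, smul_eq_mul]
      linear_combination u * s2
    · simpa using s3
    · simpa using s4
    · simpa using s5
    · simpa using s6
  obtain ⟨γ, hγ, γ', hγ', e⟩ := ht
  obtain ⟨γ₁, hγ₁, c₁⟩ := isTwistable_of_mem hN hp (u := u) (v := v) huv hγ
  obtain ⟨γ₁', hγ₁', c₁'⟩ := isTwistable_of_mem hN hp (u := u) (v := v) huv hγ'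
  have hdiag : twist u v (diagonal d) = diagonal d := by
    conv_rhs => rw [← fromBlocks_toBlocks (diagonal d)]
    rw [twist]
    congr 1 <;> ext i j <;> simp [toBlocks₁₂, toBlocks₂₁]
  have hγp := isPat_of_mem hN hγ
  have hγp' := isPat_of_mem hN hγ'
  -- compare the twist of `t` with the product of the twists of its factors
  have hcong : IsCong N m (patMat N A ((u : ℤ) • B) 0 D)
      ((γ₁ : Matrix Ix Ix ℝ) * diagonal d * (γ₁' : Matrix Ix Ix ℝ)) := by
    rw [← htw, e]
    refine IsCong.symm ?_
    have k1 := isCong_twist_mul hN huv hγp (hd.isPat (N := N))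
    rw [hdiag] at k1
    have k2 := (c₁.mul hN (IsCong.refl N m (diagonal d)) (isPat_of_mem hN hγ₁) hd.isPat).trans k1
    exact (k2.mul hN c₁' ((isPat_of_mem hN hγ₁).mul hN hd.isPat) (hγp'.twist u v)).trans
      (isCong_twist_mul hN huv (hγp.mul hN hd.isPat) hγp')
  have hτ : InCoset N d ((γ₁ : Matrix Ix Ix ℝ) * diagonal d * (γ₁' : Matrix Ix Ix ℝ)) :=
    ⟨γ₁, hγ₁, γ₁', hγ₁', rfl⟩
  obtain ⟨κ, hκ, eκ⟩ := exists_mem_mul_eq_of_isCong hN hm0 hs' (hτ.isSim hd) (hτ.isPat hN hd) hcong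
  rw [← eκ]
  exact hτ.mul_left hκ

theorem quotient_eq_of_mul_out_eq {N : ℕ}
    {c c' : Quotient (QuotientGroup.rightRel (paramodularGroup N))} {κ : GL Ix ℝ}
    (hκ : κ ∈ paramodularGroup N)
    (h : (κ : Matrix Ix Ix ℝ) * (c'.out : Matrix Ix Ix ℝ) = (c.out : Matrix Ix Ix ℝ)) : c = c' := by
  have h1 : κ * c'.out = c.out := Units.ext (by rw [Units.val_mul, h])
  rw [← Quotient.out_eq c, ← Quotient.out_eq c']
  refine (Quotient.sound ?_).symm
  refine QuotientGroup.rightRel_apply.2 ?_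
  rw [← h1, mul_inv_cancel_right]
  exact hκ

/-- There are finitely many left cosets of `K(N)` in `K(N) diag(d) K(N)`, because the coset of
`diag(d) γ` only depends on `γ` modulo `m`. -/
theorem finite_cosets {N : ℕ} (hN : 0 < N) {m : ℕ} [NeZero m] {d : Ix → ℝ}
    (hd : IsHeckeDiag (m : ℤ) d) :
    {c : Quotient (QuotientGroup.rightRel (paramodularGroup N)) |
      InCoset N d (c.out : Matrix Ix Ix ℝ)}.Finite := by
  have hm : (m : ℤ) ≠ 0 := by exact_mod_cast NeZero.ne m
  set C := {c : Quotient (QuotientGroup.rightRel (paramodularGroup N)) |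
      InCoset N d (c.out : Matrix Ix Ix ℝ)} with hC
  have hrep : ∀ c : C, ∃ γ ∈ paramodularGroup N, ∃ γ' ∈ paramodularGroup N,
      ∃ z : Ix → Ix → ℤ, (c.1.out : Matrix Ix Ix ℝ)
        = (γ : Matrix Ix Ix ℝ) * diagonal d * (γ' : Matrix Ix Ix ℝ) ∧
        ∀ i j, (γ' : Matrix Ix Ix ℝ) i j = z i j * scale N i j := by
    rintro ⟨c, γ, hγ, γ', hγ', e⟩
    choose z hz using isPat_of_mem hN hγ'
    exact ⟨γ, hγ, γ', hγ', z, e, hz⟩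
  choose γ hγ γ' hγ' z he hz using hrep
  let F : C → Ix → Ix → ZMod m := fun c i j => z c i j
  have hF : Function.Injective F := by
    intro c c' hcc
    have hw : ∀ i j, ∃ w : ℤ, z c i j = z c' i j + m * w := fun i j => by
      have h1 : ((z c i j : ℤ) : ZMod m) = z c' i j := congrFun (congrFun hcc i) j
      obtain ⟨w, hw⟩ := (ZMod.intCast_eq_intCast_iff_dvd_sub _ _ _).1 h1.symm
      exact ⟨w, by linarith⟩
    choose w hw using hw
    have hcong : IsCong N m (γ' c : Matrix Ix Ix ℝ) (γ' c' : Matrix Ix Ix ℝ) := by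
      refine ⟨Matrix.of fun i j => w i j * scale N i j, fun i j => ⟨w i j, rfl⟩, ?_⟩
      ext i j
      rw [Matrix.add_apply, Matrix.smul_apply, hz, hz, hw, smul_eq_mul, Matrix.of_apply]
      push_cast
      ring
    have hdp : IsPat N (diagonal d) := hd.isPat
    have hc2 := (IsCong.refl N m (diagonal d)).mul hN hcong hdp (isPat_of_mem hN (hγ' c'))
    have hst : ∀ c, IsSim m (diagonal d * (γ' c : Matrix Ix Ix ℝ)) := fun c => by
      simpa using hd.isSim.mul (isSim_of_mem (hγ' c))
    obtain ⟨κ, hκ, eκ⟩ := exists_mem_mul_eq_of_isCong hN hm (hst c) (hst c')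
      (hdp.mul hN (isPat_of_mem hN (hγ' c'))) hc2
    refine Subtype.ext (quotient_eq_of_mul_out_eq (κ := γ c * κ * (γ c')⁻¹)
      (mul_mem (mul_mem (hγ c) hκ) (inv_mem (hγ c'))) ?_)
    rw [he c, he c', Matrix.mul_assoc (γ c : Matrix Ix Ix ℝ), ← eκ]
    simp only [Units.val_mul, Matrix.mul_assoc]
    congr 2
    rw [← Matrix.mul_assoc, ← Matrix.mul_assoc, ← Units.val_mul, inv_mul_cancel, Units.val_one,
      Matrix.one_mul]
  have : Finite C := Finite.of_injective F hF
  exact Set.toFinite C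

/-! ### Upper triangular similitudes -/

/-- The real symmetric matrix with coordinates `x`: its entries are `x₀, x₁, x₁, x₂ / N`. -/
def symMat (N : ℕ) (x : Fin 3 → ℝ) : Matrix (Fin 2) (Fin 2) ℝ := !![x 0, x 1; x 1, x 2 / N]

/-- The point of the Siegel upper half space with coordinates `ζ`, scaled like `symMat`. -/
def pt (N : ℕ) (ζ : Fin 3 → ℂ) : Matrix (Fin 2) (Fin 2) ℂ := !![ζ 0, ζ 1; ζ 1, ζ 2 / N]

/-- The upper left block with integral coordinates `α`. -/
def levBlock (N : ℕ) (α : Matrix (Fin 2) (Fin 2) ℤ) : Matrix (Fin 2) (Fin 2) ℝ :=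
  !![(α 0 0 : ℝ), N * (α 0 1 : ℝ); (α 1 0 : ℝ), (α 1 1 : ℝ)]

/-- The determinant of `levBlock N α`. -/
def levDet (N : ℕ) (α : Matrix (Fin 2) (Fin 2) ℤ) : ℤ := α 0 0 * α 1 1 - N * (α 0 1 * α 1 0)

theorem det_levBlock (N : ℕ) (α : Matrix (Fin 2) (Fin 2) ℤ) :
    (levBlock N α).det = levDet N α := by
  rw [det_fin_two]; simp [levBlock, levDet]; ring

/-- The matrix of `S ↦ A S Aᵀ` in the coordinates of `symMat`, for `A = levBlock N α`. -/
def phi (N : ℕ) (α : Matrix (Fin 2) (Fin 2) ℤ) : Matrix (Fin 3) (Fin 3) ℤ :=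
  !![α 0 0 ^ 2, 2 * N * α 0 0 * α 0 1, N * α 0 1 ^ 2;
    α 0 0 * α 1 0, α 0 0 * α 1 1 + N * α 0 1 * α 1 0, α 0 1 * α 1 1;
    N * α 1 0 ^ 2, 2 * N * α 1 0 * α 1 1, α 1 1 ^ 2]

theorem det_phi (N : ℕ) (α : Matrix (Fin 2) (Fin 2) ℤ) : (phi N α).det = levDet N α ^ 3 := by
  rw [det_fin_three]; simp [phi, levDet]; ring

theorem levBlock_mul_symMat {N : ℕ} (hN : 0 < N) (α : Matrix (Fin 2) (Fin 2) ℤ) (y : Fin 3 → ℝ) :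
    levBlock N α * symMat N y * (levBlock N α)ᵀ
      = symMat N (fun i => ∑ j, (phi N α i j : ℝ) * y j) := by
  have h : (N : ℝ) ≠ 0 := by exact_mod_cast hN.ne'
  ext i j
  fin_cases i <;> fin_cases j <;>
  · simp [levBlock, symMat, phi, Matrix.mul_apply, Fin.sum_univ_two, Fin.sum_univ_three]
    field_simp
    ring

theorem levBlock_mul_pt {N : ℕ} (hN : 0 < N) (α : Matrix (Fin 2) (Fin 2) ℤ) (ζ : Fin 3 → ℂ) :
    (levBlock N α).map Complex.ofReal * pt N ζ * ((levBlock N α).map Complex.ofReal)ᵀ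
      = pt N (fun i => ∑ j, (phi N α i j : ℂ) * ζ j) := by
  have h : (N : ℂ) ≠ 0 := by exact_mod_cast hN.ne'
  ext i j
  fin_cases i <;> fin_cases j <;>
  · simp [levBlock, pt, phi, Matrix.mul_apply, Fin.sum_univ_two, Fin.sum_univ_three]
    field_simp
    ring

/-- The upper triangular similitude with multiplier `m` acting on the Siegel upper half space by
`Ω ↦ m⁻¹ (A Ω Aᵀ + X)`, where `A = levBlock N α` and `X` is the symmetric matrix with integral
coordinates `x`. -/
def triMat (N m : ℕ) (α : Matrix (Fin 2) (Fin 2) ℤ) (x : Fin 3 → ℤ) : Matrix Ix Ix ℝ :=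
  fromBlocks (levBlock N α)
    (((m : ℝ)⁻¹ • symMat N (fun i => (x i : ℝ))) * ((m : ℝ) • ((levBlock N α)⁻¹)ᵀ)) 0
    ((m : ℝ) • ((levBlock N α)⁻¹)ᵀ)

theorem isUnit_det_levBlock {N : ℕ} {α : Matrix (Fin 2) (Fin 2) ℤ} (hα : levDet N α ≠ 0) :
    IsUnit (levBlock N α).det := by
  rw [det_levBlock]; exact isUnit_iff_ne_zero.2 (by exact_mod_cast hα)

theorem patMat_symInt (N : ℕ) (s : Fin 3 → ℤ) :
    patMat N 1 (symInt s) 0 1 = fromBlocks 1 (symMat N (fun i => (s i : ℝ))) 0 1 := by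
  have h1 : (symMat N fun i => (s i : ℝ)) = !![((symInt s) 0 0 : ℝ), ((symInt s) 0 1 : ℝ);
      ((symInt s) 1 0 : ℝ), ((symInt s) 1 1 : ℝ) / N] := rfl
  rw [patMat, h1]
  congr 1 <;> ext i j <;> fin_cases i <;> fin_cases j <;> simp

theorem upper_mul_triMat {N m : ℕ} (hm : m ≠ 0) (α : Matrix (Fin 2) (Fin 2) ℤ) (x s : Fin 3 → ℤ) :
    patMat N 1 (symInt s) 0 1 * triMat N m α x = triMat N m α (x + m • s) := by
  have hm' : (m : ℝ) ≠ 0 := by exact_mod_cast hm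
  rw [patMat_symInt, triMat, triMat, fromBlocks_multiply]
  have h2 : (m : ℝ)⁻¹ • symMat N (fun i => ((x + m • s) i : ℝ))
      = (m : ℝ)⁻¹ • symMat N (fun i => (x i : ℝ)) + symMat N (fun i => (s i : ℝ)) := by
    ext i j
    fin_cases i <;> fin_cases j <;> simp [symMat] <;> field_simp
  rw [h2, Matrix.add_mul]
  simp

theorem triMat_mul_upper {N m : ℕ} (hN : 0 < N) (hm : m ≠ 0) {α : Matrix (Fin 2) (Fin 2) ℤ}
    (hα : levDet N α ≠ 0) (x s : Fin 3 → ℤ) :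
    triMat N m α x * patMat N 1 (symInt s) 0 1 = triMat N m α (x + phi N α *ᵥ s) := by
  have hm' : (m : ℝ) ≠ 0 := by exact_mod_cast hm
  rw [patMat_symInt, triMat, triMat, fromBlocks_multiply]
  have h2 : (m : ℝ)⁻¹ • symMat N (fun i => ((x + phi N α *ᵥ s) i : ℝ))
      = (m : ℝ)⁻¹ • symMat N (fun i => (x i : ℝ))
        + (m : ℝ)⁻¹ • (levBlock N α * symMat N (fun i => (s i : ℝ)) * (levBlock N α)ᵀ) := by
    rw [levBlock_mul_symMat hN]
    ext i j
    fin_cases i <;> fin_cases j <;> simp [symMat, mulVec, dotProduct] <;> ring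
  have h3 : (levBlock N α)ᵀ * ((levBlock N α)⁻¹)ᵀ = 1 := by
    rw [← transpose_mul, nonsing_inv_mul _ (isUnit_det_levBlock hα), transpose_one]
  rw [h2, Matrix.add_mul (((m : ℝ)⁻¹ • symMat N (fun i => (x i : ℝ))))]
  congr 1
  · simp
  · rw [add_comm]
    congr 1
    · simp
    · rw [Matrix.smul_mul, Matrix.mul_smul, smul_smul, inv_mul_cancel₀ hm', one_smul,
        Matrix.mul_assoc, h3, Matrix.mul_one]
  · simp
  · simp

/-- A similitude of the paramodular order whose lower left block vanishes has the form `triMat`. -/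
theorem exists_eq_triMat {N m : ℕ} (hN : 0 < N) (hm : m ≠ 0) {α b d : Matrix (Fin 2) (Fin 2) ℤ}
    (hs : IsSim ((m : ℤ) : ℝ) (patMat N α b 0 d)) :
    levDet N α ≠ 0 ∧ ∃ x, ∀ u : ℤ, patMat N α (u • b) 0 d = triMat N m α (u • x) := by
  have hm' : (m : ℝ) ≠ 0 := by exact_mod_cast hm
  have hNR : (N : ℝ) ≠ 0 := by exact_mod_cast hN.ne'
  obtain ⟨-, -, e3, e4, e5, e6⟩ := (isSim_patMat_iff hN _ _ _ _ _).1 hs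
  have hsym := upper_symm_of_isSim hN (by exact_mod_cast hm) hs
  simp only [Matrix.zero_apply, mul_zero, sub_zero] at e3 e4 e5 e6
  set D : Matrix (Fin 2) (Fin 2) ℝ := !![(d 0 0 : ℝ), (d 0 1 : ℝ); N * (d 1 0 : ℝ), (d 1 1 : ℝ)]
    with hD
  rify at e3 e4 e5 e6 hsym
  have hDA : Dᵀ * levBlock N α = (m : ℝ) • 1 := by
    ext i j
    fin_cases i <;> fin_cases j <;> simp [hD, levBlock, Matrix.mul_apply, Fin.sum_univ_two]
    · linear_combination e3
    · linear_combination N * e4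
    · linear_combination e5
    · linear_combination e6
  have hdet : levDet N α ≠ 0 := by
    intro h0
    have h1 := congrArg Matrix.det hDA
    rw [det_mul, det_levBlock, h0, det_smul] at h1
    simp only [Int.cast_zero, mul_zero, det_one, mul_one, Fintype.card_fin] at h1
    exact pow_ne_zero 2 hm' h1.symm
  have hD' : D = (m : ℝ) • ((levBlock N α)⁻¹)ᵀ := by
    have h1 : Dᵀ = (m : ℝ) • (levBlock N α)⁻¹ := by
      rw [← Matrix.mul_one Dᵀ, ← mul_nonsing_inv _ (isUnit_det_levBlock hdet), ← Matrix.mul_assoc,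
        hDA, Matrix.smul_mul, Matrix.one_mul]
    rw [← transpose_transpose D, h1, transpose_smul]
  have hAD : (levBlock N α)ᵀ * D = (m : ℝ) • 1 := by
    have h1 := congrArg Matrix.transpose hDA
    rwa [transpose_mul, transpose_transpose, transpose_smul, transpose_one] at h1
  refine ⟨hdet, ![b 0 0 * α 0 0 + N * (b 0 1 * α 0 1), b 0 0 * α 1 0 + b 0 1 * α 1 1,
    N * (b 1 0 * α 1 0) + b 1 1 * α 1 1], fun u => ?_⟩
  rw [triMat, ← hD', patMat]
  congr 1
  · -- the upper right block `B` is `X D` with `m X = B Aᵀ`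
    have hX : symMat N (fun i => ((u • ![b 0 0 * α 0 0 + N * (b 0 1 * α 0 1),
        b 0 0 * α 1 0 + b 0 1 * α 1 1, N * (b 1 0 * α 1 0) + b 1 1 * α 1 1] : Fin 3 → ℤ) i : ℝ))
        = !![((u • b) 0 0 : ℝ), ((u • b) 0 1 : ℝ); ((u • b) 1 0 : ℝ), ((u • b) 1 1 : ℝ) / N]
          * (levBlock N α)ᵀ := by
      ext i j
      fin_cases i <;> fin_cases j <;>
        simp [symMat, levBlock, Matrix.mul_apply, Fin.sum_univ_two, -zsmul_eq_mul]
      · ring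
      · ring
      · field_simp
        linear_combination -u * hsym
      · field_simp
    rw [hX, Matrix.smul_mul, Matrix.mul_assoc, hAD, Matrix.mul_smul, Matrix.mul_one, smul_smul,
      inv_mul_cancel₀ hm', one_smul]
  · ext i j; fin_cases i <;> fin_cases j <;> simp

theorem levBlock_injective {N : ℕ} (hN : 0 < N) {α β : Matrix (Fin 2) (Fin 2) ℤ}
    (h : levBlock N α = levBlock N β) : α = β := by
  have hNR : (N : ℝ) ≠ 0 := by exact_mod_cast hN.ne'
  have h00 := congrFun (congrFun h 0) 0
  have h01 := congrFun (congrFun h 0) 1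
  have h10 := congrFun (congrFun h 1) 0
  have h11 := congrFun (congrFun h 1) 1
  simp [levBlock, hN.ne'] at h00 h01 h10 h11
  ext i j
  fin_cases i <;> fin_cases j <;> simpa

/-- A similitude of the paramodular order with upper left block `levBlock N α` and lower left
block zero. -/
theorem exists_eq_triMat_of_blocks {N m : ℕ} (hN : 0 < N) (hm : m ≠ 0)
    {t : Matrix Ix Ix ℝ} (ht : IsPat N t) (hs : IsSim ((m : ℤ) : ℝ) t)
    {α : Matrix (Fin 2) (Fin 2) ℤ} (h₁₁ : t.toBlocks₁₁ = levBlock N α) (h₂₁ : t.toBlocks₂₁ = 0) :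
    ∃ b d x, t = patMat N α b 0 d ∧ ∀ u : ℤ, patMat N α (u • b) 0 d = triMat N m α (u • x) := by
  obtain ⟨a, b, c, d, rfl⟩ := ht.exists_patMat
  have ha : a = α := levBlock_injective hN h₁₁
  have hc : c = 0 := by
    have h2 : !![(c 0 0 : ℝ), N * (c 0 1 : ℝ); N * (c 1 0 : ℝ), N * (c 1 1 : ℝ)] = 0 := by
      simpa [patMat] using h₂₁
    have h00 := congrFun (congrFun h2 0) 0
    have h01 := congrFun (congrFun h2 0) 1
    have h10 := congrFun (congrFun h2 1) 0
    have h11 := congrFun (congrFun h2 1) 1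
    simp [hN.ne'] at h00 h01 h10 h11
    ext i j
    fin_cases i <;> fin_cases j <;> simpa
  subst ha hc
  obtain ⟨-, x, hx⟩ := exists_eq_triMat hN hm hs
  exact ⟨b, d, x, rfl, hx⟩

theorem toBlocks₁₁_triMat (N m : ℕ) (α : Matrix (Fin 2) (Fin 2) ℤ) (x : Fin 3 → ℤ) :
    (triMat N m α x).toBlocks₁₁ = levBlock N α := by simp [triMat]

theorem toBlocks₂₁_triMat (N m : ℕ) (α : Matrix (Fin 2) (Fin 2) ℤ) (x : Fin 3 → ℤ) :
    (triMat N m α x).toBlocks₂₁ = 0 := by simp [triMat]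

theorem multiplier_of_isSim {m : ℝ} {g : Matrix Ix Ix ℝ} (h : IsSim m g) : multiplier g = m := by
  rw [multiplier, h]; simp [J]

theorem denom_triMat (N m : ℕ) (α : Matrix (Fin 2) (Fin 2) ℤ) (x : Fin 3 → ℤ)
    (Ω : Matrix (Fin 2) (Fin 2) ℂ) : denom (triMat N m α x) Ω
      = ((m : ℝ) • ((levBlock N α)⁻¹)ᵀ).map Complex.ofReal := by
  rw [denom, triMat, toBlocks_fromBlocks₂₁, toBlocks_fromBlocks₂₂, Matrix.map_zero _ (by simp),
    Matrix.zero_mul, zero_add]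

theorem map_ofReal_mul (P Q : Matrix (Fin 2) (Fin 2) ℝ) :
    (P * Q).map Complex.ofReal = P.map Complex.ofReal * Q.map Complex.ofReal :=
  Matrix.map_mul (f := Complex.ofRealHom)

theorem det_map_ofReal (P : Matrix (Fin 2) (Fin 2) ℝ) :
    (P.map Complex.ofReal).det = (P.det : ℂ) := by
  rw [det_fin_two, det_fin_two]; simp

theorem denom_triMat_mul {N m : ℕ} {α : Matrix (Fin 2) (Fin 2) ℤ} (hα : levDet N α ≠ 0) :
    ((m : ℝ) • ((levBlock N α)⁻¹)ᵀ).map Complex.ofReal * ((levBlock N α).map Complex.ofReal)ᵀ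
      = (m : ℂ) • 1 := by
  rw [← transpose_map, ← map_ofReal_mul, Matrix.smul_mul, ← transpose_mul,
    mul_nonsing_inv _ (isUnit_det_levBlock hα), transpose_one]
  ext i j
  by_cases h : i = j <;> simp [h]

theorem det_denom_triMat {N m : ℕ} {α : Matrix (Fin 2) (Fin 2) ℤ} (hα : levDet N α ≠ 0)
    (x : Fin 3 → ℤ) (Ω : Matrix (Fin 2) (Fin 2) ℂ) :
    (denom (triMat N m α x) Ω).det = (m : ℂ) ^ 2 / levDet N α := by
  have hδ : (levDet N α : ℂ) ≠ 0 := by exact_mod_cast hα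
  have h1 := congrArg Matrix.det (denom_triMat_mul (m := m) hα)
  rw [det_mul, det_transpose, det_map_ofReal (levBlock N α), det_levBlock, det_smul, det_one] at h1
  rw [denom_triMat, eq_div_iff hδ]
  simpa using h1

theorem moebius_triMat {N m : ℕ} (hN : 0 < N) (hm : m ≠ 0) {α : Matrix (Fin 2) (Fin 2) ℤ}
    (hα : levDet N α ≠ 0) (x : Fin 3 → ℤ) (ζ : Fin 3 → ℂ) :
    moebius (triMat N m α x) (pt N ζ)
      = pt N fun i => ((∑ j, (phi N α i j : ℂ) * ζ j) + x i) / m := by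
  have hmC : (m : ℂ) ≠ 0 := by exact_mod_cast hm
  have hδ : (levDet N α : ℂ) ≠ 0 := by exact_mod_cast hα
  have hdet := det_denom_triMat (m := m) hα x (pt N ζ)
  rw [denom_triMat] at hdet
  have hinv : (((m : ℝ) • ((levBlock N α)⁻¹)ᵀ).map Complex.ofReal)⁻¹
      = (m : ℂ)⁻¹ • ((levBlock N α).map Complex.ofReal)ᵀ := by
    refine Matrix.inv_eq_right_inv ?_
    rw [Matrix.mul_smul, denom_triMat_mul hα, smul_smul, inv_mul_cancel₀ hmC, one_smul]
  rw [moebius, denom_triMat, triMat, toBlocks_fromBlocks₁₁, toBlocks_fromBlocks₁₂, map_ofReal_mul,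
    Matrix.add_mul,
    Matrix.mul_assoc (((m : ℝ)⁻¹ • symMat N (fun i => (x i : ℝ))).map Complex.ofReal),
    mul_nonsing_inv _ (by
      rw [hdet]; exact isUnit_iff_ne_zero.2 (div_ne_zero (pow_ne_zero _ hmC) hδ)),
    Matrix.mul_one, hinv, Matrix.mul_smul, levBlock_mul_pt hN]
  ext i j
  fin_cases i <;> fin_cases j <;> simp [pt, symMat] <;> ring

/-- The weight `k` action of an upper triangular matrix. -/
theorem slash_triMat {N m k : ℕ} (hN : 0 < N) (hm : m ≠ 0) {α : Matrix (Fin 2) (Fin 2) ℤ}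
    (hα : levDet N α ≠ 0) (x : Fin 3 → ℤ) (hs : IsSim ((m : ℤ) : ℝ) (triMat N m α x))
    (f : Matrix (Fin 2) (Fin 2) ℂ → ℂ) (ζ : Fin 3 → ℂ) :
    slash k f (triMat N m α x) (pt N ζ) = ((m : ℂ) ^ 3)⁻¹ * (levDet N α : ℂ) ^ k *
      f (pt N fun i => ((∑ j, (phi N α i j : ℂ) * ζ j) + x i) / m) := by
  have hmC : (m : ℂ) ≠ 0 := by exact_mod_cast hm
  have hδ : (levDet N α : ℂ) ≠ 0 := by exact_mod_cast hα
  rw [slash, moebius_triMat hN hm hα, det_denom_triMat hα, multiplier_of_isSim hs]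
  congr 1
  push_cast
  rw [div_zpow, _root_.zpow_neg, _root_.zpow_neg, zpow_natCast, zpow_natCast, zpow_sub₀ hmC,
    show (2 * (k : ℤ)) = ((2 * k : ℕ) : ℤ) by push_cast; ring, zpow_natCast,
    show (3 : ℤ) = ((3 : ℕ) : ℤ) by norm_num, zpow_natCast, ← pow_mul]
  field_simp

theorem map_im_pt (N : ℕ) (ζ : Fin 3 → ℂ) :
    (pt N ζ).map Complex.im = symMat N (fun i => (ζ i).im) := by
  ext i j
  fin_cases i <;> fin_cases j <;> simp [pt, symMat]

theorem pt_isSymm (N : ℕ) (ζ : Fin 3 → ℂ) : (pt N ζ).IsSymm := by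
  ext i j
  fin_cases i <;> fin_cases j <;> simp [pt]

theorem pt_mem_siegelUpperHalfSpace_iff (N : ℕ) (ζ : Fin 3 → ℂ) :
    pt N ζ ∈ siegelUpperHalfSpace ↔ (symMat N (fun i => (ζ i).im)).PosDef := by
  rw [siegelUpperHalfSpace, Set.mem_ofPred_eq, map_im_pt]
  exact and_iff_right (pt_isSymm N ζ)

theorem pt_triMat_mem {N m : ℕ} (hN : 0 < N) (hm : m ≠ 0) {α : Matrix (Fin 2) (Fin 2) ℤ}
    (hα : levDet N α ≠ 0) (x : Fin 3 → ℤ) {ζ : Fin 3 → ℂ} (hζ : pt N ζ ∈ siegelUpperHalfSpace) :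
    (pt N fun i => ((∑ j, (phi N α i j : ℂ) * ζ j) + x i) / m) ∈ siegelUpperHalfSpace := by
  rw [pt_mem_siegelUpperHalfSpace_iff] at hζ ⊢
  have h1 : symMat N (fun i => ((((∑ j, (phi N α i j : ℂ) * ζ j) + x i) / m : ℂ)).im)
      = (m : ℝ)⁻¹ • (levBlock N α * symMat N (fun i => (ζ i).im) * (levBlock N α)ᴴ) := by
    rw [conjTranspose_eq_transpose_of_trivial, levBlock_mul_symMat hN]
    ext i j
    fin_cases i <;> fin_cases j <;>
      simp [symMat, Complex.div_natCast_im, Fin.sum_univ_three] <;> ring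
  rw [h1]
  refine (hζ.mul_mul_conjTranspose_same ?_).smul (by positivity)
  exact Matrix.vecMul_injective_of_isUnit ((Matrix.isUnit_iff_isUnit_det _).2
    (isUnit_det_levBlock hα))

/-! ### Triangular representatives of the cosets -/

/-- The set `K(N) \ GL₄(ℝ)`. -/
abbrev Cosets (N : ℕ) : Type := Quotient (QuotientGroup.rightRel (paramodularGroup N))

/-- The coset `c` contains `triMat N m α x`. -/
def HasTriRep (N m : ℕ) (c : Cosets N) (α : Matrix (Fin 2) (Fin 2) ℤ) (x : Fin 3 → ℤ) : Prop :=
  ∃ κ ∈ paramodularGroup N, (κ : Matrix Ix Ix ℝ) * (c.out : Matrix Ix Ix ℝ) = triMat N m α x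

theorem InCoset.exists_eq_triMat {N m : ℕ} (hN : 0 < N) (hm : m ≠ 0) {d : Ix → ℝ}
    (hd : IsHeckeDiag (m : ℤ) d) {t : Matrix Ix Ix ℝ} (ht : InCoset N d t)
    {α : Matrix (Fin 2) (Fin 2) ℤ} (h₁₁ : t.toBlocks₁₁ = levBlock N α) (h₂₁ : t.toBlocks₂₁ = 0) :
    ∃ b d' x, t = patMat N α b 0 d' ∧ ∀ u : ℤ, patMat N α (u • b) 0 d' = triMat N m α (u • x) :=
  exists_eq_triMat_of_blocks hN hm (ht.isPat hN hd) (by exact_mod_cast ht.isSim hd) h₁₁ h₂₁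

theorem HasTriRep.inCoset {N m : ℕ} {d : Ix → ℝ} {c : Cosets N}
    {α : Matrix (Fin 2) (Fin 2) ℤ} {x : Fin 3 → ℤ} (h : HasTriRep N m c α x)
    (hc : InCoset N d (c.out : Matrix Ix Ix ℝ)) : InCoset N d (triMat N m α x) := by
  obtain ⟨κ, hκ, e⟩ := h
  exact e ▸ hc.mul_left hκ

/-- The possible upper left blocks of triangular representatives form the same set for all cosets
sharing one of them. -/
theorem HasTriRep.transfer {N m : ℕ} (hN : 0 < N) (hm : m ≠ 0) {d : Ix → ℝ}
    (hd : IsHeckeDiag (m : ℤ) d) {c c' : Cosets N}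
    (hc' : InCoset N d (c'.out : Matrix Ix Ix ℝ)) {α β : Matrix (Fin 2) (Fin 2) ℤ}
    {x y x' : Fin 3 → ℤ} (h₁ : HasTriRep N m c α x) (h₂ : HasTriRep N m c β y)
    (h₃ : HasTriRep N m c' α x') : ∃ y', HasTriRep N m c' β y' := by
  obtain ⟨κ, hκ, e⟩ := h₁
  obtain ⟨κ', hκ', e'⟩ := h₂
  obtain ⟨ρ, hρ, e₃⟩ := h₃
  have hmul : ((κ' * κ⁻¹ : GL Ix ℝ) : Matrix Ix Ix ℝ) * triMat N m α x = triMat N m β y := by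
    rw [← e, ← e', ← Matrix.mul_assoc, ← Units.val_mul, inv_mul_cancel_right]
  set ω := κ' * κ⁻¹ with hω
  have hωK : ω ∈ paramodularGroup N := mul_mem hκ' (inv_mem hκ)
  -- the left blocks of `ω * triMat N m α x` do not depend on `x`
  have key : ∀ x, (((ω : GL Ix ℝ) : Matrix Ix Ix ℝ) * triMat N m α x).toBlocks₁₁
        = (ω : Matrix Ix Ix ℝ).toBlocks₁₁ * levBlock N α ∧
      (((ω : GL Ix ℝ) : Matrix Ix Ix ℝ) * triMat N m α x).toBlocks₂₁
        = (ω : Matrix Ix Ix ℝ).toBlocks₂₁ * levBlock N α := by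
    intro x
    constructor <;>
    · conv_lhs => rw [← fromBlocks_toBlocks (ω : Matrix Ix Ix ℝ), triMat, fromBlocks_multiply]
      simp
  have hin : InCoset N d ((ω : Matrix Ix Ix ℝ) * triMat N m α x') := by
    rw [← e₃]; exact (hc'.mul_left hρ).mul_left hωK
  obtain ⟨b, d', y', h1, h2⟩ := hin.exists_eq_triMat hN hm hd (α := β)
    (by rw [(key x').1, ← (key x).1, hmul, toBlocks₁₁_triMat])
    (by rw [(key x').2, ← (key x).2, hmul, toBlocks₂₁_triMat])
  refine ⟨y', ω * ρ, mul_mem hωK hρ, ?_⟩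
  rw [Units.val_mul, Matrix.mul_assoc, e₃, h1]
  simpa using h2 1

/-- The translation vectors of triangular matrices in the same coset with the same upper left block
agree modulo `m`. -/
theorem red_eq_of_mul_triMat_eq {N m : ℕ} (hN : 0 < N) (hm : m ≠ 0)
    {α : Matrix (Fin 2) (Fin 2) ℤ} (hα : levDet N α ≠ 0) {x y : Fin 3 → ℤ} {κ : GL Ix ℝ}
    (hκ : κ ∈ paramodularGroup N) (h : (κ : Matrix Ix Ix ℝ) * triMat N m α x = triMat N m α y) :
    red m x = red m y := by
  have hmR : (m : ℝ) ≠ 0 := by exact_mod_cast hm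
  have hNR : (N : ℝ) ≠ 0 := by exact_mod_cast hN.ne'
  have hu := isUnit_det_levBlock hα
  have cancel : ∀ {A P Q : Matrix (Fin 2) (Fin 2) ℝ}, IsUnit A.det → P * A = Q * A → P = Q := by
    intro A P Q hA h
    rw [← Matrix.mul_one P, ← Matrix.mul_one Q, ← mul_nonsing_inv A hA, ← Matrix.mul_assoc, h,
      Matrix.mul_assoc]
  obtain ⟨a, b, c, d, e⟩ := (isPat_of_mem hN hκ).exists_patMat
  rw [e, patMat, triMat, triMat, fromBlocks_multiply, fromBlocks_inj] at h
  obtain ⟨h11, h12, -, -⟩ := h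
  rw [Matrix.mul_zero, add_zero] at h11
  have h1 := cancel hu (h11.trans (Matrix.one_mul _).symm)
  have hD : IsUnit ((m : ℝ) • ((levBlock N α)⁻¹)ᵀ).det := by
    rw [det_smul, det_transpose, det_nonsing_inv, Ring.inverse_eq_inv']
    exact isUnit_iff_ne_zero.2 (mul_ne_zero (pow_ne_zero _ hmR) (inv_ne_zero hu.ne_zero))
  rw [h1, Matrix.one_mul, ← Matrix.add_mul] at h12
  have h2 := cancel hD h12
  have g0 := congrFun (congrFun h2 0) 0
  have g1 := congrFun (congrFun h2 0) 1
  have g2 := congrFun (congrFun h2 1) 1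
  simp [symMat] at g0 g1 g2
  field_simp at g0 g1 g2
  have k0 : (x 0 : ℝ) + m * b 0 0 = y 0 := by linarith
  have k1 : (x 1 : ℝ) + m * b 0 1 = y 1 := by linarith
  have k2 : (x 2 : ℝ) + m * b 1 1 = y 2 := by linarith
  funext i
  simp only [red, AddMonoidHom.coe_mk, ZeroHom.coe_mk]
  fin_cases i
  · have : x 0 + m * b 0 0 = y 0 := by exact_mod_cast k0
    simp [← this]
  · have : x 1 + m * b 0 1 = y 1 := by exact_mod_cast k1
    simp [← this]
  · have : x 2 + m * b 1 1 = y 2 := by exact_mod_cast k2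
    simp [← this]

theorem exists_mem_mul_triMat_eq {N m : ℕ} (hN : 0 < N) (hm : m ≠ 0)
    (α : Matrix (Fin 2) (Fin 2) ℤ) {x y : Fin 3 → ℤ} (h : red m x = red m y) :
    ∃ κ ∈ paramodularGroup N, (κ : Matrix Ix Ix ℝ) * triMat N m α x = triMat N m α y := by
  have h1 : ∀ i, ∃ w : ℤ, y i = x i + m * w := fun i => by
    obtain ⟨w, hw⟩ := (ZMod.intCast_eq_intCast_iff_dvd_sub _ _ _).1 (congrFun h i)
    exact ⟨w, by linarith⟩
  choose w hw using h1
  obtain ⟨κ, hκ, e⟩ := exists_mem_eq_upper hN w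
  refine ⟨κ, hκ, ?_⟩
  rw [e, upper_mul_triMat hm]
  congr 1
  funext i
  simp [hw]

/-- A choice of triangular representatives for the cosets in `K(N) diag(d) K(N)`, such that cosets
which could share their upper left block do. -/
theorem exists_triRep {N p μ : ℕ} (hN : 0 < N) (hp : p.Prime) (hpN : ¬ p ^ 2 ∣ N) {d : Ix → ℝ}
    (hd : IsHeckeDiag ((p ^ μ : ℕ) : ℤ) d) :
    ∃ (rep : Cosets N → Matrix (Fin 2) (Fin 2) ℤ) (off : Cosets N → Fin 3 → ℤ),
      (∀ c, InCoset N d (c.out : Matrix Ix Ix ℝ) →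
        levDet N (rep c) ≠ 0 ∧ HasTriRep N (p ^ μ) c (rep c) (off c)) ∧
      ∀ c c', InCoset N d (c.out : Matrix Ix Ix ℝ) → InCoset N d (c'.out : Matrix Ix Ix ℝ) →
        ∀ x, HasTriRep N (p ^ μ) c' (rep c) x → rep c' = rep c := by
  have hm : p ^ μ ≠ 0 := pow_ne_zero _ hp.ne_zero
  -- the upper left block chosen by `epsilon` depends only on the set of the possible blocks
  let P : Cosets N → Matrix (Fin 2) (Fin 2) ℤ → Prop := fun c α => ∃ x, HasTriRep N (p ^ μ) c α x
  have hex : ∀ c : Cosets N, InCoset N d (c.out : Matrix Ix Ix ℝ) →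
      P c (Classical.epsilon (P c)) := by
    intro c hc
    obtain ⟨κ, hκ, a, b, d', e⟩ := exists_mul_eq_patMat_upper hN hp hpN (hc.isPat hN hd)
      (hc.isSim hd)
    have hs := (hc.mul_left hκ).isSim hd
    rw [e] at hs
    obtain ⟨-, x, hx⟩ := exists_eq_triMat hN hm hs
    have hx1 := hx 1
    rw [one_smul, one_smul] at hx1
    exact Classical.epsilon_spec (p := P c) ⟨a, x, κ, hκ, e.trans hx1⟩
  choose! off hoff using hex
  refine ⟨fun c => Classical.epsilon (P c), off, fun c hc => ⟨?_, hoff c hc⟩, ?_⟩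
  · have hin := (hoff c hc).inCoset hc
    obtain ⟨b, d', x, h1, -⟩ := hin.exists_eq_triMat hN hm hd (toBlocks₁₁_triMat _ _ _ _)
      (toBlocks₂₁_triMat _ _ _ _)
    have hs := hin.isSim hd
    rw [h1] at hs
    exact (exists_eq_triMat hN hm hs).1
  · intro c c' hc hc' x hx
    have hP : P c = P c' := by
      funext β
      refine propext ⟨fun ⟨y, hy⟩ => ?_, fun ⟨y, hy⟩ => ?_⟩
      · exact HasTriRep.transfer hN hm hd hc' (hoff c hc) hy hx
      · exact HasTriRep.transfer hN hm hd hc hx hy (hoff c hc)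
    simp only [hP]

/-- The exponential sum over the cosets with a common upper left block is an integer, after multiplication
by the factor from the weight `k` action. -/
theorem exists_int_coset_sum {N p μ k : ℕ} (hN : 0 < N) (hp : p.Prime) (hμ : 0 < μ) (hk : 3 ≤ k)
    {d : Ix → ℝ} (hd : IsHeckeDiag ((p ^ μ : ℕ) : ℤ) d) (C : Finset (Cosets N))
    (hC : ∀ c, c ∈ C ↔ InCoset N d (c.out : Matrix Ix Ix ℝ))
    {rep : Cosets N → Matrix (Fin 2) (Fin 2) ℤ} {off : Cosets N → Fin 3 → ℤ}
    (hrep : ∀ c ∈ C, levDet N (rep c) ≠ 0 ∧ HasTriRep N (p ^ μ) c (rep c) (off c))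
    (hshare : ∀ c ∈ C, ∀ c' ∈ C, ∀ x, HasTriRep N (p ^ μ) c' (rep c) x → rep c' = rep c)
    {c₀ : Cosets N} (hc₀ : c₀ ∈ C) (s T : Fin 3 → ℤ)
    (hs : (phi N (rep c₀))ᵀ *ᵥ s = ((p ^ μ : ℕ) : ℤ) • T) :
    ∃ z : ℤ, (((p ^ μ : ℕ) : ℂ) ^ 3)⁻¹ * (levDet N (rep c₀) : ℂ) ^ k *
      ∑ c ∈ C with rep c = rep c₀, ec ((∑ i, (s i : ℂ) * off c i) / ((p ^ μ : ℕ) : ℂ)) = z := by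
  classical
  have hm : p ^ μ ≠ 0 := pow_ne_zero _ hp.ne_zero
  have : NeZero (p ^ μ) := ⟨hm⟩
  set m := p ^ μ with hmdef
  set α := rep c₀ with hα
  have hδ : levDet N α ≠ 0 := (hrep c₀ hc₀).1
  set X : Finset (Fin 3 → ZMod m) :=
    {y | ∃ x : Fin 3 → ℤ, red m x = y ∧ InCoset N d (triMat N m α x)} with hX
  have memX : ∀ y, y ∈ X ↔ ∃ x : Fin 3 → ℤ, red m x = y ∧ InCoset N d (triMat N m α x) := by
    simp [hX]
  have hsum : ∑ c ∈ C with rep c = α, ec ((∑ i, (s i : ℂ) * off c i) / (m : ℂ))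
      = ∑ y ∈ X, vecChar m s y := by
    refine Finset.sum_bij (fun c _ => red m (off c)) ?_ ?_ ?_ ?_
    · intro c hc
      obtain ⟨hc1, hc2⟩ := Finset.mem_filter.1 hc
      refine (memX _).2 ⟨off c, rfl, ?_⟩
      exact (hc2 ▸ (hrep c hc1).2).inCoset ((hC c).1 hc1)
    · intro c hc c' hc' hcc
      obtain ⟨hc1, hc2⟩ := Finset.mem_filter.1 hc
      obtain ⟨hc1', hc2'⟩ := Finset.mem_filter.1 hc'
      obtain ⟨κ, hκ, e⟩ := (hrep c hc1).2
      obtain ⟨κ', hκ', e'⟩ := (hrep c' hc1').2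
      rw [hc2] at e
      rw [hc2'] at e'
      obtain ⟨ρ, hρ, h⟩ := exists_mem_mul_triMat_eq hN hm α hcc.symm
      refine quotient_eq_of_mul_out_eq (κ := κ⁻¹ * ρ * κ')
        (mul_mem (mul_mem (inv_mem hκ) hρ) hκ') ?_
      rw [Units.val_mul, Units.val_mul, Matrix.mul_assoc, e', Matrix.mul_assoc, h, ← e,
        ← Matrix.mul_assoc, ← Units.val_mul, inv_mul_cancel, Units.val_one, Matrix.one_mul]
    · intro y hy
      obtain ⟨x, rfl, hx⟩ := (memX _).1 hy
      -- the coset of `triMat N m α x`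
      have hmR : ((m : ℤ) : ℝ) ≠ 0 := by exact_mod_cast hm
      have hsim := hx.isSim hd
      let g : GL Ix ℝ := ⟨triMat N m α x, (((m : ℤ) : ℝ))⁻¹ • adj (triMat N m α x),
        by rw [Matrix.mul_smul, mul_adj_self hmR hsim, smul_smul, inv_mul_cancel₀ hmR, one_smul],
        by rw [Matrix.smul_mul, adj_mul_self hsim, smul_smul, inv_mul_cancel₀ hmR, one_smul]⟩
      let c : Cosets N := Quotient.mk _ g
      have hcg : g * c.out⁻¹ ∈ paramodularGroup N :=
        QuotientGroup.rightRel_apply.1 (Quotient.mk_out g)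
      have htri : HasTriRep N m c α x := ⟨g * c.out⁻¹, hcg, by
        rw [← Units.val_mul, inv_mul_cancel_right]⟩
      have hcC : c ∈ C := by
        rw [hC]
        have h1 := hx.mul_left (inv_mem hcg)
        obtain ⟨κ, hκ, e⟩ := htri
        have h2 : ((g * c.out⁻¹)⁻¹ : GL Ix ℝ) * g = c.out := by group
        have h3 := congrArg (Units.val) h2
        rw [Units.val_mul] at h3
        rw [← h3]
        exact h1
      have hca : rep c = α := hshare c₀ hc₀ c hcC x htri
      refine ⟨c, Finset.mem_filter.2 ⟨hcC, hca⟩, ?_⟩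
      obtain ⟨κ, hκ, e⟩ := htri
      obtain ⟨κ', hκ', e'⟩ := (hrep c hcC).2
      rw [hca] at e'
      refine red_eq_of_mul_triMat_eq hN hm hδ (κ := κ * κ'⁻¹) (mul_mem hκ (inv_mem hκ')) ?_
      rw [← e', ← e, ← Matrix.mul_assoc, ← Units.val_mul, inv_mul_cancel_right]
    · intro c _
      exact (vecChar_red m s (off c)).symm
  rw [hsum]
  refine exists_int_weighted_sum p μ k hp hμ hk (phi N α) (levDet N α) hδ (det_phi N α) X s T hs
    ?_ ?_
  · intro u hu y hy
    obtain ⟨x, rfl, hx⟩ := (memX _).1 hy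
    obtain ⟨b, d', x', h1, h2⟩ := hx.exists_eq_triMat hN hm hd (toBlocks₁₁_triMat _ _ _ _)
      (toBlocks₂₁_triMat _ _ _ _)
    have h3 : triMat N m α x = triMat N m α x' := by rw [h1]; simpa using h2 1
    have h4 : red m x = red m x' :=
      red_eq_of_mul_triMat_eq hN hm hδ (κ := 1) (one_mem _) (by simpa using h3)
    refine (memX _).2 ⟨(u : ℤ) • x', ?_, ?_⟩
    · rw [h4]
      funext i
      simp [red]
    · rw [← h2]
      exact InCoset.smul_upper hN hp hd hu (h1 ▸ hx)
  · rintro _ ⟨_, ⟨w, rfl⟩, rfl⟩ y hy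
    obtain ⟨x, rfl, hx⟩ := (memX _).1 hy
    obtain ⟨κ, hκ, e⟩ := exists_mem_eq_upper hN w
    refine (memX _).2 ⟨x + phi N α *ᵥ w, ?_, ?_⟩
    · rw [map_add, add_comm]; rfl
    · rw [← triMat_mul_upper hN hm hδ, ← e]
      exact hx.mul_right hκ

/-! ### The Fourier expansion of a Hecke operator -/

/-- The cocycle relation `f | (γ g) = f | g` for `γ ∈ K(N)` and a similitude `g` with invertible
factor of automorphy. -/
theorem slash_mul_of_mem {N k : ℕ} {f : Matrix (Fin 2) (Fin 2) ℂ → ℂ}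
    (hf : IsParamodularForm k N f) {γ : GL Ix ℝ} (hγ : γ ∈ paramodularGroup N) {m : ℝ}
    {g : Matrix Ix Ix ℝ} (hs : IsSim m g) {Ω : Matrix (Fin 2) (Fin 2) ℂ}
    (hu : IsUnit (denom g Ω).det) (hmem : moebius g Ω ∈ siegelUpperHalfSpace) :
    slash k f ((γ : Matrix Ix Ix ℝ) * g) Ω = slash k f g Ω := by
  set G : Matrix Ix Ix ℝ := γ.val with hG
  set D := denom g Ω with hD
  have hinv := hf.invariant γ hγ _ hmem
  have hblocks : G * g = fromBlocks (G.toBlocks₁₁ * g.toBlocks₁₁ + G.toBlocks₁₂ * g.toBlocks₂₁)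
      (G.toBlocks₁₁ * g.toBlocks₁₂ + G.toBlocks₁₂ * g.toBlocks₂₂)
      (G.toBlocks₂₁ * g.toBlocks₁₁ + G.toBlocks₂₂ * g.toBlocks₂₁)
      (G.toBlocks₂₁ * g.toBlocks₁₂ + G.toBlocks₂₂ * g.toBlocks₂₂) := by
    conv_lhs => rw [← fromBlocks_toBlocks G, ← fromBlocks_toBlocks g, fromBlocks_multiply]
  have hadd : ∀ P Q : Matrix (Fin 2) (Fin 2) ℝ,
      (P + Q).map Complex.ofReal = P.map Complex.ofReal + Q.map Complex.ofReal := fun P Q =>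
    Matrix.map_add _ (by simp) P Q
  -- the numerator of `g Ω` is `(g Ω) D`
  have hnum : g.toBlocks₁₁.map Complex.ofReal * Ω + g.toBlocks₁₂.map Complex.ofReal
      = moebius g Ω * D := by
    rw [moebius, Matrix.mul_assoc, nonsing_inv_mul _ hu, Matrix.mul_one]
  have hden : denom (G * g) Ω = denom G (moebius g Ω) * D := by
    rw [denom, denom, hblocks, toBlocks_fromBlocks₂₁, toBlocks_fromBlocks₂₂, Matrix.add_mul,
      Matrix.mul_assoc, ← hnum, hD, denom]
    simp only [hadd, map_ofReal_mul, Matrix.add_mul, Matrix.mul_add, Matrix.mul_assoc]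
    abel
  have hmoeb : moebius (G * g) Ω = moebius G (moebius g Ω) := by
    have h0 : moebius G (moebius g Ω) = (G.toBlocks₁₁.map Complex.ofReal * moebius g Ω
        + G.toBlocks₁₂.map Complex.ofReal) * (denom G (moebius g Ω))⁻¹ := rfl
    rw [h0, moebius, hden, Matrix.mul_inv_rev, ← Matrix.mul_assoc]
    congr 1
    have h1 : (G * g).toBlocks₁₁.map Complex.ofReal * Ω + (G * g).toBlocks₁₂.map Complex.ofReal
        = (G.toBlocks₁₁.map Complex.ofReal * moebius g Ω + G.toBlocks₁₂.map Complex.ofReal) * D := by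
      rw [hblocks, toBlocks_fromBlocks₁₁, toBlocks_fromBlocks₁₂, Matrix.add_mul, Matrix.mul_assoc,
        ← hnum, hD, denom]
      simp only [hadd, map_ofReal_mul, Matrix.add_mul, Matrix.mul_add, Matrix.mul_assoc]
      abel
    rw [h1, Matrix.mul_assoc, mul_nonsing_inv _ hu, Matrix.mul_one]
  rw [slash, multiplier_of_isSim (isSim_of_mem hγ), ← hG] at hinv
  have hmul : multiplier (G * g) = multiplier g := by
    rw [multiplier_of_isSim ((isSim_of_mem hγ).mul hs), multiplier_of_isSim hs, one_mul]
  rw [slash, slash, hmul, hden, hmoeb, det_mul, mul_zpow, ← hinv]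
  simp
  ring

/-- A Hecke operator in terms of triangular representatives. -/
theorem hecke_pt {N m k : ℕ} (hN : 0 < N) (hm : m ≠ 0) {d : Ix → ℝ}
    (hd : IsHeckeDiag (m : ℤ) d) (C : Finset (Cosets N))
    (hC : ∀ c, c ∈ C ↔ InCoset N d (c.out : Matrix Ix Ix ℝ))
    {rep : Cosets N → Matrix (Fin 2) (Fin 2) ℤ} {off : Cosets N → Fin 3 → ℤ}
    (hrep : ∀ c ∈ C, levDet N (rep c) ≠ 0 ∧ HasTriRep N m c (rep c) (off c))
    {f : Matrix (Fin 2) (Fin 2) ℂ → ℂ} (hf : IsParamodularForm k N f) {ζ : Fin 3 → ℂ}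
    (hζ : pt N ζ ∈ siegelUpperHalfSpace) :
    hecke k N d f (pt N ζ) = ∑ c ∈ C, ((m : ℂ) ^ 3)⁻¹ * (levDet N (rep c) : ℂ) ^ k *
      f (pt N fun i => ((∑ j, (phi N (rep c) i j : ℂ) * ζ j) + off c i) / m) := by
  have h1 : hecke k N d f (pt N ζ) = ∑ c ∈ C, slash k f (c.out : Matrix Ix Ix ℝ) (pt N ζ) := by
    rw [hecke]
    rw [← finsum_mem_coe_finset]
    refine finsum_congr fun c => ?_
    rw [show (c ∈ (C : Set (Cosets N))) = (c.out ∈ doubleCoset N d) from propext (hC c)]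
  rw [h1]
  refine Finset.sum_congr rfl fun c hc => ?_
  obtain ⟨hδ, hrepc⟩ := hrep c hc
  have hs := (hrepc.inCoset ((hC c).1 hc)).isSim hd
  obtain ⟨κ, hκ, e⟩ := hrepc
  rw [← slash_triMat hN hm hδ _ hs]
  have h2 : (c.out : Matrix Ix Ix ℝ) = ((κ⁻¹ : GL Ix ℝ) : Matrix Ix Ix ℝ)
      * triMat N m (rep c) (off c) := by
    rw [← e, ← Matrix.mul_assoc, ← Units.val_mul, inv_mul_cancel, Units.val_one, Matrix.one_mul]
  rw [h2]
  refine slash_mul_of_mem hf (inv_mem hκ) hs ?_ ?_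
  · rw [det_denom_triMat hδ]
    exact isUnit_iff_ne_zero.2 (div_ne_zero (pow_ne_zero _ (by exact_mod_cast hm))
      (by exact_mod_cast hδ))
  · rw [moebius_triMat hN hm hδ]
    exact pt_triMat_mem hN hm hδ _ hζ

/-- The coordinates of an index of the Fourier expansion. -/
def idx (t : ℤ × ℤ × ℤ) : Fin 3 → ℤ := ![t.1, t.2.1, t.2.2]

theorem idx_injective : Function.Injective idx := by
  rintro ⟨a, b, c⟩ ⟨a', b', c'⟩ h
  have h0 := congrFun h 0
  have h1 := congrFun h 1
  have h2 := congrFun h 2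
  simp [idx] at h0 h1 h2
  simp [h0, h1, h2]

theorem HasFourierCoeffs.hasSum_pt {N : ℕ} (hN : 0 < N) {f : Matrix (Fin 2) (Fin 2) ℂ → ℂ}
    {a : indexSemi N → ℂ} (hf : HasFourierCoeffs N f a) {ζ : Fin 3 → ℂ}
    (hζ : pt N ζ ∈ siegelUpperHalfSpace) :
    HasSum (fun t : indexSemi N => a t * ec (∑ i, (idx t i : ℂ) * ζ i)) (f (pt N ζ)) := by
  have h : (N : ℂ) ≠ 0 := by exact_mod_cast hN.ne'
  refine Eq.subst (motive := fun F => HasSum F _) (funext fun t => ?_) (hf _ hζ)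
  rw [ec]
  congr 3
  simp [indexMatrix, pt, trace_fin_two, idx, Fin.sum_univ_three]
  field_simp
  ring

/-- The coordinates of the base point `i · 1`. -/
def basePt (N : ℕ) : Fin 3 → ℂ := ![Complex.I, 0, Complex.I * N]

theorem pt_basePt_add_mem {N : ℕ} (hN : 0 < N) (x : Fin 3 → ℝ) :
    pt N (fun i => basePt N i + (x i : ℂ)) ∈ siegelUpperHalfSpace := by
  rw [pt_mem_siegelUpperHalfSpace_iff]
  have h : (N : ℝ) ≠ 0 := by exact_mod_cast hN.ne'
  have h1 : symMat N (fun i => (basePt N i + (x i : ℂ)).im) = 1 := by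
    ext i j
    fin_cases i <;> fin_cases j <;> simp [symMat, basePt, h]
  rw [h1]
  exact PosDef.one

/-- The Fourier coefficients of `λ f = T f`, for a Hecke operator `T` written in terms of triangular
representatives. -/
theorem eigenvalue_mul_coeff {N m k : ℕ} (hN : 0 < N) (hm : m ≠ 0) {d : Ix → ℝ}
    (hd : IsHeckeDiag (m : ℤ) d) (C : Finset (Cosets N))
    (hC : ∀ c, c ∈ C ↔ InCoset N d (c.out : Matrix Ix Ix ℝ))
    {rep : Cosets N → Matrix (Fin 2) (Fin 2) ℤ} {off : Cosets N → Fin 3 → ℤ}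
    (hrep : ∀ c ∈ C, levDet N (rep c) ≠ 0 ∧ HasTriRep N m c (rep c) (off c))
    {f : Matrix (Fin 2) (Fin 2) ℂ → ℂ} (hf : IsParamodularForm k N f) {a : indexSemi N → ℂ}
    (ha : HasFourierCoeffs N f a) {lam : ℂ}
    (hlam : ∀ Ω ∈ siegelUpperHalfSpace, hecke k N d f Ω = lam * f Ω) (T : indexSemi N) :
    lam * a T = ∑ c ∈ C, ((m : ℂ) ^ 3)⁻¹ * (levDet N (rep c) : ℂ) ^ k *
      ∑' s : indexSemi N, if (phi N (rep c))ᵀ *ᵥ idx s = (m : ℤ) • idx T then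
        a s * ec ((∑ i, (idx s i : ℂ) * off c i) / m) else 0 := by
  have hmC : (m : ℂ) ≠ 0 := by exact_mod_cast hm
  have hsmul : ∀ x : Fin 3 → ℝ, pt N (fun i => basePt N i + m * (x i : ℂ)) ∈
      siegelUpperHalfSpace := fun x => by
    simpa using pt_basePt_add_mem hN (fun i => m * x i)
  set E : ℂ := ec (∑ i, (idx T i : ℂ) * basePt N i) with hE
  -- the two sides of the eigenvalue equation, as Fourier series in the real part
  have hL : Tendsto (gridMean ((m : ℤ) • idx T)
      (fun x => f (pt N fun i => basePt N i + m * (x i : ℂ)))) atTop (𝓝 (a T * E)) := by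
    have h1 := tendsto_gridMean
      (fun t : indexSemi N => a t * ec (∑ i, (idx t i : ℂ) * basePt N i))
      (fun t => (m : ℤ) • idx t) (fun x => f (pt N fun i => basePt N i + m * (x i : ℂ)))
      (fun x => by
        refine Eq.subst (motive := fun F => HasSum F _) (funext fun t => ?_)
          (ha.hasSum_pt hN (hsmul x))
        rw [mul_assoc, ← ec_add, ← Finset.sum_add_distrib]
        congr 2
        refine Finset.sum_congr rfl fun i _ => ?_
        simp
        ring) ((m : ℤ) • idx T)
    rwa [tsum_eq_single T (fun t ht => if_neg fun h => ht (Subtype.ext (idx_injective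
      (smul_right_injective _ (by exact_mod_cast hm : (m : ℤ) ≠ 0) h)))), if_pos rfl] at h1
  have hR : ∀ c ∈ C, Tendsto (gridMean ((m : ℤ) • idx T) (fun x =>
      f (pt N fun i => ((∑ j, (phi N (rep c) i j : ℂ) * (basePt N j + m * (x j : ℂ))) + off c i)
        / m))) atTop
      (𝓝 ((∑' s : indexSemi N, if (phi N (rep c))ᵀ *ᵥ idx s = (m : ℤ) • idx T then
        a s * ec ((∑ i, (idx s i : ℂ) * off c i) / m) else 0) * E)) := by
    intro c hc
    have h1 := tendsto_gridMean (fun s : indexSemi N => a s * ec (∑ i, (idx s i : ℂ) *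
        (((∑ j, (phi N (rep c) i j : ℂ) * basePt N j) + off c i) / m)))
      (fun s => (phi N (rep c))ᵀ *ᵥ idx s) (fun x =>
        f (pt N fun i => ((∑ j, (phi N (rep c) i j : ℂ) * (basePt N j + m * (x j : ℂ)))
          + off c i) / m))
      (fun x => by
        refine Eq.subst (motive := fun F => HasSum F _) (funext fun s => ?_)
          (ha.hasSum_pt hN (pt_triMat_mem hN hm (hrep c hc).1 (off c) (hsmul x)))
        rw [mul_assoc, ← ec_add]
        congr 2
        simp [Fin.sum_univ_three, mulVec, dotProduct]
        field_simp
        ring) ((m : ℤ) • idx T)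
    rw [← tsum_mul_right]
    refine Eq.subst (motive := fun z => Tendsto _ _ (𝓝 z)) (tsum_congr fun s => ?_) h1
    split_ifs with h
    · have h0 := congrFun h 0
      have h1 := congrFun h 1
      have h2 := congrFun h 2
      simp only [mulVec, dotProduct, transpose_apply, Fin.sum_univ_three, Pi.smul_apply,
        smul_eq_mul] at h0 h1 h2
      rw [hE, mul_assoc, ← ec_add]
      congr 2
      have k0 : (phi N (rep c) 0 0 : ℂ) * idx s 0 + phi N (rep c) 1 0 * idx s 1
          + phi N (rep c) 2 0 * idx s 2 = m * idx T 0 := by exact_mod_cast h0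
      have k1 : (phi N (rep c) 0 1 : ℂ) * idx s 0 + phi N (rep c) 1 1 * idx s 1
          + phi N (rep c) 2 1 * idx s 2 = m * idx T 1 := by exact_mod_cast h1
      have k2 : (phi N (rep c) 0 2 : ℂ) * idx s 0 + phi N (rep c) 1 2 * idx s 1
          + phi N (rep c) 2 2 * idx s 2 = m * idx T 2 := by exact_mod_cast h2
      simp only [Fin.sum_univ_three]
      field_simp
      linear_combination basePt N 0 * k0 + basePt N 1 * k1 + basePt N 2 * k2
    · rw [zero_mul]
  have heq : (fun L => lam * gridMean ((m : ℤ) • idx T)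
      (fun x => f (pt N fun i => basePt N i + m * (x i : ℂ))) L)
      = fun L => ∑ c ∈ C, ((m : ℂ) ^ 3)⁻¹ * (levDet N (rep c) : ℂ) ^ k *
        gridMean ((m : ℤ) • idx T) (fun x => f (pt N fun i =>
          ((∑ j, (phi N (rep c) i j : ℂ) * (basePt N j + m * (x j : ℂ))) + off c i) / m)) L := by
    funext L
    simp only [← gridMean_const_mul]
    rw [← gridMean_sum]
    congr 1
    funext x
    rw [← hlam _ (hsmul x), hecke_pt hN hm hd C hC hrep hf (hsmul x)]
  have h1 := hL.const_mul lam
  rw [heq] at h1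
  have h2 := tendsto_nhds_unique h1 (tendsto_finsetSum C fun c hc => (hR c hc).const_mul
    (((m : ℂ) ^ 3)⁻¹ * (levDet N (rep c) : ℂ) ^ k))
  refine mul_right_cancel₀ (ec_ne_zero _ : E ≠ 0) ?_
  rw [mul_assoc, h2, Finset.sum_mul]
  exact Finset.sum_congr rfl fun c _ => by ring

/-- The Fourier coefficients of `T f` are integral linear combinations of those of `f`, with the
same coefficients for all `f`. -/
theorem exists_integral_hecke_formula {N p μ k : ℕ} (hN : 0 < N) (hp : p.Prime)
    (hpN : ¬ p ^ 2 ∣ N) (hμ : 0 < μ) (hk : 3 ≤ k) {d : Ix → ℝ}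
    (hd : IsHeckeDiag ((p ^ μ : ℕ) : ℤ) d) :
    ∃ ℓ : indexSemi N → (indexSemi N →₀ ℤ), ∀ (f : Matrix (Fin 2) (Fin 2) ℂ → ℂ)
      (a : indexSemi N → ℂ) (lam : ℂ), IsParamodularForm k N f → HasFourierCoeffs N f a →
      (∀ Ω ∈ siegelUpperHalfSpace, hecke k N d f Ω = lam * f Ω) →
      ∀ T, lam * a T = Finsupp.linearCombination ℤ a (ℓ T) := by
  classical
  have hm : p ^ μ ≠ 0 := pow_ne_zero _ hp.ne_zero
  have : NeZero (p ^ μ) := ⟨hm⟩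
  obtain ⟨rep, off, hrep, hshare⟩ := exists_triRep hN hp hpN hd
  set C := (finite_cosets hN hd).toFinset with hCdef
  have hC : ∀ c, c ∈ C ↔ InCoset N d (c.out : Matrix Ix Ix ℝ) := fun c => by simp [hCdef]
  have hrep' : ∀ c ∈ C, levDet N (rep c) ≠ 0 ∧ HasTriRep N (p ^ μ) c (rep c) (off c) :=
    fun c hc => hrep c ((hC c).1 hc)
  -- the contribution of the cosets with upper left block `α`
  have key : ∀ (T : indexSemi N) (α : Matrix (Fin 2) (Fin 2) ℤ), ∃ l : indexSemi N →₀ ℤ,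
      α ∈ C.image rep → ∀ a : indexSemi N → ℂ, ∑ c ∈ C with rep c = α,
        (((p ^ μ : ℕ) : ℂ) ^ 3)⁻¹ * (levDet N (rep c) : ℂ) ^ k *
        (∑' s : indexSemi N, if (phi N (rep c))ᵀ *ᵥ idx s = ((p ^ μ : ℕ) : ℤ) • idx T then
          a s * ec ((∑ i, (idx s i : ℂ) * off c i) / ((p ^ μ : ℕ) : ℂ)) else 0)
        = Finsupp.linearCombination ℤ a l := by
    intro T α
    by_cases hα : α ∈ C.image rep
    swap
    · exact ⟨0, fun h => absurd h hα⟩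
    obtain ⟨c₀, hc₀, rfl⟩ := Finset.mem_image.1 hα
    by_cases hs : ∃ s : indexSemi N, (phi N (rep c₀))ᵀ *ᵥ idx s = ((p ^ μ : ℕ) : ℤ) • idx T
    · obtain ⟨s, hs⟩ := hs
      obtain ⟨z, hz⟩ := exists_int_coset_sum hN hp hμ hk hd C hC hrep'
        (fun c hc c' hc' x hx => hshare c c' ((hC c).1 hc) ((hC c').1 hc') x hx) hc₀ (idx s)
        (idx T) hs
      refine ⟨Finsupp.single s z, fun _ a => ?_⟩
      rw [Finsupp.linearCombination_single, zsmul_eq_mul (a s) z, ← hz, Finset.mul_sum, Finset.sum_mul]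
      refine Finset.sum_congr rfl fun c hc => ?_
      rw [(Finset.mem_filter.1 hc).2, tsum_eq_single s, if_pos hs]
      · ring
      · intro s' hs'
        refine if_neg fun h => hs' (Subtype.ext (idx_injective ?_))
        refine Matrix.mulVec_injective_of_det_ne_zero (M := (phi N (rep c₀))ᵀ) ?_ (h.trans hs.symm)
        rw [det_transpose, det_phi]
        exact pow_ne_zero _ (hrep' c₀ hc₀).1
    · refine ⟨0, fun _ a => ?_⟩
      rw [map_zero]
      refine Finset.sum_eq_zero fun c hc => ?_
      rw [(Finset.mem_filter.1 hc).2]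
      have h0 : ∀ s : indexSemi N, ¬ (phi N (rep c₀))ᵀ *ᵥ idx s = ((p ^ μ : ℕ) : ℤ) • idx T :=
        fun s h => hs ⟨s, h⟩
      rw [tsum_congr fun s => if_neg (h0 s), tsum_zero, mul_zero]
  choose l hl using key
  refine ⟨fun T => ∑ α ∈ C.image rep, l T α, fun f a lam hf ha hlam T => ?_⟩
  rw [eigenvalue_mul_coeff hN hm hd C hC hrep' hf ha hlam T, map_sum,
    ← Finset.sum_fiberwise_of_maps_to (g := rep) (t := C.image rep)
      (fun c hc => Finset.mem_image_of_mem _ hc)]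
  exact Finset.sum_congr rfl fun α hα => hl T α hα a

theorem isHeckeDiag_diagT (p : ℕ) : IsHeckeDiag ((p ^ 1 : ℕ) : ℤ) (diagT p) where
  int := by
    rintro (i | i) <;> fin_cases i
    exacts [⟨1, by simp [diagT]⟩, ⟨1, by simp [diagT]⟩, ⟨p, by simp [diagT]⟩, ⟨p, by simp [diagT]⟩]
  sim := by
    intro i
    fin_cases i <;> simp [diagT]

theorem isHeckeDiag_diagSecond (N p : ℕ) : IsHeckeDiag ((p ^ 2 : ℕ) : ℤ) (diagSecond N p) := by
  unfold diagSecond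
  split_ifs
  · refine ⟨?_, ?_⟩
    · rintro (i | i) <;> fin_cases i
      exacts [⟨p, by simp [diagT01]⟩, ⟨p ^ 2, by simp [diagT01]⟩, ⟨p, by simp [diagT01]⟩,
        ⟨1, by simp [diagT01]⟩]
    · intro i
      fin_cases i <;> simp [diagT01, sq]
  · refine ⟨?_, ?_⟩
    · rintro (i | i) <;> fin_cases i
      exacts [⟨1, by simp [diagT1]⟩, ⟨p, by simp [diagT1]⟩, ⟨p ^ 2, by simp [diagT1]⟩,
        ⟨p, by simp [diagT1]⟩]
    · intro i
      fin_cases i <;> simp [diagT1, sq]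

/-! ### Vanishing of the singular Fourier coefficients -/

/-- The symplectic matrix with diagonal blocks `U`, `(U⁻¹)ᵀ`, for `U` with rows `(a, b)`, `(c, d)`
and determinant one. -/
def leviRat (a b c d : ℚ) : Matrix Ix Ix ℚ := fromBlocks !![a, b; c, d] 0 0 !![d, -c; -b, a]

theorem leviRat_mem {a b c d : ℚ} (h : a * d - b * c = 1) :
    leviRat a b c d ∈ symplecticGroup (Fin 2) ℚ := by
  rw [SymplecticGroup.mem_iff', leviRat, J, fromBlocks_transpose, fromBlocks_multiply,
    fromBlocks_multiply]
  congr 1 <;> ext i j <;> fin_cases i <;> fin_cases j <;>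
    simp [Matrix.mul_apply, Fin.sum_univ_two] <;> linarith

/-- The image of the point `diag(τ, i y)` under `leviRat a b c d`. -/
def leviPoint (a b c d : ℚ) (τ : ℂ) (y : ℝ) : Matrix (Fin 2) (Fin 2) ℂ :=
  point (a ^ 2 * τ + b ^ 2 * (Complex.I * y)) (a * c * τ + b * d * (Complex.I * y))
    (c ^ 2 * τ + d ^ 2 * (Complex.I * y))

theorem slash_leviRat {a b c d : ℚ} (h : a * d - b * c = 1) (k : ℕ)
    (f : Matrix (Fin 2) (Fin 2) ℂ → ℂ) (τ : ℂ) (y : ℝ) :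
    slash k f ((leviRat a b c d).map (fun x : ℚ => (x : ℝ))) (point τ 0 (Complex.I * y))
      = f (leviPoint a b c d τ y) := by
  have hR : (a : ℝ) * d - b * c = 1 := by exact_mod_cast h
  have hC : (a : ℂ) * d - b * c = 1 := by exact_mod_cast h
  set g : Matrix Ix Ix ℝ := (leviRat a b c d).map (fun x : ℚ => (x : ℝ)) with hg
  have hmul : multiplier g = 1 := by
    rw [multiplier, hg, leviRat]
    simp [J, Matrix.mul_apply, Fin.sum_univ_two]
    linarith
  have hden : denom g (point τ 0 (Complex.I * y)) = !![(d : ℂ), -c; -b, a] := by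
    ext i j
    fin_cases i <;> fin_cases j <;>
      simp [denom, hg, leviRat, toBlocks₂₁, toBlocks₂₂, Matrix.mul_apply]
  have hinv : (!![(d : ℂ), -c; -b, a])⁻¹ = !![(a : ℂ), c; b, d] := by
    refine Matrix.inv_eq_right_inv ?_
    ext i j
    fin_cases i <;> fin_cases j <;> simp [Matrix.mul_apply, Fin.sum_univ_two] <;>
      first | ring1 | linear_combination hC
  have hmoeb : moebius g (point τ 0 (Complex.I * y)) = leviPoint a b c d τ y := by
    rw [moebius, hden, hinv]
    ext i j
    fin_cases i <;> fin_cases j <;>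
      simp [hg, leviRat, toBlocks₁₁, toBlocks₁₂, Matrix.mul_apply, Fin.sum_univ_two, point,
        leviPoint] <;> ring
  have hdet : (!![(d : ℂ), -c; -b, a]).det = 1 := by
    rw [det_fin_two_of]; linear_combination hC
  rw [slash, hmul, hden, hmoeb, hdet]
  simp

theorem leviPoint_mem {a b c d : ℚ} (h : a * d - b * c = 1) {τ : ℂ} (hτ : 0 < τ.im) {y : ℝ}
    (hy : 0 < y) : leviPoint a b c d τ y ∈ siegelUpperHalfSpace := by
  have hR : (a : ℝ) * d - b * c = 1 := by exact_mod_cast h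
  refine ⟨?_, ?_⟩
  · ext i j
    fin_cases i <;> fin_cases j <;> simp [leviPoint, point]
  · have e : (leviPoint a b c d τ y).map Complex.im
        = !![(a : ℝ), b; c, d] * diagonal ![τ.im, y] * (!![(a : ℝ), b; c, d])ᴴ := by
      rw [conjTranspose_eq_transpose_of_trivial]
      have hre : ∀ q : ℚ, ((q : ℂ)).re = q := fun q => by simp
      have him : ∀ q : ℚ, ((q : ℂ)).im = 0 := fun q => by simp
      ext i j
      fin_cases i <;> fin_cases j <;>
        simp [leviPoint, point, Matrix.mul_apply, Fin.sum_univ_two, sq,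
          Complex.mul_im, vecMul_diagonal] <;> ring
    rw [e]
    refine PosDef.mul_mul_conjTranspose_same ?_ ?_
    · refine PosDef.diagonal fun i => ?_
      fin_cases i
      · exact hτ
      · exact hy
    · refine Matrix.vecMul_injective_of_isUnit ((Matrix.isUnit_iff_isUnit_det _).2 ?_)
      rw [det_fin_two_of]
      exact isUnit_iff_ne_zero.2 (by linarith)

/-- The value of the quadratic form of an index at the vector `(x, y)`. -/
def quadVal (N : ℕ) (t : ℤ × ℤ × ℤ) (x y : ℚ) : ℚ :=
  t.1 * x ^ 2 + t.2.1 * x * y + t.2.2 * N * y ^ 2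

theorem quadVal_nonneg {N : ℕ} {t : ℤ × ℤ × ℤ} (ht : t ∈ indexSemi N) (x y : ℚ) :
    0 ≤ quadVal N t x y := by
  obtain ⟨n, r, l⟩ := t
  obtain ⟨hn, hl, hD⟩ := ht
  simp only at hn hl hD
  have hn' : (0 : ℚ) ≤ n := by exact_mod_cast hn
  have hl' : (0 : ℚ) ≤ l := by exact_mod_cast hl
  have hD' : (0 : ℚ) ≤ 4 * n * l * N - r ^ 2 := by exact_mod_cast hD
  simp only [quadVal]
  rcases hn'.eq_or_lt with h0 | h0
  · have hr : (r : ℚ) = 0 := by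
      rw [← h0] at hD'
      nlinarith [sq_nonneg (r : ℚ)]
    rw [← h0, hr]
    have : (0 : ℚ) ≤ l * N * y ^ 2 := by positivity
    linarith
  · have h1 : 0 ≤ (4 * n : ℚ) * (n * x ^ 2 + r * x * y + l * N * y ^ 2) := by
      have : (4 * n : ℚ) * (n * x ^ 2 + r * x * y + l * N * y ^ 2)
          = (2 * n * x + r * y) ^ 2 + (4 * n * l * N - r ^ 2) * y ^ 2 := by ring
      rw [this]
      positivity
    exact nonneg_of_mul_nonneg_right h1 (by positivity)

theorem HasFourierCoeffs.hasSum_leviPoint {N : ℕ} {f : Matrix (Fin 2) (Fin 2) ℂ → ℂ}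
    {A : indexSemi N → ℂ} (hA : HasFourierCoeffs N f A) {a b c d : ℚ} (h : a * d - b * c = 1)
    {τ : ℂ} (hτ : 0 < τ.im) {y : ℝ} (hy : 0 < y) :
    HasSum (fun t : indexSemi N => A t * ec (quadVal N t a c * τ)
      * ec (quadVal N t b d * (Complex.I * y))) (f (leviPoint a b c d τ y)) := by
  refine Eq.subst (motive := fun F => HasSum F _) (funext fun t => ?_) (hA _ (leviPoint_mem h hτ hy))
  rw [mul_assoc (A t), ← ec_add, ec]
  congr 3
  simp [indexMatrix, leviPoint, point, trace_fin_two, quadVal]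
  ring

/-- The Fourier coefficient of a cusp form at `t₀` vanishes if `t₀` has a rational isotropic vector
`(b, d)` and is determined by its value at a complementary vector `(a, c)`. -/
theorem IsCuspForm.coeff_eq_zero_of_isotropic {N k : ℕ} {f : Matrix (Fin 2) (Fin 2) ℂ → ℂ}
    (hf : IsCuspForm k N f) {A : indexSemi N → ℂ} (hA : HasFourierCoeffs N f A) {a b c d : ℚ}
    (h : a * d - b * c = 1) {L : indexSemi N → ℤ} (hL : ∀ t, (L t : ℚ) = quadVal N t a c)
    {t₀ : indexSemi N} (h₀ : quadVal N t₀ b d = 0)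
    (huniq : ∀ t : indexSemi N, quadVal N t b d = 0 → L t = L t₀ → t = t₀) : A t₀ = 0 := by
  classical
  have hLC : ∀ t : indexSemi N, ((quadVal N t a c : ℚ) : ℂ) = L t := fun t => by
    rw [← hL t]; simp
  -- the constant term with respect to `y`
  have hsum : ∀ τ : ℂ, 0 < τ.im → HasSum (fun t : indexSemi N =>
      if quadVal N t b d = 0 then A t * ec (L t * τ) else 0) 0 := by
    intro τ hτ
    have hb := (hA.hasSum_leviPoint h hτ one_pos).summable.norm
    have hnorm : ∀ (t : indexSemi N) (y : ℝ), ‖ec (quadVal N t b d * (Complex.I * y))‖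
        = Real.exp (-(2 * Real.pi * (quadVal N t b d * y))) := fun t y => by
      rw [norm_ec]; simp
    have hle : ∀ y : ℝ, 1 ≤ y → ∀ t : indexSemi N, ‖A t * ec (quadVal N t a c * τ)
        * ec (quadVal N t b d * (Complex.I * y))‖ ≤ ‖A t * ec (quadVal N t a c * τ)
        * ec (quadVal N t b d * (Complex.I * (1 : ℝ)))‖ := by
      intro y hy t
      rw [norm_mul, norm_mul _ (ec (quadVal N t b d * (Complex.I * (1 : ℝ)))), hnorm, hnorm]
      have hq : (0 : ℝ) ≤ (quadVal N t b d : ℚ) := by exact_mod_cast quadVal_nonneg t.2 b d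
      gcongr
    have hlim : Tendsto (fun y : ℝ => ∑' t : indexSemi N, A t * ec (quadVal N t a c * τ)
        * ec (quadVal N t b d * (Complex.I * y))) atTop
        (𝓝 (∑' t : indexSemi N, if quadVal N t b d = 0 then A t * ec (L t * τ) else 0)) := by
      refine tendsto_tsum_of_dominated_convergence hb (fun t => ?_)
        ((eventually_ge_atTop 1).mono hle)
      split_ifs with hq
      · simp [hq, ec_zero, hLC]
      · rw [tendsto_zero_iff_norm_tendsto_zero]
        have hq0 : (0 : ℝ) < (quadVal N t b d : ℚ) := by
          exact_mod_cast lt_of_le_of_ne (quadVal_nonneg t.2 b d) (Ne.symm hq)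
        have h1 : Tendsto (fun y : ℝ => Real.exp (-(2 * Real.pi * (quadVal N t b d * y)))) atTop
            (𝓝 0) := by
          refine Real.tendsto_exp_neg_atTop_nhds_zero.comp ?_
          exact (tendsto_id.const_mul_atTop hq0).const_mul_atTop (by positivity)
        simpa [norm_mul, hnorm] using h1.const_mul ‖A t * ec (quadVal N t a c * τ)‖
    have hzero := hf.cuspidal _ (leviRat_mem h) τ hτ
    have hlim' : Tendsto (fun y : ℝ => slash k f ((leviRat a b c d).map (fun x : ℚ => (x : ℝ)))
        (point τ 0 (Complex.I * y))) atTop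
        (𝓝 (∑' t : indexSemi N, if quadVal N t b d = 0 then A t * ec (L t * τ) else 0)) := by
      refine hlim.congr' ?_
      filter_upwards [eventually_gt_atTop 0] with y hy
      rw [slash_leviRat h, (hA.hasSum_leviPoint h hτ hy).tsum_eq]
    have hS : Summable (fun t : indexSemi N =>
        if quadVal N t b d = 0 then A t * ec (L t * τ) else 0) := by
      refine Summable.of_norm_bounded hb fun t => ?_
      split_ifs with hq
      · simp [hq, ec_zero, hLC]
      · rw [norm_zero]
        exact norm_nonneg _
    have h1 := hS.hasSum
    rwa [← tendsto_nhds_unique hzero hlim'] at h1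
  have hgrid := tendsto_gridMean (fun t : indexSemi N =>
      if quadVal N t b d = 0 then A t * ec (L t * Complex.I) else 0) (fun t => ![L t, 0, 0])
    (fun _ => 0) (fun x => by
      refine Eq.subst (motive := fun F => HasSum F _) (funext fun t => ?_)
        (hsum (Complex.I + x 0) (by simp))
      split_ifs with hq
      · rw [mul_assoc, ← ec_add]
        congr 2
        simp [Fin.sum_univ_three]
        ring
      · simp) ![L t₀, 0, 0]
  have hz : gridMean ![L t₀, 0, 0] (fun _ => 0) = fun _ => 0 := by
    funext M
    simp [gridMean]
  rw [hz, tsum_eq_single t₀ fun t ht => ?_, if_pos rfl, if_pos h₀] at hgrid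
  · have h1 := tendsto_nhds_unique hgrid tendsto_const_nhds
    exact (mul_eq_zero.1 h1).resolve_right (ec_ne_zero _)
  · split_ifs with h1 h2
    · exact absurd (huniq t h2 (congrFun h1 0)) ht
    · rfl
    · rfl

/-- The Fourier coefficients of a cusp form are supported on the positive definite indices. -/
theorem IsCuspForm.coeff_eq_zero {N k : ℕ} (hN : 0 < N) {f : Matrix (Fin 2) (Fin 2) ℂ → ℂ}
    (hf : IsCuspForm k N f) {A : indexSemi N → ℂ} (hA : HasFourierCoeffs N f A)
    {t₀ : indexSemi N} (h₀ : (t₀ : ℤ × ℤ × ℤ) ∉ indexDef N) : A t₀ = 0 := by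
  have hNZ : (N : ℤ) ≠ 0 := by exact_mod_cast hN.ne'
  have hNQ : (N : ℚ) ≠ 0 := by exact_mod_cast hN.ne'
  obtain ⟨⟨n, r, l⟩, hn, hl, hD⟩ := t₀
  have hD0 : 4 * n * l * N - r ^ 2 = 0 := by
    by_contra hne
    exact h₀ ⟨hn, hl, lt_of_le_of_ne hD (Ne.symm hne)⟩
  simp only at hn hl hD
  have hDQ : 4 * n * l * N - r ^ 2 = (0 : ℚ) := by exact_mod_cast hD0
  by_cases hn0 : n = 0
  · have hr : r = 0 := by
      subst hn0
      exact pow_eq_zero_iff (two_ne_zero) |>.1 (by linarith)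
    refine hf.coeff_eq_zero_of_isotropic hA (a := 0) (b := 1) (c := -1) (d := 0) (by norm_num)
      (L := fun t => t.1.2.2 * N) (fun t => by simp [quadVal]) (by simp [quadVal, hn0]) ?_
    rintro ⟨⟨n', r', l'⟩, hn', hl', hD'⟩ hq hL
    simp only [quadVal] at hq hL hD'
    have hn'0 : n' = 0 := by
      have : (n' : ℚ) = 0 := by linarith
      exact_mod_cast this
    have hr' : r' = 0 := by
      subst hn'0
      exact pow_eq_zero_iff (two_ne_zero) |>.1 (by nlinarith [sq_nonneg r'])
    have hll : l' = l := mul_right_cancel₀ hNZ hL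
    subst hn'0 hr' hll hn0 hr
    rfl
  · have hnQ : (n : ℚ) ≠ 0 := by exact_mod_cast hn0
    refine hf.coeff_eq_zero_of_isotropic hA (a := 1) (b := -r / (2 * n)) (c := 0) (d := 1)
      (by norm_num) (L := fun t => t.1.1) (fun t => by simp [quadVal]) ?_ ?_
    · simp only [quadVal]
      field_simp
      linear_combination hDQ
    · rintro ⟨⟨n', r', l'⟩, hn', hl', hD'⟩ hq hL
      simp only [quadVal] at hq hL hD'
      subst hL
      have hD'Q : (0 : ℚ) ≤ 4 * n' * l' * N - r' ^ 2 := by exact_mod_cast hD'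
      -- completing the square in `4 n' q = 0`
      have h1 : ((r' : ℚ) - r) ^ 2 + (4 * n' * l' * N - r' ^ 2) = 0 := by
        field_simp at hq
        linear_combination hq
      have h2 : (r' : ℚ) - r = 0 := pow_eq_zero_iff (two_ne_zero) |>.1
        (le_antisymm (by linarith) (sq_nonneg _))
      have hrr : r' = r := by
        have : (r' : ℚ) = r := by linarith
        exact_mod_cast this
      subst hrr
      have h3 : (4 * n' * N : ℚ) * l' = (4 * n' * N) * l := by
        rw [h2] at h1
        linear_combination h1 - hDQ
      have hll : (l' : ℚ) = l := mul_left_cancel₀ (by positivity) h3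
      have : l' = l := by exact_mod_cast hll
      subst this
      rfl

/-! ### Congruence of the eigenvalues and Euler polynomials -/

open NumberField

theorem linearCombination_sub_mem {R ι : Type*} [CommRing R] {I : Ideal R} {x : ι → ℤ} {y : ι → R}
    (h : ∀ i, (x i : R) - y i ∈ I) (c : ι →₀ ℤ) :
    ((Finsupp.linearCombination ℤ x c : ℤ) : R) - Finsupp.linearCombination ℤ y c ∈ I := by
  rw [Finsupp.linearCombination_apply, Finsupp.linearCombination_apply, Finsupp.sum, Finsupp.sum,
    Int.cast_sum, ← Finset.sum_sub_distrib]
  refine sum_mem fun i _ => ?_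
  have := I.mul_mem_left (c i : R) (h i)
  convert this using 1
  simp [mul_sub]

section Congruence

variable {K : Type*} [Field K] [NumberField K] {σ : K →+* ℂ} {𝔞 : Ideal (𝓞 K)}

theorem CongruentMod.intCast (z : ℤ) : CongruentMod σ 𝔞 z z := ⟨z, z, rfl, by simp, by simp⟩

theorem CongruentMod.add {x y x' y' : ℂ} (h : CongruentMod σ 𝔞 x y) (h' : CongruentMod σ 𝔞 x' y') :
    CongruentMod σ 𝔞 (x + x') (y + y') := by
  obtain ⟨u, v, rfl, rfl, h⟩ := h
  obtain ⟨u', v', rfl, rfl, h'⟩ := h'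
  refine ⟨u + u', v + v', by simp, by simp, ?_⟩
  have := add_mem h h'
  convert this using 1
  push_cast
  ring

theorem CongruentMod.mul {x y x' y' : ℂ} (h : CongruentMod σ 𝔞 x y) (h' : CongruentMod σ 𝔞 x' y') :
    CongruentMod σ 𝔞 (x * x') (y * y') := by
  obtain ⟨u, v, rfl, rfl, h⟩ := h
  obtain ⟨u', v', rfl, rfl, h'⟩ := h'
  refine ⟨u * u', v * v', by simp, by simp, ?_⟩
  have := add_mem (𝔞.mul_mem_left (u : 𝓞 K) h') (𝔞.mul_mem_left v' h)
  convert this using 1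
  push_cast
  ring

theorem CongruentMod.sub {x y x' y' : ℂ} (h : CongruentMod σ 𝔞 x y) (h' : CongruentMod σ 𝔞 x' y') :
    CongruentMod σ 𝔞 (x - x') (y - y') := by
  have h1 := h.add ((CongruentMod.intCast (-1)).mul h')
  simpa [sub_eq_add_neg] using h1

theorem PolyCongruentMod.add {P Q P' Q' : ℂ[X]} (h : PolyCongruentMod σ 𝔞 P Q)
    (h' : PolyCongruentMod σ 𝔞 P' Q') : PolyCongruentMod σ 𝔞 (P + P') (Q + Q') := fun i => by
  simpa using (h i).add (h' i)

theorem PolyCongruentMod.sub {P Q P' Q' : ℂ[X]} (h : PolyCongruentMod σ 𝔞 P Q)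
    (h' : PolyCongruentMod σ 𝔞 P' Q') : PolyCongruentMod σ 𝔞 (P - P') (Q - Q') := fun i => by
  simpa using (h i).sub (h' i)

theorem CongruentMod.poly {x y : ℂ} (h : CongruentMod σ 𝔞 x y) (n : ℕ) :
    PolyCongruentMod σ 𝔞 (Polynomial.C x * Polynomial.X ^ n) (Polynomial.C y * Polynomial.X ^ n) := by
  intro i
  rw [Polynomial.coeff_C_mul_X_pow, Polynomial.coeff_C_mul_X_pow]
  split_ifs
  · exact h
  · simpa using CongruentMod.intCast (σ := σ) (𝔞 := 𝔞) 0

theorem polyCongruentMod_one : PolyCongruentMod σ 𝔞 1 1 := by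
  simpa using (CongruentMod.intCast (σ := σ) (𝔞 := 𝔞) 1).poly 0

theorem polyCongruentMod_eulerPolyGood (k p : ℕ) {x y x' y' : ℂ} (h : CongruentMod σ 𝔞 x y)
    (h' : CongruentMod σ 𝔞 x' y') :
    PolyCongruentMod σ 𝔞 (eulerPolyGood k p x x') (eulerPolyGood k p y y') := by
  have hc : ∀ z : ℤ, CongruentMod σ 𝔞 (z : ℂ) z := CongruentMod.intCast
  have h1 := (h.poly 1)
  have h2 := ((((hc p).mul h').add (hc (p ^ (2 * k - 5) * (1 + p ^ 2)))).poly 2)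
  have h3 := ((hc (p ^ (2 * k - 3))).mul h).poly 3
  have h4 := (hc (p ^ (4 * k - 6))).poly 4
  have h5 := (((polyCongruentMod_one.sub h1).add h2).sub h3).add h4
  push_cast [pow_one] at h5
  exact h5

theorem polyCongruentMod_eulerPolyBad (k p : ℕ) (ε : ℤ) {x y x' y' : ℂ}
    (h : CongruentMod σ 𝔞 x y) (h' : CongruentMod σ 𝔞 x' y') :
    PolyCongruentMod σ 𝔞 (eulerPolyBad k p ε x x') (eulerPolyBad k p ε y y') := by
  have hc : ∀ z : ℤ, CongruentMod σ 𝔞 (z : ℂ) z := CongruentMod.intCast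
  have h1 := ((h.add (hc (p ^ (k - 3) * ε))).poly 1)
  have h2 := ((((hc p).mul h').add (hc (p ^ (2 * k - 3)))).poly 2)
  have h3 := (hc (p ^ (3 * k - 5) * ε)).poly 3
  have h5 := ((polyCongruentMod_one.sub h1).add h2).add h3
  push_cast [pow_one] at h5
  exact h5

/-- If multiplication by `κ` maps each member of a nonzero family of algebraic integers to an
integral linear combination of the family, then `κ` is an algebraic integer. -/
theorem isIntegral_of_mul_mem {ι : Type*} (b : ι → 𝓞 K) {κ : K} (ℓ : ι → ι →₀ ℤ)
    (h : ∀ T, κ * b T = (Finsupp.linearCombination ℤ b (ℓ T) : 𝓞 K)) {t₀ : ι} (h₀ : b t₀ ≠ 0) :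
    IsIntegral ℤ κ := by
  let φ : 𝓞 K →ₗ[ℤ] K := (Algebra.linearMap (𝓞 K) K).restrictScalars ℤ
  let M : Submodule ℤ K := (Submodule.span ℤ (Set.range b)).map φ
  have hM : M.FG := (IsNoetherian.noetherian (Submodule.span ℤ (Set.range b))).map φ
  have hmem : ∀ x ∈ Submodule.span ℤ (Set.range b), κ * (x : K) ∈ M := by
    intro x hx
    induction hx using Submodule.span_induction with
    | mem x hx =>
      obtain ⟨T, rfl⟩ := hx
      rw [h T]
      refine Submodule.mem_map_of_mem (f := φ) ?_
      rw [← Finsupp.range_linearCombination]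
      exact ⟨ℓ T, rfl⟩
    | zero => simp
    | add x y _ _ hx hy => simpa [mul_add] using add_mem hx hy
    | smul z x _ hx => simpa [mul_left_comm] using M.smul_mem z hx
  refine isIntegral_of_smul_mem_submodule (N := M) ?_ hM κ ?_
  · intro hbot
    refine h₀ ?_
    have h1 : φ (b t₀) ∈ M := Submodule.mem_map_of_mem (Submodule.subset_span ⟨t₀, rfl⟩)
    rw [hbot, Submodule.mem_bot] at h1
    exact RingOfIntegers.coe_eq_zero_iff.1 h1
  · rintro _ ⟨x, hx, rfl⟩
    exact hmem x hx

/-- If two families, the first of integers generating the unit ideal, are congruent and are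
eigenvectors of the same integral matrix, then the eigenvalues are congruent. -/
theorem congruentMod_eigenvalue {ι : Type*} {a : ι → ℤ} {b : ι → 𝓞 K}
    (hunit : Ideal.span (Set.range a) = ⊤) (hcong : ∀ t, (a t : 𝓞 K) - b t ∈ 𝔞)
    {t₀ : ι} (h₀ : b t₀ ≠ 0) (ℓ : ι → ι →₀ ℤ) {lf lg : ℂ}
    (hf : ∀ T, lf * a T = Finsupp.linearCombination ℤ (fun t => (a t : ℂ)) (ℓ T))
    (hg : ∀ T, lg * σ (b T : K) = Finsupp.linearCombination ℤ (fun t => σ (b t : K)) (ℓ T)) :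
    CongruentMod σ 𝔞 lf lg := by
  obtain ⟨c, hc⟩ : ∃ c : ι →₀ ℤ, Finsupp.linearCombination ℤ a c = 1 := by
    have h1 : (1 : ℤ) ∈ Submodule.span ℤ (Set.range a) := by
      have h2 : (1 : ℤ) ∈ Ideal.span (Set.range a) := hunit ▸ Submodule.mem_top
      exact h2
    rw [← Finsupp.range_linearCombination] at h1
    exact h1
  set A : ι → ℤ := fun T => Finsupp.linearCombination ℤ a (ℓ T) with hA
  set B : ι → 𝓞 K := fun T => Finsupp.linearCombination ℤ b (ℓ T) with hB
  have castZ : ∀ (x : ι → ℤ) (l : ι →₀ ℤ), ((Finsupp.linearCombination ℤ x l : ℤ) : ℂ)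
      = Finsupp.linearCombination ℤ (fun t => (x t : ℂ)) l := fun x l => by
    simp [Finsupp.linearCombination_apply, Finsupp.sum]
  have castO : ∀ (x : ι → 𝓞 K) (l : ι →₀ ℤ), σ ((Finsupp.linearCombination ℤ x l : 𝓞 K) : K)
      = Finsupp.linearCombination ℤ (fun t => σ (x t : K)) l := fun x l => by
    simp [Finsupp.linearCombination_apply, Finsupp.sum]
  have hlf : lf = ((Finsupp.linearCombination ℤ A c : ℤ) : ℂ) := by
    have h1 : lf * ((Finsupp.linearCombination ℤ a c : ℤ) : ℂ)
        = ((Finsupp.linearCombination ℤ A c : ℤ) : ℂ) := by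
      rw [castZ, castZ, Finsupp.linearCombination_apply, Finsupp.linearCombination_apply,
        Finsupp.sum, Finsupp.sum, Finset.mul_sum]
      refine Finset.sum_congr rfl fun t _ => ?_
      rw [castZ, ← hf, zsmul_eq_mul, zsmul_eq_mul, mul_left_comm]
    rwa [hc, Int.cast_one, mul_one] at h1
  have h₀K : (b t₀ : K) ≠ 0 := fun h => h₀ (RingOfIntegers.coe_eq_zero_iff.1 h)
  have hlg : σ ((B t₀ : K) / b t₀) = lg := by
    rw [map_div₀, div_eq_iff (by simpa using h₀K), hg, castO]
  have hκ : ∀ T, (B t₀ : K) / b t₀ * b T = B T := fun T => σ.injective (by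
    rw [map_mul, hlg, hg, castO])
  obtain ⟨v, hv⟩ : ∃ v : 𝓞 K, (v : K) = (B t₀ : K) / b t₀ :=
    ⟨⟨_, isIntegral_of_mul_mem b ℓ hκ h₀⟩, rfl⟩
  have hvB : ∀ T, v * b T = B T := fun T => RingOfIntegers.ext (by simpa [hv] using hκ T)
  refine ⟨Finsupp.linearCombination ℤ A c, v, hlf.symm, by rw [hv, hlg], ?_⟩
  have hAB := linearCombination_sub_mem (I := 𝔞) (x := A) (y := B)
    (fun T => linearCombination_sub_mem hcong (ℓ T)) c
  have h1 := linearCombination_sub_mem (I := 𝔞) hcong c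
  have h2 : v * Finsupp.linearCombination ℤ b c = Finsupp.linearCombination ℤ B c := by
    rw [Finsupp.linearCombination_apply, Finsupp.linearCombination_apply, Finsupp.sum, Finsupp.sum,
      Finset.mul_sum]
    exact Finset.sum_congr rfl fun t _ => by rw [mul_smul_comm, hvB]
  have h3 := sub_mem hAB (𝔞.mul_mem_left v h1)
  convert h3 using 1
  rw [mul_sub, h2, hc]
  simp

end Congruence

end Paramodular

end

theorem lemma4p5 (k N p : ℕ) (hk : 3 ≤ k) (hN : 0 < N) (hp : p.Prime) (hpN : ¬ p ^ 2 ∣ N)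
    {K : Type*} [Field K] [NumberField K] (σ : K →+* ℂ)
    (f g : Matrix (Fin 2) (Fin 2) ℂ → ℂ)
    (hf : Paramodular.IsCuspForm k N f) (hg : Paramodular.IsCuspForm k N g)
    (ε : ℤ) (hε : ε = 1 ∨ ε = -1)
    (hfε : Paramodular.HasFrickeSign k N f ε) (hgε : Paramodular.HasFrickeSign k N g ε)
    (εp : ℤ) (hεp : εp = 1 ∨ εp = -1)
    (hfεp : p ∣ N → Paramodular.HasAtkinLehnerSign k N p f εp)
    (hgεp : p ∣ N → Paramodular.HasAtkinLehnerSign k N p g εp)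
    (a : Paramodular.indexSemi N → ℤ) (b : Paramodular.indexSemi N → NumberField.RingOfIntegers K)
    (ha : Paramodular.HasFourierCoeffs N f (fun t => (a t : ℂ)))
    (hb : Paramodular.HasFourierCoeffs N g (fun t => σ (b t : K)))
    (hunit : Ideal.span (Set.range a) = ⊤)
    (𝔞 : Ideal (NumberField.RingOfIntegers K))
    (hcong : ∀ t : Paramodular.indexSemi N, (t : ℤ × ℤ × ℤ) ∈ Paramodular.indexDef N →
      (a t : NumberField.RingOfIntegers K) - b t ∈ 𝔞) :
    -- the eigenvalues of each single operator are congruent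
    (∀ d : Paramodular.Ix → ℝ,
      (d = Paramodular.diagT p ∨ d = Paramodular.diagSecond N p) →
      ∀ lf lg : ℂ, Paramodular.IsEigenform k N d f lf → Paramodular.IsEigenform k N d g lg →
        Paramodular.CongruentMod σ 𝔞 lf lg) ∧
    -- for eigenforms of both operators, the Euler polynomials are congruent
    (∀ lf lg lf' lg' : ℂ,
      Paramodular.IsEigenform k N (Paramodular.diagT p) f lf →
      Paramodular.IsEigenform k N (Paramodular.diagT p) g lg →
      Paramodular.IsEigenform k N (Paramodular.diagSecond N p) f lf' →
      Paramodular.IsEigenform k N (Paramodular.diagSecond N p) g lg' →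
        (¬ p ∣ N → Paramodular.PolyCongruentMod σ 𝔞
          (Paramodular.eulerPolyGood k p lf lf') (Paramodular.eulerPolyGood k p lg lg')) ∧
        (p ∣ N → Paramodular.PolyCongruentMod σ 𝔞
          (Paramodular.eulerPolyBad k p εp lf lf') (Paramodular.eulerPolyBad k p εp lg lg'))) := by
  -- the congruence extends to the singular indices, where both sides vanish
  have hcong' : ∀ t, (a t : NumberField.RingOfIntegers K) - b t ∈ 𝔞 := by
    intro t
    by_cases ht : (t : ℤ × ℤ × ℤ) ∈ Paramodular.indexDef N
    · exact hcong t ht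
    · have h1 := hf.coeff_eq_zero hN ha ht
      have h2 := hg.coeff_eq_zero hN hb ht
      have h3 : a t = 0 := by exact_mod_cast h1
      have h4 : b t = 0 := by simpa using h2
      simp [h3, h4]
  have key : ∀ d : Paramodular.Ix → ℝ,
      (d = Paramodular.diagT p ∨ d = Paramodular.diagSecond N p) →
      ∀ lf lg : ℂ, Paramodular.IsEigenform k N d f lf → Paramodular.IsEigenform k N d g lg →
        Paramodular.CongruentMod σ 𝔞 lf lg := by
    intro d hd lf lg hlf hlg
    obtain ⟨μ, hμ, hdiag⟩ : ∃ μ, 0 < μ ∧ Paramodular.IsHeckeDiag ((p ^ μ : ℕ) : ℤ) d := by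
      rcases hd with rfl | rfl
      · exact ⟨1, one_pos, Paramodular.isHeckeDiag_diagT p⟩
      · exact ⟨2, two_pos, Paramodular.isHeckeDiag_diagSecond N p⟩
    obtain ⟨ℓ, hℓ⟩ := Paramodular.exists_integral_hecke_formula hN hp hpN hμ hk hdiag
    obtain ⟨t₀, ht₀⟩ : ∃ t₀, b t₀ ≠ 0 := by
      by_contra! hzero
      obtain ⟨Ω, hΩ, hne⟩ := hlg.1
      refine hne ((hb Ω hΩ).unique ?_)
      simp [hzero, hasSum_zero]
    exact Paramodular.congruentMod_eigenvalue hunit hcong' ht₀ ℓ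
      (hℓ f _ lf hf.toIsParamodularForm ha hlf.2) (hℓ g _ lg hg.toIsParamodularForm hb hlg.2)
  refine ⟨key, fun lf lg lf' lg' h1 h2 h3 h4 => ⟨fun _ => ?_, fun _ => ?_⟩⟩
  · exact Paramodular.polyCongruentMod_eulerPolyGood k p (key _ (Or.inl rfl) _ _ h1 h2)
      (key _ (Or.inr rfl) _ _ h3 h4)
  · exact Paramodular.polyCongruentMod_eulerPolyBad k p εp (key _ (Or.inl rfl) _ _ h1 h2)
      (key _ (Or.inr rfl) _ _ h3 h4)
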